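/- Let $\mathcal A$ be a finite alphabet with $|\mathcal A|\ge 2$, let $\mathcal A^*$ be the set of finite strings over $\mathcal A$, and let $(p_\alpha)_{\alpha\in\mathcal A}$ be a probability distribution on $\mathcal A$ with $p_\alpha>0$ for all $\alpha$. The \emph{trie} generated by a finite set $S$ of infinite strings over $\mathcal A$ is the set $T\subset\mathcal A^*$ of all $\boldsymbol\alpha\in\mathcal A^*$ such that, with $n_{\boldsymbol\alpha}$ the number of strings in $S$ having prefix $\boldsymbol\alpha$, either $n_{\boldsymbol\alpha}\ge2$, or $n_{\boldsymbol\alpha}=1$ and $\boldsymbol\alpha$ is either the empty string or has a parent $\boldsymbol\beta$ ($\boldsymbol\alpha$ with its last letter removed) with $n_{\boldsymbol\beta}\ge2$. For a trie $T$ and $v\in\mathcal A^*$, the fringe tree is the trie $T^v=\{\boldsymbol\beta\in\mathcal A^*: v\boldsymbol\beta\in T\}$. Let $\varphi$ be a real-valued function on the set of all tries (a toll function) with $\varphi(\emptyset)=0$, and let $\Phi(T)=\sum_{v\in T}\varphi(T^v)$ be the corresponding additive functional. For $\lambda>0$ let $T_\lambda$ be the random trie generated by $\Xi^{(1)},\dots,\Xi^{(N_\lambda)}$,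 where $\Xi^{(1)},\Xi^{(2)},\dots$ are i.i.d. infinite strings whose letters are i.i.d. with distribution $(p_\alpha)$, and $N_\lambda\sim\mathrm{Po}(\lambda)$ is independent of the strings. For real random variables $X_\lambda,Y_\lambda$, write $X_\lambda\overset{d}{\approx}Y_\lambda$ (as $\lambda\to\infty$) if $\mathbb E f(X_\lambda)=\mathbb E f(Y_\lambda)+o(1)$ for every bounded continuous $f:\mathbb R\to\mathbb R$. This holds \emph{with all (absolute) moments of order $s<r$} if moreover $\mathbb E|X_\lambda|^s=\mathbb E|Y_\lambda|^s+o(1)$ for every real $0<s<r$ and $\mathbb E X_\lambda^k=\mathbb E Y_\lambda^k+o(1)$ for every integer $1\le k<r$, all these moments being finite for large $\lambda$; convergence of all (absolute) moments of order $s<r$ is defined in the same way, with $Y_\lambda$ replaced by the limit. We write $N(0,\sigma^2)$ also for a random variable with that distribution, and read $N(0,v)$ as the point mass at $0$ if $v\le0$. Let $a(\lambda)$ and $b(\lambda)$ be real-valued functions, and suppose that for some real $r>2$, as $\lambda\to\infty$, \begin{align*} \mathbb E\,\Phi(T_\lambda)&=a(\lambda)+o(\sqrt\lambda),\\ \operatorname{Var}\Phi(T_\lambda)&=b(\lambda)+o(\lambda),\\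 \operatorname{Var}\Phi(T_\lambda)&=O(\lambda),\\ \operatorname{Var}\varphi(T_\lambda)&=o(\lambda),\\ \mathbb E\,|\varphi(T_\lambda)-\mathbb E\,\varphi(T_\lambda)|^r&=O(\lambda^{r/2}), \end{align*} where the last expectation is finite for all large $\lambda$. (i) Then, as $\lambda\to\infty$, $$\frac{\Phi(T_\lambda)-a(\lambda)}{\sqrt\lambda}\overset{d}{\approx}N\bigl(0,b(\lambda)/\lambda\bigr) \quad\text{and}\quad \frac{\Phi(T_\lambda)-\mathbb E\,\Phi(T_\lambda)}{\sqrt\lambda}\overset{d}{\approx}N\bigl(0,\operatorname{Var}[\Phi(T_\lambda)]/\lambda\bigr),$$ in both cases with all (absolute) moments of order $s<r$. (ii) Suppose further that $b(\lambda)=\Omega(\lambda)$, i.e. that there is $c>0$ with $b(\lambda)\ge c\lambda$ for all large $\lambda$. Then, as $\lambda\to\infty$, $$\frac{\Phi(T_\lambda)-a(\lambda)}{\sqrt{b(\lambda)}}\overset{d}{\longrightarrow}N(0,1) \quad\text{and}\quad \frac{\Phi(T_\lambda)-\mathbb E\,\Phi(T_\lambda)}{\sqrt{\operatorname{Var}\Phi(T_\lambda)}}\overset{d}{\longrightarrow}N(0,1),$$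 in both cases with convergence of all (absolute) moments of order $s<r$. -/

import Mathlib

open MeasureTheory ProbabilityTheory Filter Topology Asymptotics
open scoped NNReal ENNReal BoundedContinuousFunction

noncomputable section

namespace Tries

/-- The finite string `α` is a prefix of the infinite string `ξ`. -/
def IsPrefixOf {A : Type*} (α : List A) (ξ : ℕ → A) : Prop :=
  ∀ i : Fin α.length, α.get i = ξ i

open Classical in
/-- The number of strings in the set `S` that have `α` as a prefix. -/
def prefixCount {A : Type*} (S : Finset (ℕ → A)) (α : List A) : ℕ :=
  (S.filter (IsPrefixOf α)).card

/-- `α` is a node of the trie generated by the finite set `S` of infinite strings: either at least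
two strings pass through `α` (internal node), or exactly one does and `α` is the root or its parent
`α.dropLast` is an internal node (external node). -/
def IsTrieNode {A : Type*} (S : Finset (ℕ → A)) (α : List A) : Prop :=
  2 ≤ prefixCount S α ∨
    (prefixCount S α = 1 ∧ (α = [] ∨ 2 ≤ prefixCount S α.dropLast))

/-- A finite set of nodes is a trie if it is generated by some finite set of infinite strings. -/
def IsTrie {A : Type*} (T : Finset (List A)) : Prop :=
  ∃ S : Finset (ℕ → A), ∀ α, α ∈ T ↔ IsTrieNode S α

/-- The set of all tries over the alphabet `A`, each identified with its set of nodes. -/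
abbrev Trie (A : Type*) : Type _ := {T : Finset (List A) // IsTrie T}

lemma exists_separating_length {A : Type*} (S : Finset (ℕ → A)) :
    ∃ L : ℕ, ∀ ξ ∈ S, ∀ η ∈ S, (∀ i < L, ξ i = η i) → ξ = η := by
  have h : ∀ q : (ℕ → A) × (ℕ → A), ∃ L : ℕ, (∀ i < L, q.1 i = q.2 i) → q.1 = q.2 := by
    intro q
    by_cases hq : q.1 = q.2
    · exact ⟨0, fun _ => hq⟩
    · obtain ⟨i, hi⟩ := Function.ne_iff.mp hq
      exact ⟨i + 1, fun h => absurd (h i (Nat.lt_succ_self i)) hi⟩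
  choose f hf using h
  refine ⟨(S ×ˢ S).sup f, fun ξ hξ η hη h => hf (ξ, η) fun i hi => h i (lt_of_lt_of_le hi ?_)⟩
  exact Finset.le_sup (f := f) (Finset.mk_mem_product hξ hη)

lemma length_le_of_two_le_prefixCount {A : Type*} {S : Finset (ℕ → A)} {L : ℕ}
    (hL : ∀ ξ ∈ S, ∀ η ∈ S, (∀ i < L, ξ i = η i) → ξ = η) {α : List A}
    (h : 2 ≤ prefixCount S α) : α.length ≤ L := by
  classical
  by_contra! hlt
  obtain ⟨ξ, hξ, η, hη, hne⟩ := Finset.one_lt_card.mp (show 1 < _ from h)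
  rw [Finset.mem_filter] at hξ hη
  refine hne (hL ξ hξ.1 η hη.1 fun i hi => ?_)
  exact (hξ.2 ⟨i, hi.trans hlt⟩).symm.trans (hη.2 ⟨i, hi.trans hlt⟩)

lemma finite_trieNodes {A : Type*} [Finite A] (S : Finset (ℕ → A)) :
    {α | IsTrieNode S α}.Finite := by
  obtain ⟨L, hL⟩ := exists_separating_length S
  refine (List.finite_length_le A (L + 1)).subset ?_
  rintro α (h | ⟨-, rfl | h⟩)
  · exact (length_le_of_two_le_prefixCount hL h).trans (Nat.le_succ L)
  · simp
  · have := length_le_of_two_le_prefixCount hL h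
    rw [List.length_dropLast] at this
    simp only [Set.mem_ofPred_eq]
    omega

/-- The trie generated by the finite set `S` of infinite strings. -/
def trieOf {A : Type*} [Finite A] (S : Finset (ℕ → A)) : Trie A :=
  ⟨(finite_trieNodes S).toFinset, S, fun α => by simp⟩

/-- The empty trie. -/
def emptyTrie (A : Type*) : Trie A :=
  ⟨∅, ∅, fun α => by simp [IsTrieNode, prefixCount]⟩

lemma isPrefixOf_append {A : Type*} {α β : List A} {ξ : ℕ → A} :
    IsPrefixOf (α ++ β) ξ ↔ IsPrefixOf α ξ ∧ IsPrefixOf β (fun i => ξ (α.length + i)) := by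
  constructor
  · intro h
    refine ⟨fun i => ?_, fun i => ?_⟩
    · have := h ⟨i, by simp; omega⟩
      simpa [List.getElem_append_left] using this
    · have := h ⟨α.length + i, by simp⟩
      simpa [List.getElem_append_right] using this
  · rintro ⟨h₁, h₂⟩ ⟨i, hi⟩
    rw [List.length_append] at hi
    by_cases hlt : i < α.length
    · simpa [List.getElem_append_left, hlt] using h₁ ⟨i, hlt⟩
    · have := h₂ ⟨i - α.length, by omega⟩
      simp only [List.get_eq_getElem] at this ⊢
      rw [List.getElem_append_right (by omega), this]
      congr 1
      omega

lemma prefixCount_append_le {A : Type*} (S : Finset (ℕ → A)) (α β : List A) :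
    prefixCount S (α ++ β) ≤ prefixCount S α := by
  classical
  exact Finset.card_le_card
    (Finset.monotone_filter_right S fun ξ _ h => (isPrefixOf_append.mp h).1)

lemma exists_shifted {A : Type*} (S : Finset (ℕ → A)) (α : List A) :
    ∃ S' : Finset (ℕ → A), ∀ β, prefixCount S' β = prefixCount S (α ++ β) := by
  classical
  refine ⟨(S.filter (IsPrefixOf α)).image fun ξ i => ξ (α.length + i), fun β => ?_⟩
  unfold prefixCount
  rw [Finset.filter_image, Finset.card_image_of_injOn, Finset.filter_filter]
  · congr 1
    ext ξ
    simp only [Finset.mem_filter, isPrefixOf_append]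
  · intro ξ hξ η hη h
    simp only [Finset.coe_filter, Finset.mem_filter, Set.mem_ofPred_eq] at hξ hη
    funext i
    by_cases hi : i < α.length
    · exact (hξ.1.2 ⟨i, hi⟩).symm.trans (hη.1.2 ⟨i, hi⟩)
    · have := congrFun h (i - α.length)
      simpa [Nat.add_sub_cancel' (not_lt.mp hi)] using this

lemma isTrieNode_of_append {A : Type*} {S : Finset (ℕ → A)} {α β : List A}
    (h : IsTrieNode S (α ++ β)) : IsTrieNode S α := by
  by_cases hβ : β = []
  · simpa [hβ] using h
  · left
    rcases h with h | ⟨-, h | h⟩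
    · exact h.trans (prefixCount_append_le S α β)
    · simp [hβ] at h
    · rw [List.dropLast_append_of_ne_nil hβ] at h
      exact h.trans (prefixCount_append_le S α _)

lemma isTrie_fringe {A : Type*} {T : Finset (List A)} (hT : IsTrie T) (α : List A) :
    IsTrie (T.preimage (fun β => α ++ β) (List.append_right_injective α).injOn) := by
  obtain ⟨S, hS⟩ := hT
  by_cases hα : IsTrieNode S α
  · obtain ⟨S', hS'⟩ := exists_shifted S α
    refine ⟨S', fun β => ?_⟩
    rw [Finset.mem_preimage, hS]
    by_cases hβ : β = []
    · subst hβ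
      simp only [IsTrieNode, hS', List.append_nil]
      unfold IsTrieNode at hα
      tauto
    · simp only [IsTrieNode, hS', List.dropLast_append_of_ne_nil hβ, List.append_eq_nil_iff, hβ,
        and_false]
  · refine ⟨∅, fun β => ?_⟩
    rw [Finset.mem_preimage, hS]
    refine iff_of_false (fun h => hα (isTrieNode_of_append h)) ?_
    simp [IsTrieNode, prefixCount]

/-- The fringe tree `T^α = {β : αβ ∈ T}` of a trie, again a trie (empty if `α ∉ T`). -/
def fringe {A : Type*} (T : Trie A) (α : List A) : Trie A :=
  ⟨T.1.preimage (fun β => α ++ β) (List.append_right_injective α).injOn, isTrie_fringe T.2 α⟩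

/-- The additive functional with toll function `φ`: the sum of `φ(T^v)` over all nodes `v` of `T`. -/
def additiveFunctional {A : Type*} (φ : Trie A → ℝ) (T : Trie A) : ℝ :=
  ∑ v ∈ T.1, φ (fringe T v)

open Classical in
/-- The trie generated by the first `n` strings of the sequence `Ξ`. -/
def fixedTrie {A : Type*} [Finite A] (n : ℕ) (Ξ : ℕ → ℕ → A) : Trie A :=
  trieOf ((Finset.range n).image Ξ)

/-- The law of an i.i.d. sequence of infinite strings, with i.i.d. letters of distribution `p`. -/
def stringsLaw {A : Type*} [MeasurableSpace A] (p : PMF A) : Measure (ℕ → ℕ → A) :=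
  Measure.infinitePi fun _ : ℕ => Measure.infinitePi fun _ : ℕ => p.toMeasure

instance {A : Type*} [MeasurableSpace A] (p : PMF A) : IsProbabilityMeasure (stringsLaw p) := by
  unfold stringsLaw
  infer_instance

/-- The Poisson model: a pair `(N, Ξ)`, where `N` is Poisson distributed with mean `t` and
independent of the random strings `Ξ`. -/
def poissonModel {A : Type*} [MeasurableSpace A] (p : PMF A) (t : ℝ≥0) :
    Measure (ℕ × (ℕ → ℕ → A)) :=
  (poissonMeasure t).prod (stringsLaw p)

instance {A : Type*} [MeasurableSpace A] (p : PMF A) (t : ℝ≥0) :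
    IsProbabilityMeasure (poissonModel p t) := by
  unfold poissonModel
  infer_instance

/-- The random trie of the Poisson model, generated by the first `N` strings. -/
def poissonTrie {A : Type*} [Finite A] (ω : ℕ × (ℕ → ℕ → A)) : Trie A :=
  fixedTrie ω.1 ω.2

/-- The mean of `ψ` of the random trie in the Poisson model. -/
def poissonMean {A : Type*} [Finite A] [MeasurableSpace A] (p : PMF A) (ψ : Trie A → ℝ)
    (t : ℝ≥0) : ℝ :=
  ∫ ω, ψ (poissonTrie ω) ∂(poissonModel p t)

/-- The variance of `ψ` of the random trie in the Poisson model. -/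
def poissonVar {A : Type*} [Finite A] [MeasurableSpace A] (p : PMF A) (ψ : Trie A → ℝ)
    (t : ℝ≥0) : ℝ :=
  variance (fun ω => ψ (poissonTrie ω)) (poissonModel p t)

/-- `X i ≈ Y i` in distribution along the filter `l`: for every bounded continuous `f`,
`E f(X i) = E f(Y i) + o(1)`. -/
def ApproxInDistribution {ι Ω Ω' : Type*} [MeasurableSpace Ω] [MeasurableSpace Ω'] (l : Filter ι)
    (P : ι → Measure Ω) (X : ι → Ω → ℝ) (Q : ι → Measure Ω') (Y : ι → Ω' → ℝ) : Prop :=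
  ∀ f : ℝ →ᵇ ℝ,
    Tendsto (fun i => ∫ ω, f (X i ω) ∂(P i) - ∫ ω, f (Y i ω) ∂(Q i)) l (𝓝 0)

/-- `E |X i|^s = E |Y i|^s + o(1)` along `l`, with both sides finite. -/
def ApproxAbsMoment {ι Ω Ω' : Type*} [MeasurableSpace Ω] [MeasurableSpace Ω'] (l : Filter ι)
    (P : ι → Measure Ω) (X : ι → Ω → ℝ) (Q : ι → Measure Ω') (Y : ι → Ω' → ℝ) (s : ℝ) : Prop :=
  (∀ᶠ i in l, Integrable (fun ω => |X i ω| ^ s) (P i) ∧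
      Integrable (fun ω => |Y i ω| ^ s) (Q i)) ∧
    Tendsto (fun i => ∫ ω, |X i ω| ^ s ∂(P i) - ∫ ω, |Y i ω| ^ s ∂(Q i)) l (𝓝 0)

/-- `E (X i)^k = E (Y i)^k + o(1)` along `l`, with both sides finite. -/
def ApproxMoment {ι Ω Ω' : Type*} [MeasurableSpace Ω] [MeasurableSpace Ω'] (l : Filter ι)
    (P : ι → Measure Ω) (X : ι → Ω → ℝ) (Q : ι → Measure Ω') (Y : ι → Ω' → ℝ) (k : ℕ) : Prop :=
  (∀ᶠ i in l, Integrable (fun ω => X i ω ^ k) (P i) ∧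
      Integrable (fun ω => Y i ω ^ k) (Q i)) ∧
    Tendsto (fun i => ∫ ω, X i ω ^ k ∂(P i) - ∫ ω, Y i ω ^ k ∂(Q i)) l (𝓝 0)

/-- Approximation along `l` of all absolute moments of real order `0 < s < r`, and of all ordinary moments of
integer order `1 ≤ k < r`. -/
def ApproxMomentsBelow {ι Ω Ω' : Type*} [MeasurableSpace Ω] [MeasurableSpace Ω'] (l : Filter ι)
    (P : ι → Measure Ω) (X : ι → Ω → ℝ) (Q : ι → Measure Ω') (Y : ι → Ω' → ℝ) (r : ℝ) : Prop :=
  (∀ s : ℝ, 0 < s → s < r → ApproxAbsMoment l P X Q Y s) ∧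
    ∀ k : ℕ, 1 ≤ k → (k : ℝ) < r → ApproxMoment l P X Q Y k

end Tries

end

/-! Grouping the strings by their first letter turns the Poisson trie with mean `t` into independent
Poisson tries with means `p x * t`. Hence `Z = Φ(T_t)` satisfies `Z = Y + ∑ x, W x`, where `Y` is a
toll at the root and the `W x` are independent, `W x` being distributed as `Z` at mean `p x * t`
(`map_poissonSubtrie`, `additiveFunctional_trieOf`). Everything after that uses only this recursion
and moment bounds, collected in `RecursiveFamily`.

The normal approximation is a contraction argument. Let `e_t(u)` be the distance at `u` between the
characteristic function of `(Z - E Z) / √t` and that of the centred normal law with the same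
variance `v_t = Var Z / t`. As `Var Y = o(t)`, the first characteristic function is, up to `o(1)`,
the product over `x` of its values at mean `p x * t` and argument `√(p x) * u`. Likewise `v_t = ∑ x,
p x * v_{p x * t} + o(1)`, so the normal one obeys the same approximate recursion, and `e_t(u) ≤ ∑
x, e_{p x * t}(√(p x) * u) + o(1)`. The first two moments agree, so `e_t(u) ≤ C |u| ^ s` with `s =
min r 3 > 2`; each use of the recursion multiplies this bound by `∑ x, p x ^ (s / 2) < 1`, whence
`e_t(u) → 0` (`tendsto_charFun_sub`). The ratio `v_t` may oscillate; its convergence is never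
needed.

The constant `C` requires `E |Z - E Z| ^ r = O(t ^ (r / 2))`. This is a second contraction, with
factor `∑ x, p x ^ (r / 2) < 1`: in the `r`-th moment of a sum of independent terms, the cross terms
grow more slowly than linearly in the constant to be bounded (`exists_integral_rpow_le`). That these
moments are finite at all is shown beforehand, by truncating the functional in depth and comparing
Poisson weights (`lintegral_additiveFunctional_rpow_lt_top`).

Lévy's continuity theorem along subsequences with convergent variances then gives approximation in
distribution, and bounded moments of order `r` give uniform integrability of all lower powers. Part
(ii) is a change of scale by `√(t / b t)`. -/

noncomputable section

namespace Tries

variable {A : Type*}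

/-! ### Decomposition of a trie at its root -/

open Classical in
/-- The strings of `S` that start with the letter `x`, with that letter removed. -/
def childSet (S : Finset (ℕ → A)) (x : A) : Finset (ℕ → A) :=
  (S.filter fun ξ => ξ 0 = x).image fun ξ i => ξ (i + 1)

lemma isPrefixOf_nil (ξ : ℕ → A) : IsPrefixOf [] ξ := fun i => i.elim0

lemma isPrefixOf_cons {x : A} {β : List A} {ξ : ℕ → A} :
    IsPrefixOf (x :: β) ξ ↔ ξ 0 = x ∧ IsPrefixOf β fun i => ξ (i + 1) := by
  constructor
  · intro h
    exact ⟨(h ⟨0, by simp⟩).symm, fun i => h ⟨i + 1, by simp⟩⟩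
  · rintro ⟨h₁, h₂⟩ ⟨i, hi⟩
    cases i with
    | zero => exact h₁.symm
    | succ i => exact h₂ ⟨i, by simpa using hi⟩

lemma prefixCount_nil (S : Finset (ℕ → A)) : prefixCount S [] = S.card := by
  simp [prefixCount, isPrefixOf_nil]

lemma childSet_injOn (S : Finset (ℕ → A)) (x : A) :
    Set.InjOn (fun (ξ : ℕ → A) i => ξ (i + 1)) {ξ | ξ ∈ S ∧ ξ 0 = x} := by
  rintro ξ ⟨-, hξ⟩ η ⟨-, hη⟩ h
  funext i
  cases i with
  | zero => exact hξ.trans hη.symm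
  | succ i => exact congrFun h i

lemma prefixCount_childSet (S : Finset (ℕ → A)) (x : A) (β : List A) :
    prefixCount (childSet S x) β = prefixCount S (x :: β) := by
  classical
  unfold prefixCount childSet
  rw [Finset.filter_image, Finset.card_image_of_injOn, Finset.filter_filter]
  · congr 1
    ext ξ
    simp only [Finset.mem_filter, isPrefixOf_cons]
  · refine (childSet_injOn S x).mono fun ξ hξ => ?_
    simp only [Finset.coe_filter, Finset.mem_filter, Set.mem_ofPred_eq] at hξ ⊢
    exact hξ.1

lemma sum_card_childSet [Fintype A] (S : Finset (ℕ → A)) :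
    ∑ x, (childSet S x).card = S.card := by
  classical
  rw [Finset.card_eq_sum_card_fiberwise (f := fun ξ : ℕ → A => ξ 0) (t := Finset.univ)
    fun _ _ => by simp]
  refine Finset.sum_congr rfl fun x _ => ?_
  rw [childSet, Finset.card_image_of_injOn]
  refine (childSet_injOn S x).mono fun ξ hξ => ?_
  simpa using hξ

/-- With at least two strings the root is internal. The node `[x]` therefore satisfies the parent
condition automatically, which matches the exemption of the root in the child trie. -/
lemma isTrieNode_cons {S : Finset (ℕ → A)} (hS : 2 ≤ S.card) (x : A) (β : List A) :
    IsTrieNode S (x :: β) ↔ IsTrieNode (childSet S x) β := by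
  unfold IsTrieNode
  rcases β with _ | ⟨y, β⟩
  · have h := prefixCount_childSet S x []
    rw [prefixCount_nil] at h
    simp [prefixCount_nil, hS, h]
  · simp [prefixCount_childSet]

lemma isTrieNode_cons_of_card_le_one {S : Finset (ℕ → A)} (hS : S.card ≤ 1) (x : A)
    (β : List A) : ¬ IsTrieNode S (x :: β) := by
  have h : ∀ γ, prefixCount S γ ≤ 1 := fun γ =>
    (prefixCount_append_le S [] γ).trans (by rwa [prefixCount_nil])
  rintro (h' | ⟨-, h' | h'⟩)
  · have := h (x :: β); omega
  · simp at h'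
  · have := h (x :: β).dropLast; omega

lemma isTrieNode_nil {S : Finset (ℕ → A)} : IsTrieNode S [] ↔ S.Nonempty := by
  rw [IsTrieNode, ← Finset.card_pos, prefixCount_nil]
  simp only [true_or, and_true]
  omega

/-- The trie consisting of the root only. -/
def IsLeaf (T : Trie A) : Prop := T.1 = {[]}

lemma fringe_nil (T : Trie A) : fringe T [] = T := by
  apply Subtype.ext
  ext γ
  simp [fringe]

lemma card_childSet_le [Fintype A] (S : Finset (ℕ → A)) (x : A) : (childSet S x).card ≤ S.card := by
  rw [← sum_card_childSet S]
  exact Finset.single_le_sum (f := fun x => (childSet S x).card) (fun _ _ => Nat.zero_le _)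
    (Finset.mem_univ x)

open Classical in
/-- The toll function `φ`, set to `0` on the trie of a single string. -/
def innerToll (φ : Trie A → ℝ) (T : Trie A) : ℝ := if IsLeaf T then 0 else φ T

lemma innerToll_of_isLeaf (φ : Trie A → ℝ) {T : Trie A} (h : IsLeaf T) : innerToll φ T = 0 :=
  if_pos h

lemma innerToll_emptyTrie {φ : Trie A → ℝ} (hφ : φ (emptyTrie A) = 0) :
    innerToll φ (emptyTrie A) = 0 := by
  simp [innerToll, hφ]

lemma additiveFunctional_emptyTrie (φ : Trie A → ℝ) :
    additiveFunctional φ (emptyTrie A) = 0 := by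
  simp [additiveFunctional, emptyTrie]

lemma fringe_of_isLeaf {T : Trie A} (h : IsLeaf T) (x : A) : fringe T [x] = emptyTrie A := by
  apply Subtype.ext
  ext γ
  simp [fringe, show T.1 = {[]} from h, emptyTrie]

/-! ### Tries generated by finite sets of strings -/

section Finite

variable [Finite A]

lemma mem_trieOf {S : Finset (ℕ → A)} {α : List A} : α ∈ (trieOf S).1 ↔ IsTrieNode S α := by
  simp [trieOf]

lemma isLeaf_iff_card {S : Finset (ℕ → A)} : IsLeaf (trieOf S) ↔ S.card = 1 := by
  constructor
  · intro h
    have h0 : IsTrieNode S [] := by rw [← mem_trieOf, show (trieOf S).1 = {[]} from h]; simp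
    have hpos := Finset.card_pos.mpr (isTrieNode_nil.mp h0)
    by_contra hne
    have h2 : 2 ≤ S.card := by omega
    obtain ⟨ξ, hξ⟩ := isTrieNode_nil.mp h0
    have : ([ξ 0] : List A) ∈ (trieOf S).1 := by
      rw [mem_trieOf, isTrieNode_cons h2, isTrieNode_nil]
      classical
      exact ⟨_, Finset.mem_image_of_mem _ (Finset.mem_filter.mpr ⟨hξ, rfl⟩)⟩
    rw [show (trieOf S).1 = {[]} from h] at this
    simp at this
  · intro h
    ext α
    rw [mem_trieOf, Finset.mem_singleton]
    rcases α with _ | ⟨x, β⟩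
    · simp [isTrieNode_nil, ← Finset.card_pos, h]
    · simp [isTrieNode_cons_of_card_le_one h.le]

lemma trieOf_eq_emptyTrie_iff {S : Finset (ℕ → A)} : trieOf S = emptyTrie A ↔ S = ∅ := by
  constructor
  · intro h
    by_contra hS
    have := mem_trieOf.mpr (isTrieNode_nil.mpr (Finset.nonempty_iff_ne_empty.mpr hS))
    rw [h] at this
    simp [emptyTrie] at this
  · rintro rfl
    apply Subtype.ext
    ext α
    rw [mem_trieOf]
    simp [emptyTrie, IsTrieNode, prefixCount]

lemma fringe_trieOf {S : Finset (ℕ → A)} (hS : 2 ≤ S.card) (x : A) (β : List A) :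
    fringe (trieOf S) (x :: β) = fringe (trieOf (childSet S x)) β := by
  apply Subtype.ext
  ext γ
  simp only [fringe, Finset.mem_preimage, mem_trieOf, List.cons_append, isTrieNode_cons hS]

lemma fringe_trieOf_singleton {S : Finset (ℕ → A)} (hS : 2 ≤ S.card) (x : A) :
    fringe (trieOf S) [x] = trieOf (childSet S x) := by
  rw [fringe_trieOf hS, fringe_nil]

lemma fringe_trieOf_of_card_le_one {S : Finset (ℕ → A)} (hS : S.card ≤ 1) (x : A) :
    fringe (trieOf S) [x] = emptyTrie A := by
  apply Subtype.ext
  ext γ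
  simp [fringe, mem_trieOf, isTrieNode_cons_of_card_le_one hS, emptyTrie]

/-- A functional that vanishes on tries of at most one string does not distinguish between the
fringe trees at depth one and the tries generated by the corresponding strings. -/
lemma apply_fringe_trieOf [Fintype A] {M : Type*} [Zero M] {F : Trie A → M}
    (h0 : F (emptyTrie A) = 0) (h1 : ∀ T, IsLeaf T → F T = 0) (S : Finset (ℕ → A)) (x : A) :
    F (fringe (trieOf S) [x]) = F (trieOf (childSet S x)) := by
  by_cases hS : 2 ≤ S.card
  · rw [fringe_trieOf_singleton hS]
  · rw [fringe_trieOf_of_card_le_one (by omega), h0]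
    have := card_childSet_le S x
    rcases Nat.lt_or_ge (childSet S x).card 1 with h | h
    · rw [trieOf_eq_emptyTrie_iff.mpr (Finset.card_eq_zero.mp (by omega)), h0]
    · rw [h1 _ (isLeaf_iff_card.mpr (by omega))]

/-- The value of `φ` on the trie consisting of the root only. -/
def leafToll [Nonempty A] (φ : Trie A → ℝ) : ℝ :=
  φ (trieOf {fun _ => Classical.arbitrary A})

lemma apply_eq_leafToll [Nonempty A] (φ : Trie A → ℝ) {T : Trie A} (h : IsLeaf T) :
    φ T = leafToll φ := by
  have h' : IsLeaf (trieOf {fun _ : ℕ => Classical.arbitrary A}) := isLeaf_iff_card.mpr (by simp)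
  exact congrArg φ (Subtype.ext (h.trans h'.symm))

/-- The change of toll is uniformly bounded, so variance and moment hypotheses on `φ` carry over to
`innerToll φ`. -/
lemma abs_sub_innerToll_le [Nonempty A] (φ : Trie A → ℝ) (T : Trie A) :
    |φ T - innerToll φ T| ≤ |leafToll φ| := by
  by_cases h : IsLeaf T
  · simp [innerToll_of_isLeaf φ h, apply_eq_leafToll φ h]
  · simp [innerToll, h]

end Finite

/-! ### The root recursion and its truncation in depth -/

section Fintype

variable [Fintype A]

lemma additiveFunctional_of_isLeaf [Nonempty A] (φ : Trie A → ℝ) {T : Trie A} (h : IsLeaf T) :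
    additiveFunctional φ T = leafToll φ := by
  rw [additiveFunctional, show T.1 = {[]} from h, Finset.sum_singleton, fringe_nil,
    apply_eq_leafToll φ h]

/-- For two or more strings the nodes split into the root and the nodes of the child tries. A single
string generates only the root, yet its child set generates a one-node trie again, which already
contributes `leafToll φ`; using `innerToll` at the root avoids counting it twice and makes the
recursion hold for every `S`. -/
lemma additiveFunctional_trieOf [Nonempty A] {φ : Trie A → ℝ} (hφ : φ (emptyTrie A) = 0)
    (S : Finset (ℕ → A)) :
    additiveFunctional φ (trieOf S) =
      innerToll φ (trieOf S) + ∑ x, additiveFunctional φ (trieOf (childSet S x)) := by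
  classical
  rcases Nat.lt_or_ge S.card 2 with hS | hS
  · rcases Nat.lt_or_ge S.card 1 with h | h
    · have h0 : S = ∅ := Finset.card_eq_zero.mp (by omega)
      have hc : ∀ x, childSet S x = ∅ := fun x => by simp [childSet, h0]
      simp [hc, trieOf_eq_emptyTrie_iff.mpr h0, trieOf_eq_emptyTrie_iff.mpr,
        additiveFunctional_emptyTrie, innerToll_emptyTrie hφ]
    · have h1 : S.card = 1 := by omega
      -- Every child set has at most one string, so its contribution is linear in its cardinality
      -- and the sum is `leafToll φ`.
      have hc : ∀ x, additiveFunctional φ (trieOf (childSet S x))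
          = ((childSet S x).card : ℝ) * leafToll φ := fun x => by
        have := card_childSet_le S x
        rcases Nat.lt_or_ge (childSet S x).card 1 with h | h
        · have h0 : childSet S x = ∅ := Finset.card_eq_zero.mp (by omega)
          rw [trieOf_eq_emptyTrie_iff.mpr h0, additiveFunctional_emptyTrie, h0]
          simp
        · have h1 : (childSet S x).card = 1 := by omega
          rw [additiveFunctional_of_isLeaf φ (isLeaf_iff_card.mpr h1), h1]
          simp
      simp_rw [hc]
      rw [additiveFunctional_of_isLeaf φ (isLeaf_iff_card.mpr h1),
        innerToll_of_isLeaf φ (isLeaf_iff_card.mpr h1), ← Finset.sum_mul, ← Nat.cast_sum,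
        sum_card_childSet, h1]
      simp
  · have hleaf : ¬ IsLeaf (trieOf S) := by rw [isLeaf_iff_card]; omega
    have hnil : [] ∈ (trieOf S).1 := by
      rw [mem_trieOf, isTrieNode_nil, ← Finset.card_pos]; omega
    have hdec : (trieOf S).1 = insert []
        (Finset.univ.biUnion fun x => (trieOf (childSet S x)).1.image (List.cons x)) := by
      ext α
      rcases α with _ | ⟨x, β⟩
      · simp only [hnil, Finset.mem_insert, true_or]
      · rw [mem_trieOf, isTrieNode_cons hS]
        simp [mem_trieOf]
    rw [additiveFunctional, hdec, Finset.sum_insert (by simp), fringe_nil, innerToll,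
      if_neg hleaf, Finset.sum_biUnion]
    · congr 1
      refine Finset.sum_congr rfl fun x _ => ?_
      rw [Finset.sum_image fun _ _ _ _ h => List.cons_injective h, additiveFunctional]
      exact Finset.sum_congr rfl fun β _ => by rw [fringe_trieOf hS]
    · intro x _ y _ hxy
      rw [Function.onFun, Finset.disjoint_left]
      simp only [Finset.mem_image, not_exists, not_and]
      rintro _ ⟨β, -, rfl⟩ γ _ h
      exact hxy (List.cons.inj h).1.symm

/-- The additive functional with toll function `innerToll φ`, restricted to depths below `m`. -/
def truncatedFunctional (φ : Trie A → ℝ) : ℕ → Trie A → ℝ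
  | 0, _ => 0
  | m + 1, T => innerToll φ T + ∑ x, truncatedFunctional φ m (fringe T [x])

lemma truncatedFunctional_emptyTrie {φ : Trie A → ℝ} (hφ : φ (emptyTrie A) = 0) (m : ℕ) :
    truncatedFunctional φ m (emptyTrie A) = 0 := by
  induction m with
  | zero => rfl
  | succ m ih =>
    have h : ∀ x : A, fringe (emptyTrie A) [x] = emptyTrie A := fun x =>
      Subtype.ext (by ext; simp [fringe, emptyTrie])
    simp [truncatedFunctional, innerToll_emptyTrie hφ, h, ih]

lemma truncatedFunctional_of_isLeaf {φ : Trie A → ℝ} (hφ : φ (emptyTrie A) = 0) (m : ℕ)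
    {T : Trie A} (h : IsLeaf T) : truncatedFunctional φ m T = 0 := by
  cases m with
  | zero => rfl
  | succ m =>
    simp [truncatedFunctional, innerToll_of_isLeaf φ h, fringe_of_isLeaf h,
      truncatedFunctional_emptyTrie hφ]

/-- Fringe trees and child sets disagree only below a one-string root, where the truncated
functional vanishes. -/
lemma truncatedFunctional_succ {φ : Trie A → ℝ} (hφ : φ (emptyTrie A) = 0) (m : ℕ)
    (S : Finset (ℕ → A)) :
    truncatedFunctional φ (m + 1) (trieOf S) =
      innerToll φ (trieOf S) + ∑ x, truncatedFunctional φ m (trieOf (childSet S x)) := by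
  rw [truncatedFunctional]
  simp_rw [apply_fringe_trieOf (truncatedFunctional_emptyTrie hφ m)
    (fun T => truncatedFunctional_of_isLeaf hφ m) S]

/-- Each string ends in its own leaf, which accounts for the term `S.card * leafToll φ`. If the
first `L` letters separate the strings, all internal nodes have depth below `L`, so truncation at `m
≥ L` loses nothing. Passing to a child set lowers `L` by one. -/
lemma additiveFunctional_eq_truncatedFunctional [Nonempty A] {φ : Trie A → ℝ}
    (hφ : φ (emptyTrie A) = 0) {L : ℕ} : ∀ {S : Finset (ℕ → A)},
    (∀ ξ ∈ S, ∀ η ∈ S, (∀ i < L, ξ i = η i) → ξ = η) → ∀ m ≥ L,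
    additiveFunctional φ (trieOf S) = S.card * leafToll φ + truncatedFunctional φ m (trieOf S) := by
  classical
  induction L with
  | zero =>
    intro S hS m _
    have hc : S.card ≤ 1 := Finset.card_le_one.mpr fun ξ hξ η hη => hS ξ hξ η hη (by simp)
    rcases Nat.lt_or_ge S.card 1 with h | h
    · have h0 : S = ∅ := Finset.card_eq_zero.mp (by omega)
      rw [trieOf_eq_emptyTrie_iff.mpr h0, additiveFunctional_emptyTrie,
        truncatedFunctional_emptyTrie hφ, h0]
      simp
    · have h1 : S.card = 1 := by omega
      rw [additiveFunctional_of_isLeaf φ (isLeaf_iff_card.mpr h1),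
        truncatedFunctional_of_isLeaf hφ m (isLeaf_iff_card.mpr h1), h1]
      simp
  | succ L ih =>
    intro S hS m hm
    obtain ⟨m, rfl⟩ : ∃ k, m = k + 1 := ⟨m - 1, by omega⟩
    have hsep : ∀ x, ∀ ξ ∈ childSet S x, ∀ η ∈ childSet S x,
        (∀ i < L, ξ i = η i) → ξ = η := by
      intro x ξ hξ η hη h
      simp only [childSet, Finset.mem_image, Finset.mem_filter] at hξ hη
      obtain ⟨ξ, ⟨hξS, hξ0⟩, rfl⟩ := hξ
      obtain ⟨η, ⟨hηS, hη0⟩, rfl⟩ := hη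
      rw [hS ξ hξS η hηS]
      intro i hi
      cases i with
      | zero => exact hξ0.trans hη0.symm
      | succ i => exact h i (by omega)
    rw [additiveFunctional_trieOf hφ, truncatedFunctional_succ hφ,
      Finset.sum_congr rfl fun x _ => ih (hsep x) m (by omega), Finset.sum_add_distrib,
      ← Finset.sum_mul, ← Nat.cast_sum, sum_card_childSet]
    ring

end Fintype

/-! ### Measurability of random tries -/

/-- The discrete σ-algebra makes every functional of a trie measurable. Over a finite alphabet there
are countably many tries, so measurability of a random trie reduces to events `{T}`. -/
instance : MeasurableSpace (Trie A) := ⊤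

instance : DiscreteMeasurableSpace (Trie A) := ⟨fun _ => trivial⟩

lemma measurable_trieOf [Finite A] {Ω : Type*} [MeasurableSpace Ω] {S : Ω → Finset (ℕ → A)}
    (h : ∀ v, Measurable fun ω => prefixCount (S ω) v) : Measurable fun ω => trieOf (S ω) := by
  refine measurable_to_countable' fun T => ?_
  have hset : (fun ω => trieOf (S ω)) ⁻¹' {T} = ⋂ v, {ω | IsTrieNode (S ω) v ↔ v ∈ T.1} := by
    ext ω
    simp only [Set.mem_preimage, Set.mem_singleton_iff, Set.mem_iInter, Set.mem_ofPred_eq,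
      ← mem_trieOf]
    exact ⟨fun h v => by rw [h], fun h => Subtype.ext (Finset.ext h)⟩
  rw [hset]
  refine MeasurableSet.iInter fun v => ?_
  have hnode : MeasurableSet {ω | IsTrieNode (S ω) v} := by
    refine MeasurableSet.union (measurableSet_le measurable_const (h v))
      (MeasurableSet.inter (h v (measurableSet_singleton 1)) (MeasurableSet.union ?_
        (measurableSet_le measurable_const (h v.dropLast))))
    exact MeasurableSet.const _
  by_cases hv : v ∈ T.1
  · simpa [hv] using hnode
  · simp only [hv, iff_false]
    exact hnode.compl

lemma measurableSet_isPrefixOf [MeasurableSpace A] [DiscreteMeasurableSpace A] (v : List A) :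
    MeasurableSet {ξ : ℕ → A | IsPrefixOf v ξ} := by
  simp only [IsPrefixOf, Set.ofPred_forall]
  exact MeasurableSet.iInter fun i =>
    measurable_pi_apply (i : ℕ) (MeasurableSet.of_discrete (s := {x | v.get i = x}))

-- Strings are added one at a time; a new one counts unless it repeats an earlier one, which is a
-- measurable event.
open Classical in
lemma measurable_prefixCount_image [MeasurableSpace A] [DiscreteMeasurableSpace A] [Countable A]
    (n : ℕ) (v : List A) :
    Measurable fun Ξ : ℕ → ℕ → A => prefixCount ((Finset.range n).image Ξ) v := by
  induction n with
  | zero => simp [prefixCount]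
  | succ n ih =>
    have hmem : MeasurableSet {Ξ : ℕ → ℕ → A | Ξ n ∈ (Finset.range n).image Ξ} := by
      simp only [Finset.mem_image, Finset.mem_range, Set.ofPred_exists, Set.ofPred_and]
      refine MeasurableSet.iUnion fun i => MeasurableSet.inter (MeasurableSet.const _) ?_
      exact measurableSet_eq_fun (measurable_pi_apply i) (measurable_pi_apply n)
    have hpre : MeasurableSet {Ξ : ℕ → ℕ → A | IsPrefixOf v (Ξ n)} :=
      (measurable_pi_apply (X := fun _ : ℕ => ℕ → A) n) (measurableSet_isPrefixOf v)
    have heq : (fun Ξ : ℕ → ℕ → A => prefixCount ((Finset.range (n + 1)).image Ξ) v) =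
        fun Ξ => prefixCount ((Finset.range n).image Ξ) v +
          if Ξ n ∉ (Finset.range n).image Ξ ∧ IsPrefixOf v (Ξ n) then 1 else 0 := by
      funext Ξ
      rw [Finset.range_add_one, Finset.image_insert, prefixCount, Finset.filter_insert]
      by_cases h1 : IsPrefixOf v (Ξ n)
      · by_cases h2 : Ξ n ∈ (Finset.range n).image Ξ
        · have h3 : Ξ n ∈ ((Finset.range n).image Ξ).filter (IsPrefixOf v) :=
            Finset.mem_filter.mpr ⟨h2, h1⟩
          rw [if_pos h1, Finset.insert_eq_of_mem h3, if_neg (fun h => h.1 h2)]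
          rfl
        · have h3 : Ξ n ∉ ((Finset.range n).image Ξ).filter (IsPrefixOf v) :=
            fun h => h2 (Finset.mem_filter.mp h).1
          rw [if_pos h1, Finset.card_insert_of_notMem h3, if_pos ⟨h2, h1⟩]
          rfl
      · rw [if_neg h1, if_neg (fun h => h1 h.2)]
        rfl
    rw [heq]
    exact ih.add (Measurable.ite (hmem.compl.inter hpre) measurable_const measurable_const)

open Classical in
/-- The set of strings generating the random trie of the Poisson model. -/
def poissonStrings (ω : ℕ × (ℕ → ℕ → A)) : Finset (ℕ → A) := (Finset.range ω.1).image ω.2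

lemma poissonTrie_eq [Finite A] (ω : ℕ × (ℕ → ℕ → A)) :
    poissonTrie ω = trieOf (poissonStrings ω) := rfl

lemma card_poissonStrings_le (ω : ℕ × (ℕ → ℕ → A)) : (poissonStrings ω).card ≤ ω.1 := by
  classical
  exact Finset.card_image_le.trans (by simp)

/-- The trie generated by the strings of the Poisson model that start with `x`. -/
def poissonSubtrie [Finite A] (x : A) (ω : ℕ × (ℕ → ℕ → A)) : Trie A :=
  trieOf (childSet (poissonStrings ω) x)

section Measurable

variable [Finite A] [MeasurableSpace A] [DiscreteMeasurableSpace A]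

lemma measurable_prefixCount_poissonStrings (v : List A) :
    Measurable fun ω : ℕ × (ℕ → ℕ → A) => prefixCount (poissonStrings ω) v :=
  measurable_from_prod_countable_right fun n => measurable_prefixCount_image n v

lemma measurable_poissonTrie : Measurable (poissonTrie (A := A)) :=
  measurable_trieOf measurable_prefixCount_poissonStrings

lemma measurable_poissonSubtrie (x : A) : Measurable (poissonSubtrie x) := by
  refine measurable_trieOf fun v => ?_
  simp_rw [prefixCount_childSet]
  exact measurable_prefixCount_poissonStrings _

end Measurable

/-! ### Splitting the Poisson model by the first letter -/

/-- The infinite string with first letter `x` followed by `ξ`. -/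
def consString (x : A) (ξ : ℕ → A) : ℕ → A
  | 0 => x
  | i + 1 => ξ i

open Classical in
/-- The sequence of strings whose first letters are given by `a`, and where the strings with first
letter `x` continue, in order, with `X (x, 0), X (x, 1), …`. -/
def mergeStrings (a : ℕ → A) (X : A × ℕ → ℕ → A) (i : ℕ) : ℕ → A :=
  consString (a i) (X (a i, Nat.count (fun j => a j = a i) i))

-- Different positions draw different entries of the array in `mergeStrings`, so the continuations
-- are independent.
open Classical in
lemma injective_letter_count (a : ℕ → A) :
    Function.Injective fun i => (a i, Nat.count (fun j => a j = a i) i) := by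
  intro i j h
  obtain ⟨h1, h2⟩ := Prod.ext_iff.mp h
  simp only at h1 h2
  rw [← h1] at h2
  exact Nat.count_injective (p := fun k => a k = a i) rfl h1.symm h2

lemma exists_count_eq {P : ℕ → Prop} [DecidablePred P] {n k : ℕ} (h : k < Nat.count P n) :
    ∃ i < n, P i ∧ Nat.count P i = k := by
  induction n with
  | zero => simp at h
  | succ n ih =>
    rw [Nat.count_succ] at h
    by_cases hk : k < Nat.count P n
    · obtain ⟨i, hi, h'⟩ := ih hk
      exact ⟨i, by omega, h'⟩
    · by_cases hn : P n
      · rw [if_pos hn] at h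
        exact ⟨n, by omega, hn, by omega⟩
      · rw [if_neg hn] at h
        omega

-- Row `x` of the array is consumed in order and without gaps: the running count of `x` takes every
-- value below its final one.
open Classical in
lemma childSet_mergeStrings (a : ℕ → A) (X : A × ℕ → ℕ → A) (n : ℕ) (x : A) :
    childSet (poissonStrings (n, mergeStrings a X)) x =
      poissonStrings (Nat.count (fun j => a j = x) n, fun k => X (x, k)) := by
  ext ξ
  simp only [childSet, poissonStrings, Finset.mem_image, Finset.mem_filter, Finset.mem_range]
  constructor
  · rintro ⟨_, ⟨⟨i, hi, rfl⟩, h0⟩, rfl⟩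
    have h0' : a i = x := h0
    subst h0'
    exact ⟨_, Nat.count_strict_mono (p := fun j => a j = a i) rfl hi, rfl⟩
  · rintro ⟨k, hk, rfl⟩
    obtain ⟨i, hi, rfl, rfl⟩ := exists_count_eq hk
    exact ⟨_, ⟨⟨i, hi, rfl⟩, rfl⟩, rfl⟩

section Split

variable [MeasurableSpace A]

/-- The law of an infinite string with i.i.d. letters. -/
def stringLaw (p : PMF A) : Measure (ℕ → A) := Measure.infinitePi fun _ : ℕ => p.toMeasure

instance (p : PMF A) : IsProbabilityMeasure (stringLaw p) := by
  unfold stringLaw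
  infer_instance

lemma measurable_consString : Measurable fun q : A × (ℕ → A) => consString q.1 q.2 := by
  refine measurable_pi_lambda _ fun i => ?_
  cases i with
  | zero => exact measurable_fst
  | succ i => exact (measurable_pi_apply i).comp measurable_snd

lemma map_consString (p : PMF A) :
    (p.toMeasure.prod (stringLaw p)).map (fun q => consString q.1 q.2) = stringLaw p := by
  classical
  refine Measure.eq_infinitePi _ fun s t ht => ?_
  -- The finite index set is enlarged to an initial segment, with trivial constraints added, so that
  -- removing coordinate `0` leaves an initial segment again.
  obtain ⟨N, hN⟩ : ∃ N, s ⊆ Finset.range (N + 1) :=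
    ⟨s.sup id, fun i hi => Finset.mem_range.mpr
      (Nat.lt_succ_of_le (Finset.le_sup (f := id) hi))⟩
  set t' : ℕ → Set A := fun i => if i ∈ s then t i else Set.univ with ht'
  have hm : ∀ i, MeasurableSet (t' i) := fun i => by
    by_cases h : i ∈ s <;> simp [ht', h, ht i]
  have hpi : Set.pi (s : Set ℕ) t = Set.pi (Finset.range (N + 1) : Set ℕ) t' := by
    ext ξ
    simp only [Set.mem_pi, Finset.mem_coe, ht']
    refine ⟨fun h i _ => ?_, fun h i hi => by simpa [hi] using h i (hN hi)⟩
    by_cases hi : i ∈ s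
    · simpa [hi] using h i hi
    · simp [hi]
  have hprod : ∏ i ∈ s, p.toMeasure (t i) = ∏ i ∈ Finset.range (N + 1), p.toMeasure (t' i) := by
    rw [← Finset.prod_subset hN]
    · exact Finset.prod_congr rfl fun i hi => by simp [ht', hi]
    · intro i _ hi
      simp [ht', hi]
  have hpre : (fun q : A × (ℕ → A) => consString q.1 q.2) ⁻¹'
      Set.pi (Finset.range (N + 1) : Set ℕ) t' =
      t' 0 ×ˢ Set.pi (Finset.range N : Set ℕ) fun i => t' (i + 1) := by
    ext ⟨x, ξ⟩
    simp only [Set.mem_preimage, Set.mem_pi, Finset.mem_coe, Finset.mem_range, Set.mem_prod]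
    constructor
    · exact fun h => ⟨h 0 (by omega), fun i hi => h (i + 1) (by omega)⟩
    · rintro ⟨h0, h1⟩ (_ | i) hi
      · exact h0
      · exact h1 i (by omega)
  rw [hpi, hprod, Measure.map_apply measurable_consString
    (MeasurableSet.pi (Finset.countable_toSet _) fun i _ => hm i), hpre, Measure.prod_prod,
    stringLaw, Measure.infinitePi_pi _ (fun i _ => hm (i + 1)), Finset.prod_range_succ', mul_comm]

section Countable

variable [DiscreteMeasurableSpace A]

open Classical in
lemma measurable_letterCount (x : A) (n : ℕ) :
    Measurable fun a : ℕ → A => Nat.count (fun j => a j = x) n := by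
  induction n with
  | zero => simp
  | succ n ih =>
    simp_rw [Nat.count_succ]
    have hn : MeasurableSet {a : ℕ → A | a n = x} :=
      (measurable_pi_apply (X := fun _ : ℕ => A) n) (MeasurableSet.of_discrete (s := {y | y = x}))
    exact ih.add (Measurable.ite hn measurable_const measurable_const)

variable [Countable A]

lemma measurable_mergeStrings :
    Measurable fun q : (ℕ → A) × (A × ℕ → ℕ → A) => mergeStrings q.1 q.2 := by
  classical
  refine measurable_pi_lambda _ fun i => ?_
  -- Evaluation at a random index is measurable because `A × ℕ` is countable.
  have hev : Measurable fun q : (A × ℕ) × (A × ℕ → ℕ → A) => q.2 q.1 :=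
    measurable_from_prod_countable_right fun j => measurable_pi_apply j
  have hcount : Measurable fun a : ℕ → A => Nat.count (fun j => a j = a i) i := by
    have h : Measurable fun q : A × (ℕ → A) => Nat.count (fun j => q.2 j = q.1) i :=
      measurable_from_prod_countable_right fun x => measurable_letterCount x i
    exact h.comp (g := fun q : A × (ℕ → A) => Nat.count (fun j => q.2 j = q.1) i)
      (f := fun a => (a i, a)) ((measurable_pi_apply i).prodMk measurable_id)
  have h1 : Measurable fun q : (ℕ → A) × (A × ℕ → ℕ → A) => q.1 i :=
    (measurable_pi_apply i).comp measurable_fst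
  exact measurable_consString.comp (h1.prodMk
    (hev.comp ((h1.prodMk (hcount.comp measurable_fst)).prodMk measurable_snd)))

/-- Given the first letters `a`, the continuations are distinct entries of an i.i.d. array, so the
conditional probability of a cylinder is a product whose `i`-th factor depends only on `a i`.
Independence of the letters then separates the factors. The first `stringLaw p` is here the law of
the sequence of first letters. -/
lemma map_mergeStrings (p : PMF A) :
    ((stringLaw p).prod (Measure.infinitePi fun _ : A × ℕ => stringLaw p)).map
      (fun q => mergeStrings q.1 q.2) = stringsLaw p := by
  classical
  refine Measure.eq_infinitePi _ fun s t ht => ?_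
  have hpi : MeasurableSet (Set.pi (s : Set ℕ) t) :=
    MeasurableSet.pi (Finset.countable_toSet _) fun i _ => ht i
  have hcons : ∀ (x : A) i, MeasurableSet {ξ | consString x ξ ∈ t i} := fun x i =>
    (measurable_consString.comp measurable_prodMk_left) (ht i)
  have hfib : ∀ a : ℕ → A, (Measure.infinitePi fun _ : A × ℕ => stringLaw p)
      (Prod.mk a ⁻¹' ((fun q : (ℕ → A) × (A × ℕ → ℕ → A) => mergeStrings q.1 q.2) ⁻¹'
        Set.pi (s : Set ℕ) t)) = ∏ i ∈ s, stringLaw p {ξ | consString (a i) ξ ∈ t i} := by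
    intro a
    have hmap := Measure.map_infinitePi_infinitePi_of_inj
      (P := fun _ : A × ℕ => stringLaw p) (injective_letter_count a)
    rw [← Measure.infinitePi_pi (fun _ : ℕ => stringLaw p) (fun i _ => hcons (a i) i), ← hmap,
      Measure.map_apply (by fun_prop)
        (MeasurableSet.pi (Finset.countable_toSet _) fun i _ => hcons (a i) i)]
    rfl
  rw [Measure.map_apply measurable_mergeStrings hpi,
    Measure.prod_apply (measurable_mergeStrings hpi), lintegral_congr hfib]
  have hdisc : ∀ i, Measurable fun x => stringLaw p {ξ | consString x ξ ∈ t i} :=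
    fun i => Measurable.of_discrete
  have hprod := lintegral_prod_eq_prod_lintegral_of_indepFun (μ := stringLaw p) s
    (fun i (a : ℕ → A) => stringLaw p {ξ | consString (a i) ξ ∈ t i})
    (iIndepFun_infinitePi (P := fun _ : ℕ => p.toMeasure)
      (X := fun i x => stringLaw p {ξ | consString x ξ ∈ t i}) hdisc)
    (fun i => (hdisc i).comp (measurable_pi_apply i))
  rw [hprod]
  refine Finset.prod_congr rfl fun i _ => ?_
  -- Averaging over the first letter restores the law of a whole string, by `map_consString`.
  have h1 : ∫⁻ a : ℕ → A, stringLaw p {ξ | consString (a i) ξ ∈ t i}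
        ∂(stringLaw p) =
      ∫⁻ x, stringLaw p {ξ | consString x ξ ∈ t i} ∂p.toMeasure := by
    conv_rhs => rw [← Measure.infinitePi_map_eval (fun _ : ℕ => p.toMeasure) i]
    rw [lintegral_map (hdisc i) (measurable_pi_apply i)]
    rfl
  rw [h1]
  change _ = stringLaw p (t i)
  conv_rhs => rw [← map_consString p]
  rw [Measure.map_apply measurable_consString (ht i),
    Measure.prod_apply (measurable_consString (ht i))]
  rfl

end Countable

end Split

/-! ### Letter counts in the Poisson model -/

/-- The probability of the letter `x`. -/
def letterProb (p : PMF A) (x : A) : ℝ≥0 := (p x).toNNReal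

lemma coe_letterProb (p : PMF A) (x : A) : (letterProb p x : ℝ≥0∞) = p x :=
  ENNReal.coe_toNNReal (p.apply_ne_top x)

lemma sum_letterProb [Fintype A] (p : PMF A) : ∑ x, letterProb p x = 1 := by
  rw [← ENNReal.coe_inj]
  push_cast
  simp_rw [coe_letterProb]
  have h := p.tsum_coe
  rwa [tsum_fintype] at h

/-- Both sides are the coefficient of the monomial with exponents `k` in the `n`-th power of the
linear form with coefficients `q`: one by expanding over words of length `n`, the other by the
multinomial theorem. -/
lemma sum_prod_of_card_fiber {A R : Type*} [Fintype A] [DecidableEq A] [CommSemiring R] (n : ℕ)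
    (q : A → R) (k : A → ℕ) (hk : ∑ x, k x = n) :
    ∑ f : Fin n → A with ∀ x, (Finset.univ.filter fun i => f i = x).card = k x, ∏ i, q (f i) =
      Nat.multinomial Finset.univ k * ∏ x, q x ^ k x := by
  have h := MvPolynomial.coeff_linearCombination_X_pow_of_fintype q
    (Finsupp.equivFunOnFinite.symm k) n
  rw [if_pos (by rw [Finsupp.sum_fintype _ _ (by simp)]; simpa using hk),
    Finsupp.prod_fintype _ _ (by simp), ← Finsupp.multinomial_of_support_subset
      (Finset.subset_univ _)] at h
  rw [show Nat.multinomial Finset.univ k * ∏ x, q x ^ k x = _ from h.symm]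
  have hpow : (∑ x, q x • (MvPolynomial.X x : MvPolynomial A R)) ^ n
      = ∑ f : Fin n → A, ∏ i, q (f i) • (MvPolynomial.X (f i) : MvPolynomial A R) := by
    have := Finset.prod_univ_sum (ι := Fin n) (fun _ => (Finset.univ : Finset A))
      fun _ x => q x • (MvPolynomial.X x : MvPolynomial A R)
    simpa using this
  rw [hpow, MvPolynomial.coeff_sum, Finset.sum_filter]
  refine Finset.sum_congr rfl fun f _ => ?_
  have hmon : ∏ i, q (f i) • (MvPolynomial.X (f i) : MvPolynomial A R) =
      MvPolynomial.monomial (∑ i, Finsupp.single (f i) 1) (∏ i, q (f i)) := by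
    rw [MvPolynomial.monomial_sum_prod]
    refine Finset.prod_congr rfl fun i _ => ?_
    rw [MvPolynomial.smul_eq_C_mul, MvPolynomial.C_mul_X_eq_monomial]
  rw [hmon, MvPolynomial.coeff_monomial]
  refine if_congr ?_ rfl rfl
  rw [Finsupp.ext_iff]
  refine forall_congr' fun x => ?_
  rw [Finset.card_filter, Finsupp.finsetSum_apply]
  simp only [Finsupp.single_apply]
  rfl

open Classical in
lemma count_eq_card_fin (a : ℕ → A) (x : A) (n : ℕ) :
    Nat.count (fun j => a j = x) n = (Finset.univ.filter fun i : Fin n => a i = x).card := by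
  rw [Nat.count_eq_card_filter_range, Finset.card_filter, Finset.card_filter, Finset.sum_range]

open Classical in
lemma sum_count [Fintype A] (a : ℕ → A) (n : ℕ) : ∑ x, Nat.count (fun j => a j = x) n = n := by
  simp_rw [Nat.count_eq_card_filter_range]
  rw [← Finset.card_eq_sum_card_fiberwise (s := Finset.range n) (f := a) (fun _ _ => by simp),
    Finset.card_range]

section Counts

variable [Fintype A] [MeasurableSpace A] [DiscreteMeasurableSpace A]

open Classical in
lemma stringLaw_count_eq (p : PMF A) (k : A → ℕ) :
    stringLaw p {a | ∀ x, Nat.count (fun j => a j = x) (∑ x, k x) = k x} =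
      Nat.multinomial Finset.univ k * ∏ x, p x ^ k x := by
  set n := ∑ x, k x with hn
  rw [← sum_prod_of_card_fiber n p k hn.symm]
  have hmap := Measure.map_infinitePi_infinitePi_of_inj
      (P := fun _ : ℕ => p.toMeasure) (Fin.val_injective (n := n))
  have hset : {a : ℕ → A | ∀ x, Nat.count (fun j => a j = x) n = k x} =
      (fun (a : ℕ → A) (i : Fin n) => a i) ⁻¹' ((Finset.univ.filter fun f : Fin n → A =>
        ∀ x, (Finset.univ.filter fun i => f i = x).card = k x : Finset (Fin n → A)) :
          Set (Fin n → A)) := by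
    ext a
    simp [count_eq_card_fin]
  rw [hset, stringLaw, ← Measure.map_apply (by fun_prop) MeasurableSet.of_discrete, hmap,
    ← sum_measure_singleton]
  refine Finset.sum_congr rfl fun f _ => ?_
  rw [Measure.infinitePi_singleton_of_fintype]
  exact Finset.prod_congr rfl fun i _ => PMF.toMeasure_apply_singleton _ _ MeasurableSet.of_discrete

-- Poisson splitting: the weight of `n = ∑ k x` times the multinomial probability factorises,
-- because `n!` cancels and `exp (-t)` is the product of the `exp (-p x * t)`.
open Classical in
lemma map_letterCounts (p : PMF A) (t : ℝ≥0) :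
    ((poissonMeasure t).prod (stringLaw p)).map
      (fun q x => Nat.count (fun j => q.2 j = x) q.1) =
      Measure.pi fun x => poissonMeasure (letterProb p x * t) := by
  have hmeas : Measurable fun (q : ℕ × (ℕ → A)) x => Nat.count (fun j => q.2 j = x) q.1 :=
    measurable_from_prod_countable_right fun n =>
      measurable_pi_lambda _ fun x => measurable_letterCount x n
  refine Measure.ext_of_singleton fun k => ?_
  rw [Measure.map_apply hmeas MeasurableSet.of_discrete, Measure.pi_singleton]
  have hset : (fun (q : ℕ × (ℕ → A)) x => Nat.count (fun j => q.2 j = x) q.1) ⁻¹' {k} =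
      {∑ x, k x} ×ˢ {a | ∀ x, Nat.count (fun j => a j = x) (∑ x, k x) = k x} := by
    ext ⟨n, a⟩
    simp only [Set.mem_preimage, Set.mem_singleton_iff, Set.mem_prod, Set.mem_ofPred_eq,
      funext_iff]
    constructor
    · intro h
      have hn : n = ∑ x, k x := by rw [← sum_count a n]; exact Finset.sum_congr rfl fun x _ => h x
      exact ⟨hn, hn ▸ h⟩
    · rintro ⟨rfl, h⟩
      exact h
  rw [hset, Measure.prod_prod, stringLaw_count_eq]
  simp_rw [poissonMeasure_singleton, ← coe_letterProb]
  rw [← ENNReal.ofReal_prod_of_nonneg (fun x _ => by positivity)]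
  have h2 : ((Nat.multinomial Finset.univ k : ℕ) : ℝ≥0∞) * ∏ x, (letterProb p x : ℝ≥0∞) ^ k x =
      ENNReal.ofReal (Nat.multinomial Finset.univ k * ∏ x, (letterProb p x : ℝ) ^ k x) := by
    rw [ENNReal.ofReal_mul (by positivity), ENNReal.ofReal_natCast,
      ENNReal.ofReal_prod_of_nonneg (fun x _ => by positivity)]
    simp [ENNReal.ofReal_pow]
  rw [h2, ← ENNReal.ofReal_mul (by positivity)]
  congr 1
  have hsum : ∑ x, (letterProb p x : ℝ) = 1 := by exact_mod_cast sum_letterProb p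
  have hspec : (∏ x, ((k x).factorial : ℝ)) * Nat.multinomial Finset.univ k =
      ((∑ x, k x).factorial : ℝ) := by exact_mod_cast Nat.multinomial_spec Finset.univ k
  have hexp : ∏ x, Real.exp (-((letterProb p x * t : ℝ≥0) : ℝ)) = Real.exp (-t) := by
    rw [← Real.exp_sum, Finset.sum_neg_distrib]
    push_cast
    rw [← Finset.sum_mul, hsum, one_mul]
  have hfac : (∏ x, ((k x).factorial : ℝ)) ≠ 0 :=
    Finset.prod_ne_zero_iff.mpr fun x _ => by positivity
  rw [Finset.prod_div_distrib, Finset.prod_mul_distrib, hexp]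
  push_cast
  simp_rw [mul_pow]
  rw [Finset.prod_mul_distrib, Finset.prod_pow_eq_pow_sum, ← hspec]
  have hmul : (Nat.multinomial Finset.univ k : ℝ) ≠ 0 := by
    exact_mod_cast (Nat.multinomial_pos Finset.univ k).ne'
  field_simp

/-- In the Poisson model, the tries generated by the strings with a given first letter are
independent, and distributed as Poisson tries. -/
lemma map_poissonSubtrie (p : PMF A) (t : ℝ≥0) :
    (poissonModel p t).map (fun ω x => poissonSubtrie x ω) =
      Measure.pi fun x => (poissonModel p (letterProb p x * t)).map poissonTrie := by
  classical
  set R : Measure (A × ℕ → ℕ → A) := Measure.infinitePi fun _ => stringLaw p with hR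
  have hid : Measurable (Prod.map (id : ℕ → ℕ)
      (fun q : (ℕ → A) × (A × ℕ → ℕ → A) => mergeStrings q.1 q.2)) :=
    measurable_id.prodMap measurable_mergeStrings
  -- The model is realised by three independent sources: the number of strings, their first letters,
  -- and an array of continuations.
  have hmodel : poissonModel p t = ((poissonMeasure t).prod ((stringLaw p).prod R)).map
      (Prod.map id (fun q : (ℕ → A) × (A × ℕ → ℕ → A) => mergeStrings q.1 q.2)) := by
    rw [← Measure.map_prod_map _ _ measurable_id measurable_mergeStrings, Measure.map_id,
      map_mergeStrings, poissonModel]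
  have hsub : Measurable fun (ω : ℕ × (ℕ → ℕ → A)) x => poissonSubtrie x ω :=
    measurable_pi_lambda _ measurable_poissonSubtrie
  have hcount : Measurable fun (q : ℕ × (ℕ → A)) x => Nat.count (fun j => q.2 j = x) q.1 :=
    measurable_from_prod_countable_right fun n =>
      measurable_pi_lambda _ fun x => measurable_letterCount x n
  have hcurry : Measurable (MeasurableEquiv.curry A ℕ (ℕ → A)) := MeasurableEquiv.measurable _
  have hRc : R.map (MeasurableEquiv.curry A ℕ (ℕ → A)) = Measure.pi fun _ : A => stringsLaw p := by
    rw [hR, Measure.infinitePi_map_curry (fun _ _ => stringLaw p)]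
    exact Measure.infinitePi_eq_pi _
  have hpair := (measurePreserving_arrowProdEquivProdArrow ℕ (ℕ → ℕ → A) A
    (fun x => poissonMeasure (letterProb p x * t)) (fun _ => stringsLaw p)).map_eq
  have hT : Measurable fun (z : A → ℕ × (ℕ → ℕ → A)) x => poissonTrie (z x) :=
    measurable_pi_lambda _ fun x => measurable_poissonTrie.comp (measurable_pi_apply x)
  rw [← Measure.pi_map_pi (fun x => measurable_poissonTrie.aemeasurable)]
  -- Letter counts depend on the first two sources only; paired with the rows of the independent
  -- array they form independent Poisson models.
  have hsymm : (Measure.pi fun x => poissonModel p (letterProb p x * t)) =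
      ((((poissonMeasure t).prod (stringLaw p)).prod R).map (Prod.map
        (fun q x => Nat.count (fun j => q.2 j = x) q.1) (MeasurableEquiv.curry A ℕ (ℕ → A)))).map
        (MeasurableEquiv.arrowProdEquivProdArrow ℕ (ℕ → ℕ → A) A).symm := by
    rw [← Measure.map_prod_map _ _ hcount hcurry, map_letterCounts, hRc, ← hpair,
      MeasurableEquiv.map_symm_map]
    rfl
  rw [hsymm, Measure.map_map (MeasurableEquiv.measurable _) (hcount.prodMap hcurry),
    Measure.map_map hT ((MeasurableEquiv.measurable _).comp (hcount.prodMap hcurry)), hmodel,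
    Measure.map_map hsub hid, ← Measure.prodAssoc_prod,
    Measure.map_map (hsub.comp hid) (MeasurableEquiv.measurable _)]
  congr 1
  funext q
  funext x
  simp only [Function.comp_apply]
  change trieOf (childSet (poissonStrings (q.1.1, mergeStrings q.1.2 q.2)) x) = _
  rw [childSet_mergeStrings]
  rfl

end Counts

/-! ### Comparison of Poisson models with different means -/

section Moments

variable [MeasurableSpace A]

lemma lintegral_poissonModel (p : PMF A) (t : ℝ≥0) {F : ℕ × (ℕ → ℕ → A) → ℝ≥0∞}
    (hF : Measurable F) :
    ∫⁻ ω, F ω ∂(poissonModel p t) = ∑' n : ℕ,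
      ENNReal.ofReal (Real.exp (-t) * t ^ n / n.factorial) * ∫⁻ Ξ, F (n, Ξ) ∂(stringsLaw p) := by
  rw [poissonModel, lintegral_prod _ hF.aemeasurable, poissonMeasure, lintegral_sum_measure]
  simp

/-- The law of the strings does not depend on the mean, so it is enough to compare the Poisson
weights for each `n`. -/
lemma lintegral_poissonModel_le (p : PMF A) {s t : ℝ≥0} {F G : ℕ × (ℕ → ℕ → A) → ℝ≥0∞}
    (hF : Measurable F) (hG : Measurable G) (C : ℝ≥0∞)
    (h : ∀ n Ξ, ENNReal.ofReal (Real.exp (-s) * s ^ n / n.factorial) * F (n, Ξ) ≤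
      C * (ENNReal.ofReal (Real.exp (-t) * t ^ n / n.factorial) * G (n, Ξ))) :
    ∫⁻ ω, F ω ∂(poissonModel p s) ≤ C * ∫⁻ ω, G ω ∂(poissonModel p t) := by
  rw [lintegral_poissonModel p s hF, lintegral_poissonModel p t hG, ← ENNReal.tsum_mul_left]
  refine ENNReal.tsum_le_tsum fun n => ?_
  have hFn : Measurable fun Ξ => F (n, Ξ) := hF.comp measurable_prodMk_left
  have hGn : Measurable fun Ξ => G (n, Ξ) := hG.comp measurable_prodMk_left
  rw [← lintegral_const_mul _ hFn, ← lintegral_const_mul _ hGn,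
    ← lintegral_const_mul _ (hGn.const_mul _)]
  exact lintegral_mono fun Ξ => h n Ξ

lemma lintegral_poissonModel_mono (p : PMF A) {s t : ℝ≥0} (hst : s ≤ t)
    {F : ℕ × (ℕ → ℕ → A) → ℝ≥0∞} (hF : Measurable F) :
    ∫⁻ ω, F ω ∂(poissonModel p s) ≤
      ENNReal.ofReal (Real.exp t) * ∫⁻ ω, F ω ∂(poissonModel p t) := by
  refine lintegral_poissonModel_le p hF hF _ fun n Ξ => ?_
  rw [← mul_assoc, ← ENNReal.ofReal_mul (by positivity)]
  gcongr ENNReal.ofReal ?_ * _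
  rw [← mul_div_assoc, ← mul_assoc, ← Real.exp_add, add_neg_cancel, Real.exp_zero]
  gcongr
  · simp

/-- Only `n ≥ 2` contributes, and there `(s / t) ^ n ≤ (s / t) ^ 2`. The quadratic decay is what
makes the recursion for moments contract, with factor `∑ x, p x ^ 2`. -/
lemma lintegral_poissonModel_le_sq (p : PMF A) {s t : ℝ≥0} (hst : s ≤ t) (ht : 0 < t)
    {F : ℕ × (ℕ → ℕ → A) → ℝ≥0∞} (hF : Measurable F) (h0 : ∀ n ≤ 1, ∀ Ξ, F (n, Ξ) = 0) :
    ∫⁻ ω, F ω ∂(poissonModel p s) ≤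
      ENNReal.ofReal (Real.exp t * (s / t) ^ 2) * ∫⁻ ω, F ω ∂(poissonModel p t) := by
  refine lintegral_poissonModel_le p hF hF _ fun n Ξ => ?_
  rcases Nat.lt_or_ge n 2 with hn | hn
  · rw [h0 n (by omega)]
    simp
  rw [← mul_assoc, ← ENNReal.ofReal_mul (by positivity)]
  gcongr ENNReal.ofReal ?_ * _
  have ht' : (0 : ℝ) < t := ht
  have hle : ((s : ℝ) / t) ^ n ≤ (s / t) ^ 2 :=
    pow_le_pow_of_le_one (by positivity) (div_le_one_of_le₀ hst ht'.le) hn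
  calc Real.exp (-s) * s ^ n / n.factorial ≤ 1 * s ^ n / n.factorial := by
        gcongr
        simp
    _ = (s / t : ℝ) ^ n * t ^ n / n.factorial := by rw [div_pow]; field_simp
    _ ≤ (s / t : ℝ) ^ 2 * t ^ n / n.factorial := by gcongr
    _ = Real.exp t * (s / t) ^ 2 * (Real.exp (-t) * t ^ n / n.factorial) := by
        rw [Real.exp_neg]
        field_simp

/-- A factor `2 ^ n` is absorbed by doubling the mean, at the cost of `exp t`. Powers of the number
of strings are handled this way. -/
lemma lintegral_poissonModel_tilt (p : PMF A) (t : ℝ≥0) {F G : ℕ × (ℕ → ℕ → A) → ℝ≥0∞}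
    (hF : Measurable F) (hG : Measurable G) (C : ℝ≥0∞)
    (h : ∀ n Ξ, F (n, Ξ) ≤ C * 2 ^ n * G (n, Ξ)) :
    ∫⁻ ω, F ω ∂(poissonModel p t) ≤
      C * ENNReal.ofReal (Real.exp t) * ∫⁻ ω, G ω ∂(poissonModel p (2 * t)) := by
  refine lintegral_poissonModel_le p hF hG _ fun n Ξ => ?_
  calc _ ≤ ENNReal.ofReal (Real.exp (-t) * t ^ n / n.factorial) * (C * 2 ^ n * G (n, Ξ)) := by
        gcongr
        exact h n Ξ
    _ = C * (ENNReal.ofReal (Real.exp (-t) * t ^ n / n.factorial) * 2 ^ n) * G (n, Ξ) := by ring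
    _ = C * (ENNReal.ofReal (Real.exp t) * ENNReal.ofReal
          (Real.exp (-(2 * t : ℝ≥0)) * (2 * t : ℝ≥0) ^ n / n.factorial)) * G (n, Ξ) := by
        congr 2
        rw [← ENNReal.ofReal_mul (by positivity), show (2 : ℝ≥0∞) ^ n = ENNReal.ofReal (2 ^ n) by
          rw [ENNReal.ofReal_pow (by norm_num)]; norm_num, ← ENNReal.ofReal_mul (by positivity)]
        congr 1
        push_cast
        rw [show -(2 * (t : ℝ)) = -t + -t by ring, Real.exp_add, Real.exp_neg, mul_pow]
        field_simp
    _ = _ := by ring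

end Moments

lemma exists_rpow_le_two_pow {r : ℝ} (hr : 0 < r) :
    ∃ B : ℝ≥0, ∀ n : ℕ, (n : ℝ≥0∞) ^ r ≤ B * 2 ^ n := by
  obtain ⟨k, hk⟩ := exists_nat_ge r
  obtain ⟨B, hB⟩ :=
    (tendsto_pow_const_div_const_pow_of_one_lt k (one_lt_two : (1 : ℝ) < 2)).bddAbove_range
  refine ⟨B.toNNReal, fun n => ?_⟩
  rcases Nat.eq_zero_or_pos n with rfl | hn
  · simp [hr]
  have h1 : (n : ℝ) ^ k ≤ B * 2 ^ n := by
    rw [← div_le_iff₀ (by positivity)]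
    exact hB ⟨n, rfl⟩
  calc (n : ℝ≥0∞) ^ r ≤ (n : ℝ≥0∞) ^ (k : ℝ) :=
        ENNReal.rpow_le_rpow_of_exponent_le (by exact_mod_cast hn) hk
    _ = ENNReal.ofReal ((n : ℝ) ^ k) := by
        rw [ENNReal.rpow_natCast, ENNReal.ofReal_pow (by positivity), ENNReal.ofReal_natCast]
    _ ≤ ENNReal.ofReal (B * 2 ^ n) := ENNReal.ofReal_le_ofReal h1
    _ = _ := by
        rw [ENNReal.ofReal_mul' (by positivity), ENNReal.ofReal_pow (by positivity),
          ENNReal.ofReal_ofNat]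
        rfl

/-! ### Marginal laws of the subtries and contraction factors -/

section Subtrie

variable [Fintype A] [MeasurableSpace A] [DiscreteMeasurableSpace A]

lemma map_poissonSubtrie_apply (p : PMF A) (t : ℝ≥0) (x : A) :
    (poissonModel p t).map (poissonSubtrie x) =
      (poissonModel p (letterProb p x * t)).map poissonTrie := by
  have hprob : ∀ y, IsProbabilityMeasure
      ((poissonModel p (letterProb p y * t)).map (poissonTrie (A := A))) :=
    fun y => Measure.isProbabilityMeasure_map measurable_poissonTrie.aemeasurable
  have h := congrArg (fun μ => μ.map (Function.eval x)) (map_poissonSubtrie p t)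
  rwa [Measure.map_map (measurable_pi_apply x) (measurable_pi_lambda _ measurable_poissonSubtrie),
    (measurePreserving_eval _ x).map_eq] at h

lemma lintegral_poissonSubtrie (p : PMF A) (t : ℝ≥0) (F : Trie A → ℝ≥0∞) (x : A) :
    ∫⁻ ω, F (poissonSubtrie x ω) ∂(poissonModel p t) =
      ∫⁻ ω, F (poissonTrie ω) ∂(poissonModel p (letterProb p x * t)) := by
  rw [← lintegral_map Measurable.of_discrete (measurable_poissonSubtrie x),
    map_poissonSubtrie_apply, lintegral_map Measurable.of_discrete measurable_poissonTrie]

end Subtrie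

lemma letterProb_pos {p : PMF A} (hp : ∀ x, 0 < p x) (x : A) : 0 < letterProb p x :=
  ENNReal.toNNReal_pos (hp x).ne' (p.apply_ne_top x)

lemma letterProb_lt_one [Fintype A] [Nontrivial A] {p : PMF A} (hp : ∀ x, 0 < p x) (x : A) :
    letterProb p x < 1 := by
  obtain ⟨y, hy⟩ := exists_ne x
  classical
  rw [← sum_letterProb p]
  exact Finset.single_lt_sum hy (Finset.mem_univ x) (Finset.mem_univ y) (letterProb_pos hp y)
    fun _ _ _ => zero_le

lemma sum_letterProb_rpow_lt_one [Fintype A] [Nontrivial A] {p : PMF A} (hp : ∀ x, 0 < p x)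
    {s : ℝ} (hs : 1 < s) : ∑ x, (letterProb p x : ℝ) ^ s < 1 := by
  have h1 : ∑ x, (letterProb p x : ℝ) = 1 := by exact_mod_cast sum_letterProb p
  rw [← h1]
  exact Finset.sum_lt_sum_of_nonempty Finset.univ_nonempty fun x _ =>
    Real.rpow_lt_self_of_lt_one (letterProb_pos hp x) (letterProb_lt_one hp x) hs

/-- Hölder's inequality with exponents `r / (r - 1)` and `r`, after writing `f ≤ w ^ ((r - 1) / r) *
h ^ (1 / r)`. -/
lemma ENNReal_sum_rpow_le {ι : Type*} (s : Finset ι) {r : ℝ} (hr : 1 < r) (f w h : ι → ℝ≥0∞)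
    (hf : ∀ i ∈ s, f i ^ r ≤ w i ^ (r - 1) * h i) :
    (∑ i ∈ s, f i) ^ r ≤ (∑ i ∈ s, w i) ^ (r - 1) * ∑ i ∈ s, h i := by
  have hr0 : 0 < r := by linarith
  have hpq : (r / (r - 1)).HolderConjugate r := (Real.HolderConjugate.conjExponent hr).symm
  have h1 : ∀ i ∈ s, f i ≤ w i ^ ((r - 1) / r) * h i ^ (1 / r) := by
    intro i hi
    have := ENNReal.rpow_le_rpow (hf i hi) (z := 1 / r) (by positivity)
    rwa [← ENNReal.rpow_mul, mul_one_div_cancel hr0.ne', ENNReal.rpow_one,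
      ENNReal.mul_rpow_of_nonneg _ _ (by positivity), ← ENNReal.rpow_mul, mul_one_div] at this
  have h2 := (Finset.sum_le_sum h1).trans (ENNReal.inner_le_Lp_mul_Lq s _ _ hpq)
  have h3 := ENNReal.rpow_le_rpow h2 hr0.le
  rw [ENNReal.mul_rpow_of_nonneg _ _ hr0.le, ← ENNReal.rpow_mul, ← ENNReal.rpow_mul,
    one_div_mul_cancel hr0.ne', ENNReal.rpow_one] at h3
  have hr1 : r - 1 ≠ 0 := by linarith
  have e1 : ∀ i, (w i ^ ((r - 1) / r)) ^ (r / (r - 1)) = w i := fun i => by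
    rw [← ENNReal.rpow_mul, show (r - 1) / r * (r / (r - 1)) = 1 by field_simp, ENNReal.rpow_one]
  have e2 : ∀ i, (h i ^ (1 / r)) ^ r = h i := fun i => by
    rw [← ENNReal.rpow_mul, one_div_mul_cancel hr0.ne', ENNReal.rpow_one]
  simp_rw [e1, e2] at h3
  rwa [show 1 / (r / (r - 1)) * r = r - 1 by field_simp] at h3

/-! ### Finiteness of moments of additive functionals -/

section Finiteness

variable [Fintype A]

/-- The additive functional with toll `‖innerToll φ T‖ ^ r`, where a node at depth `k < m` has
weight `c ^ k`. -/
def weightedFunctional (φ : Trie A → ℝ) (r : ℝ) (c : ℝ≥0∞) : ℕ → Trie A → ℝ≥0∞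
  | 0, _ => 0
  | m + 1, T => ‖innerToll φ T‖ₑ ^ r + c * ∑ x, weightedFunctional φ r c m (fringe T [x])

variable {φ : Trie A → ℝ} {r : ℝ} {c : ℝ≥0∞}

lemma weightedFunctional_emptyTrie (hφ : φ (emptyTrie A) = 0) (hr : 0 < r) (m : ℕ) :
    weightedFunctional φ r c m (emptyTrie A) = 0 := by
  induction m with
  | zero => rfl
  | succ m ih =>
    have h : ∀ x : A, fringe (emptyTrie A) [x] = emptyTrie A := fun x =>
      Subtype.ext (by ext; simp [fringe, emptyTrie])
    simp [weightedFunctional, innerToll_emptyTrie hφ, h, ih, hr]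

lemma weightedFunctional_of_isLeaf (hφ : φ (emptyTrie A) = 0) (hr : 0 < r) (m : ℕ)
    {T : Trie A} (h : IsLeaf T) : weightedFunctional φ r c m T = 0 := by
  cases m with
  | zero => rfl
  | succ m =>
    simp [weightedFunctional, innerToll_of_isLeaf φ h, fringe_of_isLeaf h,
      weightedFunctional_emptyTrie hφ hr, hr]

lemma weightedFunctional_succ (hφ : φ (emptyTrie A) = 0) (hr : 0 < r) (m : ℕ)
    (S : Finset (ℕ → A)) :
    weightedFunctional φ r c (m + 1) (trieOf S) = ‖innerToll φ (trieOf S)‖ₑ ^ r +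
      c * ∑ x, weightedFunctional φ r c m (trieOf (childSet S x)) := by
  rw [weightedFunctional]
  simp_rw [apply_fringe_trieOf (weightedFunctional_emptyTrie hφ hr m)
    (fun T => weightedFunctional_of_isLeaf hφ hr m) S]

/-- Hölder with the number of strings as weight for each child and `δ * S.card` for the root. The
child weights add up to `S.card`, so a level costs only `(δ + 1) ^ (r - 1)`, arbitrarily close to
`1`; equal weights would cost a power of the alphabet size. -/
lemma enorm_truncatedFunctional_rpow_le (hφ : φ (emptyTrie A) = 0) (hr : 1 < r) {δ : ℝ≥0∞}
    (hδ : δ ≠ 0) (hδ' : δ ≠ ⊤) (m : ℕ) : ∀ S : Finset (ℕ → A),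
    ‖truncatedFunctional φ m (trieOf S)‖ₑ ^ r ≤
      ((δ + 1) ^ (r - 1) * (δ ^ (r - 1))⁻¹) * (S.card : ℝ≥0∞) ^ (r - 1) *
        weightedFunctional φ r ((δ + 1) ^ (r - 1)) m (trieOf S) := by
  have hr0 : 0 < r := by linarith
  have hr1 : 0 < r - 1 := by linarith
  have hδr : δ ^ (r - 1) * (δ ^ (r - 1))⁻¹ = 1 :=
    ENNReal.mul_inv_cancel (by simp [hδ, hδ']) (by simp [hδ, hδ'])
  set C := (δ + 1) ^ (r - 1) * (δ ^ (r - 1))⁻¹ with hC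
  induction m with
  | zero =>
    intro S
    simp [truncatedFunctional, hr0]
  | succ m ih =>
    intro S
    rw [truncatedFunctional_succ hφ, weightedFunctional_succ hφ hr0]
    set G := weightedFunctional φ r ((δ + 1) ^ (r - 1)) m
    let f : Option A → ℝ≥0∞ := fun o => o.elim ‖innerToll φ (trieOf S)‖ₑ
      fun x => ‖truncatedFunctional φ m (trieOf (childSet S x))‖ₑ
    let w : Option A → ℝ≥0∞ := fun o => o.elim (δ * S.card) fun x => (childSet S x).card
    let h : Option A → ℝ≥0∞ := fun o =>
      o.elim ((δ ^ (r - 1))⁻¹ * ‖innerToll φ (trieOf S)‖ₑ ^ r)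
        fun x => C * G (trieOf (childSet S x))
    have hfwh : ∀ o ∈ Finset.univ, f o ^ r ≤ w o ^ (r - 1) * h o := by
      rintro (_ | x) -
      · simp only [f, w, h, Option.elim_none]
        -- The root toll carries no power of `S.card`; the missing factor is at least `1` unless `S`
        -- is empty, when the toll is `0`.
        rcases S.eq_empty_or_nonempty with hS | hS
        · rw [trieOf_eq_emptyTrie_iff.mpr hS, innerToll_emptyTrie hφ]
          simp [hr0]
        · have h1 : (1 : ℝ≥0∞) ≤ (S.card : ℝ≥0∞) ^ (r - 1) :=
            ENNReal.one_le_rpow (by exact_mod_cast hS.card_pos) hr1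
          rw [ENNReal.mul_rpow_of_nonneg _ _ hr1.le]
          calc _ = 1 * (δ ^ (r - 1) * (δ ^ (r - 1))⁻¹) * ‖innerToll φ (trieOf S)‖ₑ ^ r := by
                rw [hδr, one_mul, one_mul]
            _ ≤ (S.card : ℝ≥0∞) ^ (r - 1) * (δ ^ (r - 1) * (δ ^ (r - 1))⁻¹) *
                ‖innerToll φ (trieOf S)‖ₑ ^ r := by gcongr
            _ = _ := by ring
      · simp only [f, w, h, Option.elim_some]
        refine (ih _).trans (le_of_eq ?_)
        ring
    have hle : ‖innerToll φ (trieOf S) +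
        ∑ x, truncatedFunctional φ m (trieOf (childSet S x))‖ₑ ≤ ∑ o, f o := by
      rw [Fintype.sum_option]
      exact (enorm_add_le _ _).trans (add_le_add le_rfl (enorm_sum_le _ _))
    have hw : ∑ o, w o = (δ + 1) * S.card := by
      rw [Fintype.sum_option]
      simp only [w, Option.elim_none, Option.elim_some]
      rw [← Nat.cast_sum, sum_card_childSet]
      ring
    calc _ ≤ (∑ o, f o) ^ r := by gcongr
      _ ≤ (∑ o, w o) ^ (r - 1) * ∑ o, h o := ENNReal_sum_rpow_le _ hr f w h hfwh
      _ = _ := by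
        rw [hw, Fintype.sum_option, ENNReal.mul_rpow_of_nonneg _ _ hr1.le]
        simp only [h, Option.elim_none, Option.elim_some]
        rw [← Finset.mul_sum, hC]
        ring

lemma innerToll_poissonTrie_of_le_one (hφ : φ (emptyTrie A) = 0) {n : ℕ} (hn : n ≤ 1)
    (Ξ : ℕ → ℕ → A) : innerToll φ (poissonTrie (n, Ξ)) = 0 := by
  have hc : (poissonStrings (n, Ξ)).card ≤ 1 := (card_poissonStrings_le _).trans hn
  rw [poissonTrie_eq]
  rcases Nat.lt_or_ge (poissonStrings (n, Ξ)).card 1 with h | h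
  · rw [trieOf_eq_emptyTrie_iff.mpr (Finset.card_eq_zero.mp (by omega)), innerToll_emptyTrie hφ]
  · exact innerToll_of_isLeaf φ (isLeaf_iff_card.mpr (by omega))

variable [MeasurableSpace A]

lemma lintegral_innerToll_rpow_lt_top {p : PMF A} (hr : 0 < r) {t : ℝ≥0}
    (h : ∫⁻ ω, ‖φ (poissonTrie ω)‖ₑ ^ r ∂(poissonModel p t) < ⊤) :
    ∫⁻ ω, ‖innerToll φ (poissonTrie ω)‖ₑ ^ r ∂(poissonModel p t) < ⊤ := by
  refine (lintegral_mono fun ω => ?_).trans_lt h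
  gcongr
  unfold innerToll
  split_ifs <;> simp

variable [DiscreteMeasurableSpace A]

/-- The bound `K * t ^ 2` reproduces itself, since the children at means `p x * t` contribute `c *
(∑ x, p x ^ 2) * K * t ^ 2`. The constant is the same for every depth `m`. -/
lemma lintegral_weightedFunctional_le (p : PMF A) (hφ : φ (emptyTrie A) = 0) (hr : 0 < r)
    {K₀ K : ℝ≥0∞} {t₀ : ℝ≥0} (hK : K₀ + c * (∑ x, (letterProb p x : ℝ≥0∞) ^ 2) * K ≤ K)
    (h : ∀ t ≤ t₀, ∫⁻ ω, ‖innerToll φ (poissonTrie ω)‖ₑ ^ r ∂(poissonModel p t) ≤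
      K₀ * (t : ℝ≥0∞) ^ 2) (m : ℕ) : ∀ t ≤ t₀,
    ∫⁻ ω, weightedFunctional φ r c m (poissonTrie ω) ∂(poissonModel p t) ≤
      K * (t : ℝ≥0∞) ^ 2 := by
  induction m with
  | zero =>
    intro t _
    simp [weightedFunctional]
  | succ m ih =>
    intro t ht
    have hmeas : ∀ x, Measurable fun ω : ℕ × (ℕ → ℕ → A) =>
        weightedFunctional φ r c m (poissonSubtrie x ω) := fun x =>
      Measurable.of_discrete.comp (measurable_poissonSubtrie x)
    have h1 : Measurable fun ω : ℕ × (ℕ → ℕ → A) => ‖innerToll φ (poissonTrie ω)‖ₑ ^ r :=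
      (Measurable.of_discrete (f := fun T => ‖innerToll φ T‖ₑ ^ r)).comp measurable_poissonTrie
    have hle : ∀ x, letterProb p x * t ≤ t₀ := fun x => by
      refine le_trans (mul_le_of_le_one_left zero_le ?_) ht
      rw [← sum_letterProb p]
      exact Finset.single_le_sum (fun _ _ => zero_le) (Finset.mem_univ x)
    calc _ = ∫⁻ ω, (‖innerToll φ (poissonTrie ω)‖ₑ ^ r +
          c * ∑ x, weightedFunctional φ r c m (poissonSubtrie x ω)) ∂(poissonModel p t) :=
          lintegral_congr fun ω => weightedFunctional_succ hφ hr m _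
      _ = ∫⁻ ω, ‖innerToll φ (poissonTrie ω)‖ₑ ^ r ∂(poissonModel p t) + c * ∑ x,
          ∫⁻ ω, weightedFunctional φ r c m (poissonTrie ω)
            ∂(poissonModel p (letterProb p x * t)) := by
          rw [lintegral_add_left h1, lintegral_const_mul _ (Finset.measurable_sum _ fun x _ => hmeas x),
            lintegral_finsetSum _ fun x _ => hmeas x]
          simp_rw [lintegral_poissonSubtrie]
      _ ≤ K₀ * (t : ℝ≥0∞) ^ 2 + c * ∑ x, K * ((letterProb p x * t : ℝ≥0) : ℝ≥0∞) ^ 2 := by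
          gcongr with x
          · exact h t ht
          · exact ih _ (hle x)
      _ = (K₀ + c * (∑ x, (letterProb p x : ℝ≥0∞) ^ 2) * K) * (t : ℝ≥0∞) ^ 2 := by
          push_cast
          simp_rw [mul_pow]
          rw [← Finset.mul_sum, ← Finset.sum_mul]
          ring
      _ ≤ _ := by gcongr

lemma exists_lintegral_truncatedFunctional_le [Nontrivial A] {p : PMF A} (hp : ∀ x, 0 < p x)
    (hφ : φ (emptyTrie A) = 0) (hr : 1 < r)
    (h : ∀ t, ∫⁻ ω, ‖φ (poissonTrie ω)‖ₑ ^ r ∂(poissonModel p t) < ⊤) (t : ℝ≥0) :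
    ∃ C : ℝ≥0∞, C < ⊤ ∧ ∀ m, ∫⁻ ω, ‖truncatedFunctional φ m (poissonTrie ω)‖ₑ ^ r
      ∂(poissonModel p t) ≤ C := by
  have hr0 : 0 < r := by linarith
  have hr1 : 0 < r - 1 := by linarith
  set ρ : ℝ := ∑ x, (letterProb p x : ℝ) ^ (2 : ℝ) with hρ
  have hρ0 : 0 ≤ ρ := Finset.sum_nonneg fun x _ => by positivity
  have hρ1 : ρ < 1 := sum_letterProb_rpow_lt_one hp one_lt_two
  -- The loss per level must not spoil the contraction factor `ρ < 1`.
  obtain ⟨δ, hδρ, hδ⟩ : ∃ δ : ℝ, (δ + 1) ^ (r - 1) * ρ < 1 ∧ 0 < δ := by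
    have hcont : Tendsto (fun δ : ℝ => (δ + 1) ^ (r - 1) * ρ) (𝓝[>] 0)
        (𝓝 ((0 + 1) ^ (r - 1) * ρ)) := by
      refine Tendsto.mono_left ?_ nhdsWithin_le_nhds
      exact ((((continuous_id.add continuous_const).tendsto 0).rpow_const
        (Or.inr hr1.le))).mul_const ρ
    have hlt : ((0 : ℝ) + 1) ^ (r - 1) * ρ < 1 := by simpa using hρ1
    exact ((hcont.eventually_lt_const hlt).and self_mem_nhdsWithin).exists
  -- Large enough for the doubled mean needed in the tilting step, and positive even when `t = 0`.
  set t₀ : ℝ≥0 := 2 * t + 1 with ht₀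
  have ht₀pos : 0 < t₀ := by positivity
  set M := ∫⁻ ω, ‖innerToll φ (poissonTrie ω)‖ₑ ^ r ∂(poissonModel p t₀) with hM
  have hMtop : M < ⊤ := lintegral_innerToll_rpow_lt_top hr0 (h t₀)
  have hmeasI : Measurable fun ω : ℕ × (ℕ → ℕ → A) => ‖innerToll φ (poissonTrie ω)‖ₑ ^ r :=
    (Measurable.of_discrete (f := fun T => ‖innerToll φ T‖ₑ ^ r)).comp measurable_poissonTrie
  set k : ℝ := Real.exp t₀ / t₀ ^ 2 * M.toReal with hk
  have hk0 : 0 ≤ k := by positivity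
  have hbound : ∀ s ≤ t₀, ∫⁻ ω, ‖innerToll φ (poissonTrie ω)‖ₑ ^ r ∂(poissonModel p s) ≤
      ENNReal.ofReal k * (s : ℝ≥0∞) ^ 2 := by
    intro s hs
    refine (lintegral_poissonModel_le_sq p hs ht₀pos hmeasI fun n hn Ξ => ?_).trans (le_of_eq ?_)
    · rw [innerToll_poissonTrie_of_le_one hφ hn]
      simp [hr0]
    · rw [← hM, ← ENNReal.ofReal_toReal hMtop.ne, ← ENNReal.ofReal_mul (by positivity),
        show (s : ℝ≥0∞) ^ 2 = ENNReal.ofReal ((s : ℝ) ^ 2) by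
          rw [ENNReal.ofReal_pow (by positivity), ENNReal.ofReal_coe_nnreal],
        ← ENNReal.ofReal_mul hk0]
      congr 1
      rw [hk]
      field_simp
  set c : ℝ := (δ + 1) ^ (r - 1) with hc
  have hc0 : 0 < c := by positivity
  have hcENN : (ENNReal.ofReal δ + 1) ^ (r - 1) = ENNReal.ofReal c := by
    rw [← ENNReal.ofReal_one, ← ENNReal.ofReal_add hδ.le zero_le_one,
      ENNReal.ofReal_rpow_of_pos (by positivity)]
  have hρENN : ∑ x, (letterProb p x : ℝ≥0∞) ^ 2 = ENNReal.ofReal ρ := by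
    rw [hρ, ENNReal.ofReal_sum_of_nonneg fun x _ => by positivity]
    refine Finset.sum_congr rfl fun x _ => ?_
    rw [Real.rpow_two, ENNReal.ofReal_pow (by positivity), ENNReal.ofReal_coe_nnreal]
  -- The fixed point of `K ↦ k + c * ρ * K`.
  set K : ℝ := k / (1 - c * ρ) with hKdef
  have h1cρ : 0 < 1 - c * ρ := by linarith
  have hK0 : 0 ≤ K := by positivity
  have hK : ENNReal.ofReal k + (ENNReal.ofReal δ + 1) ^ (r - 1) *
      (∑ x, (letterProb p x : ℝ≥0∞) ^ 2) * ENNReal.ofReal K ≤ ENNReal.ofReal K := by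
    rw [hcENN, hρENN, ← ENNReal.ofReal_mul hc0.le, ← ENNReal.ofReal_mul (by positivity),
      ← ENNReal.ofReal_add hk0 (by positivity)]
    refine le_of_eq (congrArg _ ?_)
    rw [hKdef]
    field_simp
    ring
  have hG := fun m => lintegral_weightedFunctional_le p hφ hr0 hK hbound m (2 * t)
    (by rw [ht₀]; exact le_self_add)
  obtain ⟨B, hB⟩ := exists_rpow_le_two_pow hr1
  have hδ0 : ENNReal.ofReal δ ≠ 0 := by simpa using hδ
  set D := (ENNReal.ofReal δ + 1) ^ (r - 1) * (ENNReal.ofReal δ ^ (r - 1))⁻¹ with hD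
  have hDtop : D ≠ ⊤ := by
    refine ENNReal.mul_ne_top (by rw [hcENN]; exact ENNReal.ofReal_ne_top) ?_
    rw [Ne, ENNReal.inv_eq_top]
    simp [hδ]
  refine ⟨D * B * ENNReal.ofReal (Real.exp t) *
    (ENNReal.ofReal K * ((2 * t : ℝ≥0) : ℝ≥0∞) ^ 2), ?_, fun m => ?_⟩
  · refine ENNReal.mul_lt_top (ENNReal.mul_lt_top (ENNReal.mul_lt_top hDtop.lt_top
      ENNReal.coe_lt_top) ENNReal.ofReal_lt_top) (ENNReal.mul_lt_top ENNReal.ofReal_lt_top ?_)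
    exact ENNReal.pow_lt_top ENNReal.coe_lt_top
  -- The factor `n ^ (r - 1)` left by Hölder is at most `B * 2 ^ n`, which doubling the mean
  -- absorbs.
  · refine (lintegral_poissonModel_tilt p t (G := fun ω =>
      weightedFunctional φ r ((ENNReal.ofReal δ + 1) ^ (r - 1)) m (poissonTrie ω))
      ((Measurable.of_discrete (f := fun T => ‖truncatedFunctional φ m T‖ₑ ^ r)).comp
        measurable_poissonTrie) (Measurable.of_discrete.comp measurable_poissonTrie) (D * B)
      fun n Ξ => ?_).trans ?_
    · refine (enorm_truncatedFunctional_rpow_le hφ hr hδ0 ENNReal.ofReal_ne_top m _).trans ?_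
      rw [← hD, mul_assoc D B]
      refine mul_le_mul_left (mul_le_mul_right (le_trans ?_ (hB n)) D) _
      refine ENNReal.rpow_le_rpow ?_ hr1.le
      exact_mod_cast card_poissonStrings_le (n, Ξ)
    · exact mul_le_mul_right (hG m) _

/-- If the toll function has finite moments of order `r` in all Poisson models, then so has the
additive functional. -/
lemma lintegral_additiveFunctional_rpow_lt_top [Nontrivial A] {p : PMF A} (hp : ∀ x, 0 < p x)
    (hφ : φ (emptyTrie A) = 0) (hr : 1 < r)
    (h : ∀ t, ∫⁻ ω, ‖φ (poissonTrie ω)‖ₑ ^ r ∂(poissonModel p t) < ⊤) (t : ℝ≥0) :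
    ∫⁻ ω, ‖additiveFunctional φ (poissonTrie ω)‖ₑ ^ r ∂(poissonModel p t) < ⊤ := by
  have hr0 : 0 < r := by linarith
  obtain ⟨C, hC, hCm⟩ := exists_lintegral_truncatedFunctional_le hp hφ hr h t
  obtain ⟨B, hB⟩ := exists_rpow_le_two_pow hr0
  let F : ℕ → ℕ × (ℕ → ℕ → A) → ℝ≥0∞ := fun m ω =>
    2 ^ (r - 1) * (((ω.1 : ℝ≥0∞) * ‖leafToll φ‖ₑ) ^ r +
      ‖truncatedFunctional φ m (poissonTrie ω)‖ₑ ^ r)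
  have hN : Measurable fun ω : ℕ × (ℕ → ℕ → A) => ((ω.1 : ℝ≥0∞) * ‖leafToll φ‖ₑ) ^ r :=
    (Measurable.of_discrete (f := fun n : ℕ => ((n : ℝ≥0∞) * ‖leafToll φ‖ₑ) ^ r)).comp
      measurable_fst
  have hT : ∀ m, Measurable fun ω : ℕ × (ℕ → ℕ → A) =>
      ‖truncatedFunctional φ m (poissonTrie ω)‖ₑ ^ r := fun m =>
    (Measurable.of_discrete (f := fun T => ‖truncatedFunctional φ m T‖ₑ ^ r)).comp
      measurable_poissonTrie
  -- For each outcome the strings are separated at some finite depth, beyond which truncation is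
  -- exact. Fatou's lemma then transfers the bounds that are uniform in `m`.
  have hle : ∀ ω, ‖additiveFunctional φ (poissonTrie ω)‖ₑ ^ r ≤
      liminf (fun m => F m ω) atTop := by
    intro ω
    obtain ⟨L, hL⟩ := exists_separating_length (poissonStrings ω)
    refine le_liminf_of_le (by isBoundedDefault) ?_
    filter_upwards [eventually_ge_atTop L] with m hm
    refine le_trans ?_ (ENNReal.rpow_add_le_mul_rpow_add_rpow _ _ hr.le)
    gcongr
    rw [poissonTrie_eq, additiveFunctional_eq_truncatedFunctional hφ hL m hm]
    refine (enorm_add_le _ _).trans ?_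
    gcongr
    rw [enorm_mul]
    gcongr
    rw [Real.enorm_natCast]
    exact_mod_cast card_poissonStrings_le ω
  set E := ENNReal.ofReal (Real.exp t) with hE
  have hNint : ∫⁻ ω, ((ω.1 : ℝ≥0∞) * ‖leafToll φ‖ₑ) ^ r ∂(poissonModel p t) ≤
      B * ‖leafToll φ‖ₑ ^ r * E * 1 := by
    refine (lintegral_poissonModel_tilt p t hN (G := fun _ => 1) measurable_const
      (B * ‖leafToll φ‖ₑ ^ r) fun n Ξ => ?_).trans (by simp [hE])
    rw [ENNReal.mul_rpow_of_nonneg _ _ hr0.le, mul_one]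
    calc _ ≤ B * 2 ^ n * ‖leafToll φ‖ₑ ^ r := mul_le_mul_left (hB n) _
      _ = _ := by ring
  calc _ ≤ ∫⁻ ω, liminf (fun m => F m ω) atTop ∂(poissonModel p t) := lintegral_mono hle
    _ ≤ liminf (fun m => ∫⁻ ω, F m ω ∂(poissonModel p t)) atTop :=
        lintegral_liminf_le fun m => (hN.add (hT m)).const_mul _
    _ ≤ liminf (fun _ : ℕ => 2 ^ (r - 1) * (B * ‖leafToll φ‖ₑ ^ r * E * 1 + C)) atTop := by
        refine liminf_le_liminf (Eventually.of_forall fun m => ?_)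
        simp only [F]
        have hm : Measurable fun ω : ℕ × (ℕ → ℕ → A) => ((ω.1 : ℝ≥0∞) * ‖leafToll φ‖ₑ) ^ r +
            ‖truncatedFunctional φ m (poissonTrie ω)‖ₑ ^ r := hN.add (hT m)
        rw [lintegral_const_mul _ hm, lintegral_add_left hN]
        gcongr
        exact hCm m
    _ < ⊤ := by
        rw [liminf_const]
        refine ENNReal.mul_lt_top (ENNReal.rpow_lt_top_of_nonneg (by linarith) (by simp))
          (ENNReal.add_lt_top.mpr ⟨?_, hC⟩)
        rw [mul_one]
        exact ENNReal.mul_lt_top (ENNReal.mul_lt_top ENNReal.coe_lt_top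
          (ENNReal.rpow_lt_top_of_nonneg hr0.le enorm_ne_top)) ENNReal.ofReal_lt_top

end Finiteness

/-! ### Moments of sums -/

/-- The sum is compared with its largest term `x k` through the tangent line of the `r`-th power at
`S`, and `S ≤ card * x k`. The diagonal terms keep the coefficient exactly `1`, as the contraction
requires; all constants fall on the mixed terms. -/
lemma sum_rpow_le {ι : Type*} [Fintype ι] [DecidableEq ι] [Nonempty ι] {r : ℝ} (hr : 1 ≤ r)
    {x : ι → ℝ} (hx : ∀ i, 0 ≤ x i) :
    (∑ i, x i) ^ r ≤ ∑ i, x i ^ r + r * (Fintype.card ι : ℝ) ^ (r - 1) *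
      ∑ i, ∑ j ∈ Finset.univ.erase i, x i ^ (r - 1) * x j := by
  set S := ∑ i, x i with hS
  obtain ⟨k, hk⟩ := Finite.exists_max x
  have hS0 : 0 ≤ S := Finset.sum_nonneg fun i _ => hx i
  have hnonneg : ∀ i, 0 ≤ ∑ j ∈ Finset.univ.erase i, x i ^ (r - 1) * x j := fun i =>
    Finset.sum_nonneg fun j _ => mul_nonneg (Real.rpow_nonneg (hx i) _) (hx j)
  rcases hS0.eq_or_lt with h0 | hpos
  · rw [← h0, Real.zero_rpow (by linarith)]
    have := Finset.sum_nonneg fun i (_ : i ∈ Finset.univ) => hnonneg i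
    have := Finset.sum_nonneg fun i (_ : i ∈ Finset.univ) => Real.rpow_nonneg (hx i) r
    positivity
  have hSk : S - x k = ∑ j ∈ Finset.univ.erase k, x j := by
    rw [hS, ← Finset.add_sum_erase _ _ (Finset.mem_univ k)]
    ring
  have hSle : S ≤ Fintype.card ι * x k := by
    rw [hS, ← nsmul_eq_mul, ← Finset.card_univ]
    exact Finset.sum_le_card_nsmul _ _ _ fun i _ => hk i
  have hbern : S ^ r - x k ^ r ≤ r * S ^ (r - 1) * (S - x k) := by
    have h := one_add_mul_self_le_rpow_one_add (s := x k / S - 1)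
      (by have := div_nonneg (hx k) hS0; linarith) hr
    rw [add_sub_cancel, Real.div_rpow (hx k) hS0, le_div_iff₀ (by positivity)] at h
    have h2 : S ^ r = S ^ (r - 1) * S := by
      rw [← Real.rpow_add_one hpos.ne']
      ring_nf
    have h3 : (1 + r * (x k / S - 1)) * S ^ r = S ^ r - r * S ^ (r - 1) * (S - x k) := by
      rw [h2]
      field_simp
      ring
    linarith
  have hpow : S ^ (r - 1) ≤ (Fintype.card ι : ℝ) ^ (r - 1) * x k ^ (r - 1) := by
    rw [← Real.mul_rpow (by positivity) (hx k)]
    exact Real.rpow_le_rpow hS0 hSle (by linarith)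
  have h1 : x k ^ r ≤ ∑ i, x i ^ r :=
    Finset.single_le_sum (f := fun i => x i ^ r) (fun i _ => Real.rpow_nonneg (hx i) r)
      (Finset.mem_univ k)
  have h2 : x k ^ (r - 1) * (S - x k) ≤
      ∑ i, ∑ j ∈ Finset.univ.erase i, x i ^ (r - 1) * x j := by
    rw [hSk, Finset.mul_sum]
    exact Finset.single_le_sum (f := fun i => ∑ j ∈ Finset.univ.erase i, x i ^ (r - 1) * x j)
      (fun i _ => hnonneg i) (Finset.mem_univ k)
  have hSk0 : 0 ≤ S - x k := by
    rw [hSk]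
    exact Finset.sum_nonneg fun i _ => hx i
  calc S ^ r ≤ x k ^ r + r * S ^ (r - 1) * (S - x k) := by linarith
    _ ≤ x k ^ r + r * ((Fintype.card ι : ℝ) ^ (r - 1) * x k ^ (r - 1)) * (S - x k) := by gcongr
    _ = x k ^ r + r * (Fintype.card ι : ℝ) ^ (r - 1) * (x k ^ (r - 1) * (S - x k)) := by ring
    _ ≤ _ := by gcongr

/-- Convexity with weights `1 - θ` and `θ`. A small `θ` keeps the first coefficient close to `1`. -/
lemma abs_add_rpow_le {r θ : ℝ} (hr : 1 ≤ r) (hθ : 0 < θ) (hθ1 : θ < 1) (x y : ℝ) :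
    |x + y| ^ r ≤ (1 - θ) ^ (1 - r) * |x| ^ r + θ ^ (1 - r) * |y| ^ r := by
  have h1θ : 0 < 1 - θ := by linarith
  have hc := (convexOn_rpow hr).2 (x := |x| / (1 - θ)) (y := |y| / θ)
    (Set.mem_Ici.mpr (by positivity)) (Set.mem_Ici.mpr (by positivity)) h1θ.le hθ.le (by ring)
  simp only [smul_eq_mul] at hc
  rw [mul_div_cancel₀ _ h1θ.ne', mul_div_cancel₀ _ hθ.ne', Real.div_rpow (abs_nonneg _) h1θ.le,
    Real.div_rpow (abs_nonneg _) hθ.le] at hc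
  have e : ∀ a : ℝ, 0 < a → ∀ b : ℝ, a * (b / a ^ r) = a ^ (1 - r) * b := fun a ha b => by
    rw [Real.rpow_sub ha, Real.rpow_one]
    ring
  rw [e _ h1θ, e _ hθ] at hc
  exact (Real.rpow_le_rpow (abs_nonneg _) (abs_add_le x y) (by linarith)).trans hc

section Probability

variable {Ω : Type*} [MeasurableSpace Ω] {μ : Measure Ω} [IsProbabilityMeasure μ]

lemma integrable_abs_rpow {X : Ω → ℝ} {r s : ℝ} (hX : MemLp X (ENNReal.ofReal r) μ) (hs : 0 ≤ s)
    (hsr : s ≤ r) : Integrable (fun ω => |X ω| ^ s) μ := by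
  have h := (hX.mono_exponent (ENNReal.ofReal_le_ofReal hsr)).integrable_norm_rpow'
  simpa [ENNReal.toReal_ofReal hs] using h

/-- Jensen's inequality for the power `r / s ≥ 1`. -/
lemma integral_abs_rpow_le {X : Ω → ℝ} {r s : ℝ} (hX : MemLp X (ENNReal.ofReal r) μ) (hs : 0 < s)
    (hsr : s ≤ r) : ∫ ω, |X ω| ^ s ∂μ ≤ (∫ ω, |X ω| ^ r ∂μ) ^ (s / r) := by
  have hr : 0 < r := hs.trans_le hsr
  have hpow : ∀ ω, (|X ω| ^ s) ^ (r / s) = |X ω| ^ r := fun ω => by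
    rw [← Real.rpow_mul (abs_nonneg _), mul_div_cancel₀ _ hs.ne']
  have h := (convexOn_rpow ((one_le_div hs).mpr hsr)).map_integral_le (μ := μ)
    (f := fun ω => |X ω| ^ s) (Real.continuous_rpow_const (by positivity)).continuousOn
    isClosed_Ici (Eventually.of_forall fun ω => Set.mem_Ici.mpr (by positivity))
    (integrable_abs_rpow hX hs.le hsr)
    (by simpa [Function.comp_def, hpow] using integrable_abs_rpow hX hr.le le_rfl)
  simp only [hpow] at h
  have h0 : 0 ≤ ∫ ω, |X ω| ^ s ∂μ := integral_nonneg fun ω => by positivity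
  have h1 := Real.rpow_le_rpow (by positivity) h (z := s / r) (by positivity)
  rwa [← Real.rpow_mul h0, show r / s * (s / r) = 1 by field_simp, Real.rpow_one] at h1

/-- By independence each mixed term of `sum_rpow_le` has expectation `E |W i| ^ (r - 1) * E |W j|`,
so it involves only the power `(r - 1) / r` of the bound `m i`. -/
lemma integral_abs_sum_rpow_le {ι : Type*} [Fintype ι] [DecidableEq ι] [Nonempty ι]
    {W : ι → Ω → ℝ} {r v : ℝ} {m : ι → ℝ} (hr : 1 < r) (hind : iIndepFun W μ)
    (hW : ∀ i, MemLp (W i) (ENNReal.ofReal r) μ) (hm : ∀ i, ∫ ω, |W i ω| ^ r ∂μ ≤ m i)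
    (hv : ∀ i, ∫ ω, |W i ω| ∂μ ≤ v) :
    ∫ ω, |∑ i, W i ω| ^ r ∂μ ≤ ∑ i, m i + r * (Fintype.card ι : ℝ) ^ (r - 1) *
      ∑ i, ∑ _j ∈ Finset.univ.erase i, m i ^ ((r - 1) / r) * v := by
  have hr0 : 0 < r := by linarith
  have hr1 : 0 < r - 1 := by linarith
  have hint1 : ∀ i, Integrable (fun ω => |W i ω| ^ r) μ := fun i =>
    integrable_abs_rpow (hW i) hr0.le le_rfl
  have hint2 : ∀ i, Integrable (fun ω => |W i ω| ^ (r - 1)) μ := fun i =>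
    integrable_abs_rpow (hW i) hr1.le (by linarith)
  have hint3 : ∀ i, Integrable (fun ω => |W i ω|) μ := fun i => by
    simpa using integrable_abs_rpow (hW i) zero_le_one hr.le
  have hindep : ∀ i j, i ≠ j → IndepFun (fun ω => |W i ω| ^ (r - 1)) (fun ω => |W j ω|) μ :=
    fun i j hij => (hind.indepFun hij).comp (φ := fun x : ℝ => |x| ^ (r - 1))
      (ψ := fun x : ℝ => |x|) (by fun_prop) (by fun_prop)
  have hint4 : ∀ i, ∀ j ∈ Finset.univ.erase i,
      Integrable (fun ω => |W i ω| ^ (r - 1) * |W j ω|) μ := fun i j hj =>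
    (hindep i j (Finset.ne_of_mem_erase hj).symm).integrable_mul (hint2 i) (hint3 j)
  have hint5 : Integrable (fun ω => ∑ i, ∑ j ∈ Finset.univ.erase i,
      |W i ω| ^ (r - 1) * |W j ω|) μ :=
    integrable_finsetSum _ fun i _ => integrable_finsetSum _ fun j hj => hint4 i j hj
  have hint6 : Integrable (fun ω => ∑ i, |W i ω| ^ r) μ :=
    integrable_finsetSum _ fun i _ => hint1 i
  calc ∫ ω, |∑ i, W i ω| ^ r ∂μ ≤ ∫ ω, (∑ i, |W i ω| ^ r + r * (Fintype.card ι : ℝ) ^ (r - 1) *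
        ∑ i, ∑ j ∈ Finset.univ.erase i, |W i ω| ^ (r - 1) * |W j ω|) ∂μ := by
        refine integral_mono_of_nonneg (Eventually.of_forall fun ω => by positivity)
          (hint6.add (hint5.const_mul _)) (Eventually.of_forall fun ω => ?_)
        exact (Real.rpow_le_rpow (abs_nonneg _) (Finset.abs_sum_le_sum_abs _ _) hr0.le).trans
          (sum_rpow_le hr.le fun i => abs_nonneg _)
    _ = ∑ i, ∫ ω, |W i ω| ^ r ∂μ + r * (Fintype.card ι : ℝ) ^ (r - 1) *
        ∑ i, ∑ j ∈ Finset.univ.erase i, (∫ ω, |W i ω| ^ (r - 1) ∂μ) * ∫ ω, |W j ω| ∂μ := by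
        rw [integral_add hint6 (hint5.const_mul _), integral_finsetSum _ fun i _ => hint1 i,
          integral_const_mul, integral_finsetSum _ fun i _ =>
            integrable_finsetSum _ fun j hj => hint4 i j hj]
        congr 2
        refine Finset.sum_congr rfl fun i _ => ?_
        rw [integral_finsetSum _ fun j hj => hint4 i j hj]
        refine Finset.sum_congr rfl fun j hj => ?_
        exact (hindep i j (Finset.ne_of_mem_erase hj).symm).integral_fun_mul_eq_mul_integral
          (hint2 i).aestronglyMeasurable (hint3 j).aestronglyMeasurable
    _ ≤ _ := by
        gcongr with i _ i _ j _
        · exact hm i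
        · exact Real.rpow_nonneg ((integral_nonneg fun ω => by positivity).trans (hm i)) _
        · refine (integral_abs_rpow_le (hW i) hr1 (by linarith)).trans ?_
          exact Real.rpow_le_rpow (integral_nonneg fun ω => by positivity) (hm i) (by positivity)
        · exact hv j

end Probability

/-! ### Families with a stochastic recursion -/

/-- A family of random variables `Z`, under probability measures `P t`, that satisfies the
distributional recursion `Z = Y + ∑ x, W x`, where the `W x` are independent and `W x` under `P t`
is distributed as `Z` under `P (q x * t)`. The toll `Y` is of smaller order than `Z`. -/
structure RecursiveFamily [Fintype A] {Ω : Type*} [MeasurableSpace Ω] (q : A → ℝ≥0)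
    (P : ℝ≥0 → Measure Ω) (Z Y : Ω → ℝ) (W : A → Ω → ℝ) (r : ℝ) : Prop where
  two_lt : 2 < r
  sum_eq_one : ∑ x, q x = 1
  pos : ∀ x, 0 < q x
  lt_one : ∀ x, q x < 1
  isProbabilityMeasure : ∀ t, IsProbabilityMeasure (P t)
  measurable : Measurable Z
  measurable_child : ∀ x, Measurable (W x)
  decomp : ∀ ω, Z ω = Y ω + ∑ x, W x ω
  indep : ∀ t, iIndepFun W (P t)
  map_child : ∀ t x, (P t).map (W x) = (P (q x * t)).map Z
  memLp : ∀ t, MemLp Z (ENNReal.ofReal r) (P t)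
  -- Supplies the base case of the induction over `t`.
  bounded : ∀ t₀ : ℝ≥0, ∃ C, ∀ t ≤ t₀, ∫ ω, |Z ω - ∫ ω', Z ω' ∂(P t)| ^ r ∂(P t) ≤ C
  variance_le : ∃ V, ∀ᶠ t : ℝ≥0 in atTop, Var[Z; P t] ≤ V * t
  toll_variance : Tendsto (fun t : ℝ≥0 => Var[Y; P t] / t) atTop (𝓝 0)
  toll_moment : ∃ C, ∀ᶠ t : ℝ≥0 in atTop,
    ∫ ω, |Y ω - ∫ ω', Y ω' ∂(P t)| ^ r ∂(P t) ≤ C * (t : ℝ) ^ (r / 2)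

lemma integral_abs_sub_integral_le {Ω : Type*} [MeasurableSpace Ω] {μ : Measure Ω}
    [IsProbabilityMeasure μ] {X : Ω → ℝ} (hX : MemLp X 2 μ) :
    ∫ ω, |X ω - ∫ ω', X ω' ∂μ| ∂μ ≤ √(Var[X; μ]) := by
  have hm : MemLp (fun ω => X ω - ∫ ω', X ω' ∂μ) (ENNReal.ofReal 2) μ := by
    rw [ENNReal.ofReal_ofNat]
    exact hX.sub (memLp_const _)
  have h1 := integral_abs_rpow_le hm one_pos one_le_two
  rw [variance_eq_integral hX.aestronglyMeasurable.aemeasurable, Real.sqrt_eq_rpow]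
  simpa using h1

/-- Induction along the recursion: repeated factors of at most `max q < 1` bring `t` below `t₀`,
while `ht` keeps the children of any `t ≥ t₀` above `t₁`. -/
lemma forall_ge_of_forall_mul [Fintype A] [Nonempty A] {q : A → ℝ≥0} (hlt : ∀ x, q x < 1)
    {t₁ t₀ : ℝ≥0} (h0 : 0 < t₀) (ht : ∀ x, t₁ ≤ q x * t₀) {S : ℝ≥0 → Prop}
    (hbase : ∀ t, t₁ ≤ t → t ≤ t₀ → S t) (hstep : ∀ t, t₀ ≤ t → (∀ x, S (q x * t)) → S t)
    (t : ℝ≥0) (htt : t₁ ≤ t) : S t := by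
  obtain ⟨k, hk⟩ := Finite.exists_max q
  have key : ∀ n : ℕ, ∀ t, t₁ ≤ t → q k ^ n * t ≤ t₀ → S t := by
    intro n
    induction n with
    | zero => intro t h1 h2; exact hbase t h1 (by simpa using h2)
    | succ n ih =>
      intro t h1 h2
      rcases le_total t t₀ with h | h
      · exact hbase t h1 h
      · refine hstep t h fun x => ih _ ((ht x).trans (by gcongr)) (le_trans ?_ h2)
        calc q k ^ n * (q x * t) ≤ q k ^ n * (q k * t) := by gcongr; exact hk x
          _ = q k ^ (n + 1) * t := by ring
  have hlim : Tendsto (fun n : ℕ => q k ^ n * t) atTop (𝓝 (0 * t)) :=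
    (tendsto_pow_atTop_nhds_zero_of_lt_one zero_le (hlt k)).mul_const t
  rw [zero_mul] at hlim
  obtain ⟨n, hn⟩ := (hlim.eventually_le_const h0).exists
  exact key n t htt hn

/-! ### Growth of the central moments in a recursive family -/

namespace RecursiveFamily

variable [Fintype A] {Ω : Type*} [MeasurableSpace Ω] {q : A → ℝ≥0} {P : ℝ≥0 → Measure Ω}
  {Z Y : Ω → ℝ} {W : A → Ω → ℝ} {r : ℝ}

lemma memLp_child (h : RecursiveFamily q P Z Y W r) (t : ℝ≥0) (x : A) :
    MemLp (W x) (ENNReal.ofReal r) (P t) := by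
  have h1 : MemLp id (ENNReal.ofReal r) ((P (q x * t)).map Z) :=
    (memLp_map_measure_iff aestronglyMeasurable_id h.measurable.aemeasurable).mpr (h.memLp _)
  rw [← h.map_child] at h1
  exact (memLp_map_measure_iff aestronglyMeasurable_id
    (h.measurable_child x).aemeasurable).mp h1

lemma memLp_toll (h : RecursiveFamily q P Z Y W r) (t : ℝ≥0) :
    MemLp Y (ENNReal.ofReal r) (P t) := by
  have h1 : Y = fun ω => Z ω - ∑ x, W x ω := by
    funext ω
    rw [h.decomp]
    ring
  rw [h1]
  exact (h.memLp t).sub (memLp_finsetSum _ fun x _ => h.memLp_child t x)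

lemma integral_child (h : RecursiveFamily q P Z Y W r) (t : ℝ≥0) (x : A) {E : Type*}
    [NormedAddCommGroup E] [NormedSpace ℝ E] {f : ℝ → E} (hf : StronglyMeasurable f) :
    ∫ ω, f (W x ω) ∂(P t) = ∫ ω, f (Z ω) ∂(P (q x * t)) := by
  rw [← integral_map (h.measurable_child x).aemeasurable hf.aestronglyMeasurable, h.map_child,
    integral_map h.measurable.aemeasurable hf.aestronglyMeasurable]

lemma integral_child_self (h : RecursiveFamily q P Z Y W r) (t : ℝ≥0) (x : A) :
    ∫ ω, W x ω ∂(P t) = ∫ ω, Z ω ∂(P (q x * t)) :=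
  h.integral_child t x stronglyMeasurable_id

lemma variance_child (h : RecursiveFamily q P Z Y W r) (t : ℝ≥0) (x : A) :
    Var[W x; P t] = Var[Z; P (q x * t)] := by
  rw [variance_eq_integral (h.measurable_child x).aemeasurable,
    variance_eq_integral h.measurable.aemeasurable, h.integral_child_self]
  exact h.integral_child t x (f := fun z => (z - ∫ ω, Z ω ∂(P (q x * t))) ^ 2)
    (Measurable.stronglyMeasurable (by fun_prop))

lemma ofReal_two_le (h : RecursiveFamily q P Z Y W r) : 2 ≤ ENNReal.ofReal r := by
  rw [← ENNReal.ofReal_ofNat]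
  exact ENNReal.ofReal_le_ofReal h.two_lt.le

lemma ofReal_one_le (h : RecursiveFamily q P Z Y W r) : 1 ≤ ENNReal.ofReal r :=
  one_le_two.trans h.ofReal_two_le

lemma sub_integral_eq (h : RecursiveFamily q P Z Y W r) (t : ℝ≥0) (ω : Ω) :
    Z ω - ∫ ω', Z ω' ∂(P t) = (∑ x, (W x ω - ∫ ω', W x ω' ∂(P t))) +
      (Y ω - ∫ ω', Y ω' ∂(P t)) := by
  have := h.isProbabilityMeasure t
  have h1 : ∫ ω', Z ω' ∂(P t) = ∫ ω', Y ω' ∂(P t) + ∑ x, ∫ ω', W x ω' ∂(P t) := by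
    simp_rw [h.decomp]
    rw [integral_add ((h.memLp_toll t).integrable h.ofReal_one_le)
      (integrable_finsetSum _ fun x _ => (h.memLp_child t x).integrable h.ofReal_one_le),
      integral_finsetSum _ fun x _ => (h.memLp_child t x).integrable h.ofReal_one_le]
  rw [h1, h.decomp, Finset.sum_sub_distrib]
  ring

lemma integral_abs_sub_le (h : RecursiveFamily q P Z Y W r) (t : ℝ≥0) :
    ∫ ω, |Z ω - ∫ ω', Z ω' ∂(P t)| ∂(P t) ≤ √(Var[Z; P t]) :=
  have := h.isProbabilityMeasure t
  integral_abs_sub_integral_le ((h.memLp t).mono_exponent h.ofReal_two_le)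

/-- The coefficient of `K` is close to `∑ x, q x ^ (r / 2)`, and the mixed terms involve only `K ^
((r - 1) / r)`. A large `K` is therefore preserved by the recursion. -/
lemma integral_rpow_step (h : RecursiveFamily q P Z Y W r) [Nonempty A] {t : ℝ≥0} (ht : 0 < t)
    {V C K θ : ℝ} (hK : 0 ≤ K) (hθ : 0 < θ) (hθ1 : θ < 1)
    (hV : ∀ x, Var[Z; P (q x * t)] ≤ V * (q x * t : ℝ≥0))
    (hV0 : 0 ≤ V)
    (hC : ∫ ω, |Y ω - ∫ ω', Y ω' ∂(P t)| ^ r ∂(P t) ≤ C * (t : ℝ) ^ (r / 2))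
    (hm : ∀ x, ∫ ω, |Z ω - ∫ ω', Z ω' ∂(P (q x * t))| ^ r ∂(P (q x * t)) ≤
      K * ((q x * t : ℝ≥0) : ℝ) ^ (r / 2)) :
    ∫ ω, |Z ω - ∫ ω', Z ω' ∂(P t)| ^ r ∂(P t) ≤
      ((1 - θ) ^ (1 - r) * ((∑ x, (q x : ℝ) ^ (r / 2)) * K +
        r * (Fintype.card A : ℝ) ^ (r - 1) * (Fintype.card A : ℝ) ^ 2 * √V * K ^ ((r - 1) / r)) +
        θ ^ (1 - r) * C) * (t : ℝ) ^ (r / 2) := by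
  classical
  have hprob := h.isProbabilityMeasure
  have hr := h.two_lt
  have ht' : (0 : ℝ) < t := ht
  set Wc : A → Ω → ℝ := fun x ω => W x ω - ∫ ω', W x ω' ∂(P t) with hWc
  have hWcm : ∀ x, MemLp (Wc x) (ENNReal.ofReal r) (P t) := fun x =>
    (h.memLp_child t x).sub (memLp_const _)
  have hind : iIndepFun Wc (P t) :=
    (h.indep t).comp (fun x z => z - ∫ ω', W x ω' ∂(P t)) fun x => by fun_prop
  have hmW : ∀ x, ∫ ω, |Wc x ω| ^ r ∂(P t) ≤ K * ((q x * t : ℝ≥0) : ℝ) ^ (r / 2) := fun x => by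
    refine le_trans (le_of_eq ?_) (hm x)
    simp only [hWc, h.integral_child_self]
    exact h.integral_child t x (f := fun z => |z - ∫ ω', Z ω' ∂(P (q x * t))| ^ r)
      (Measurable.stronglyMeasurable (by fun_prop))
  have hq1 : ∀ x, (q x : ℝ) ≤ 1 := fun x => (h.lt_one x).le
  -- First absolute moments are controlled by the variance alone, hence without `K`.
  have hvW : ∀ x, ∫ ω, |Wc x ω| ∂(P t) ≤ √V * √t := fun x => by
    calc ∫ ω, |Wc x ω| ∂(P t) = ∫ ω, |Z ω - ∫ ω', Z ω' ∂(P (q x * t))| ∂(P (q x * t)) := by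
          simp only [hWc, h.integral_child_self]
          exact h.integral_child t x (f := fun z => |z - ∫ ω', Z ω' ∂(P (q x * t))|)
            (Measurable.stronglyMeasurable (by fun_prop))
      _ ≤ √(Var[Z; P (q x * t)]) := h.integral_abs_sub_le _
      _ ≤ √(V * t) := by
          refine Real.sqrt_le_sqrt ((hV x).trans ?_)
          push_cast
          gcongr
          exact mul_le_of_le_one_left ht'.le (hq1 x)
      _ = √V * √t := Real.sqrt_mul hV0 _
  have hsum := integral_abs_sum_rpow_le (by linarith) hind hWcm hmW hvW
  have hYc : MemLp (fun ω => Y ω - ∫ ω', Y ω' ∂(P t)) (ENNReal.ofReal r) (P t) :=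
    (h.memLp_toll t).sub (memLp_const _)
  have hS : MemLp (fun ω => ∑ x, Wc x ω) (ENNReal.ofReal r) (P t) :=
    memLp_finsetSum _ fun x _ => hWcm x
  have hr0 : 0 ≤ r := by linarith
  have h1θ : 0 < 1 - θ := by linarith
  have e1 : ∑ x, K * ((q x * t : ℝ≥0) : ℝ) ^ (r / 2) =
      (∑ x, (q x : ℝ) ^ (r / 2)) * K * (t : ℝ) ^ (r / 2) := by
    rw [Finset.sum_mul, Finset.sum_mul]
    refine Finset.sum_congr rfl fun x _ => ?_
    push_cast
    rw [Real.mul_rpow (by positivity) ht'.le]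
    ring
  have e2 : ∑ x : A, ∑ _y ∈ Finset.univ.erase x,
      (K * ((q x * t : ℝ≥0) : ℝ) ^ (r / 2)) ^ ((r - 1) / r) * (√V * √t) ≤
      (Fintype.card A : ℝ) ^ 2 * √V * K ^ ((r - 1) / r) * (t : ℝ) ^ (r / 2) := by
    have hterm : ∀ x, (K * ((q x * t : ℝ≥0) : ℝ) ^ (r / 2)) ^ ((r - 1) / r) * (√V * √t) ≤
        √V * K ^ ((r - 1) / r) * (t : ℝ) ^ (r / 2) := by
      intro x
      have hqt : ((q x * t : ℝ≥0) : ℝ) ≤ t := by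
        push_cast
        exact mul_le_of_le_one_left ht'.le (hq1 x)
      have hexp : 0 ≤ (r - 1) / r := div_nonneg (by linarith) hr0
      calc _ ≤ (K * (t : ℝ) ^ (r / 2)) ^ ((r - 1) / r) * (√V * √t) := by gcongr
        _ = √V * K ^ ((r - 1) / r) * ((t : ℝ) ^ (r / 2 * ((r - 1) / r)) * (t : ℝ) ^ (1 / 2 : ℝ)) := by
            rw [Real.mul_rpow hK (by positivity), ← Real.rpow_mul ht'.le, Real.sqrt_eq_rpow (t : ℝ)]
            ring
        _ = _ := by
            -- The exponents match: `(r / 2) * ((r - 1) / r) + 1 / 2 = r / 2`.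
            rw [← Real.rpow_add ht']
            congr 2
            field_simp
            ring
    calc _ ≤ ∑ x : A, ∑ _y ∈ Finset.univ.erase x,
          √V * K ^ ((r - 1) / r) * (t : ℝ) ^ (r / 2) :=
          Finset.sum_le_sum fun x _ => Finset.sum_le_sum fun y _ => hterm x
      _ ≤ ∑ x : A, ∑ _y : A, √V * K ^ ((r - 1) / r) * (t : ℝ) ^ (r / 2) :=
          Finset.sum_le_sum fun x _ => Finset.sum_le_sum_of_subset_of_nonneg
            (Finset.subset_univ _) fun _ _ _ => by positivity
      _ = _ := by
          simp only [Finset.sum_const, Finset.card_univ, nsmul_eq_mul]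
          ring
  calc ∫ ω, |Z ω - ∫ ω', Z ω' ∂(P t)| ^ r ∂(P t)
      ≤ ∫ ω, ((1 - θ) ^ (1 - r) * |∑ x, Wc x ω| ^ r +
          θ ^ (1 - r) * |Y ω - ∫ ω', Y ω' ∂(P t)| ^ r) ∂(P t) := by
        refine integral_mono_of_nonneg (Eventually.of_forall fun ω => by positivity)
          (((integrable_abs_rpow hS hr0 le_rfl).const_mul _).add
            ((integrable_abs_rpow hYc hr0 le_rfl).const_mul _)) (Eventually.of_forall fun ω => ?_)
        simp only
        rw [h.sub_integral_eq]
        exact abs_add_rpow_le (by linarith) hθ hθ1 _ _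
    _ = (1 - θ) ^ (1 - r) * ∫ ω, |∑ x, Wc x ω| ^ r ∂(P t) +
          θ ^ (1 - r) * ∫ ω, |Y ω - ∫ ω', Y ω' ∂(P t)| ^ r ∂(P t) := by
        rw [integral_add ((integrable_abs_rpow hS hr0 le_rfl).const_mul _)
          ((integrable_abs_rpow hYc hr0 le_rfl).const_mul _), integral_const_mul,
          integral_const_mul]
    _ ≤ (1 - θ) ^ (1 - r) * ((∑ x, (q x : ℝ) ^ (r / 2)) * K * (t : ℝ) ^ (r / 2) +
          r * (Fintype.card A : ℝ) ^ (r - 1) *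
            ((Fintype.card A : ℝ) ^ 2 * √V * K ^ ((r - 1) / r) * (t : ℝ) ^ (r / 2))) +
          θ ^ (1 - r) * (C * (t : ℝ) ^ (r / 2)) := by
        gcongr
        refine hsum.trans ?_
        rw [e1]
        gcongr
    _ = _ := by ring

lemma nonempty (h : RecursiveFamily q P Z Y W r) : Nonempty A := by
  by_contra hA
  rw [not_nonempty_iff] at hA
  simpa using h.sum_eq_one

lemma sum_rpow_lt_one (h : RecursiveFamily q P Z Y W r) {s : ℝ} (hs : 1 < s) :
    ∑ x, (q x : ℝ) ^ s < 1 := by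
  have := h.nonempty
  have h1 : ∑ x, (q x : ℝ) = 1 := by exact_mod_cast h.sum_eq_one
  rw [← h1]
  exact Finset.sum_lt_sum_of_nonempty Finset.univ_nonempty fun x _ =>
    Real.rpow_lt_self_of_lt_one (h.pos x) (h.lt_one x) hs

lemma tendsto_mul_atTop (h : RecursiveFamily q P Z Y W r) (x : A) :
    Tendsto (fun t : ℝ≥0 => q x * t) atTop atTop :=
  tendsto_id.const_mul_atTop (h.pos x)

/-- The central moments of order `r` are of order `t ^ (r / 2)`. -/
theorem exists_integral_rpow_le (h : RecursiveFamily q P Z Y W r) :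
    ∃ K, ∀ᶠ t : ℝ≥0 in atTop,
      ∫ ω, |Z ω - ∫ ω', Z ω' ∂(P t)| ^ r ∂(P t) ≤ K * (t : ℝ) ^ (r / 2) := by
  have hA := h.nonempty
  have hr := h.two_lt
  obtain ⟨V, hV⟩ := h.variance_le
  obtain ⟨C, hC⟩ := h.toll_moment
  -- With `t₁ ≥ 1` the factor `t ^ (r / 2)` is at least `1`, so a constant bound suffices in the
  -- base case.
  obtain ⟨t₁, ht₁⟩ := eventually_atTop.mp ((hV.and hC).and (eventually_ge_atTop 1))
  have h1t₁ : 1 ≤ t₁ := (ht₁ t₁ le_rfl).2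
  obtain ⟨k, hk⟩ := Finite.exists_min q
  set t₀ : ℝ≥0 := t₁ / q k with ht₀
  have ht₀pos : 0 < t₀ := div_pos (by positivity) (h.pos k)
  have hqt₀ : ∀ x, t₁ ≤ q x * t₀ := fun x => by
    calc t₁ = q k * t₀ := by rw [ht₀, mul_div_cancel₀ _ (h.pos k).ne']
      _ ≤ q x * t₀ := by gcongr; exact hk x
  obtain ⟨C₀, hC₀⟩ := h.bounded t₀
  set ρ : ℝ := ∑ x, (q x : ℝ) ^ (r / 2) with hρ
  have hρ1 : ρ < 1 := h.sum_rpow_lt_one (by linarith)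
  obtain ⟨θ, ⟨hθρ, hθ1⟩, hθ⟩ : ∃ θ : ℝ, ((1 - θ) ^ (1 - r) * ρ < 1 ∧ θ < 1) ∧ 0 < θ := by
    have hcont : Tendsto (fun θ : ℝ => (1 - θ) ^ (1 - r) * ρ) (𝓝[>] 0)
        (𝓝 ((1 - 0) ^ (1 - r) * ρ)) := by
      refine Tendsto.mono_left ?_ nhdsWithin_le_nhds
      exact ((((continuous_const.sub continuous_id).tendsto 0).rpow_const
        (Or.inl (by simp)))).mul_const ρ
    have hlt : ((1 : ℝ) - 0) ^ (1 - r) * ρ < 1 := by simpa using hρ1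
    exact (((hcont.eventually_lt_const hlt).and
      (nhdsWithin_le_nhds (eventually_lt_nhds one_pos))).and self_mem_nhdsWithin).exists
  set ρ₁ := (1 - θ) ^ (1 - r) * ρ with hρ₁
  set C₃ := (1 - θ) ^ (1 - r) *
    (r * (Fintype.card A : ℝ) ^ (r - 1) * (Fintype.card A : ℝ) ^ 2 * √|V|) with hC₃
  set C₄ := θ ^ (1 - r) * |C| with hC₄
  have h1θ : 0 < 1 - θ := by linarith
  have hC₃0 : 0 ≤ C₃ := by positivity
  have hC₄0 : 0 ≤ C₄ := by positivity
  -- The constant is `K = κ ^ r`, which turns `K ^ ((r - 1) / r)` into `κ ^ (r - 1)`; the last entry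
  -- makes the remaining terms fit into `(1 - ρ₁) * κ ^ r`.
  set κ := max (max 1 C₀) ((C₃ + C₄) / (1 - ρ₁)) with hκ
  have hκ1 : 1 ≤ κ := (le_max_left _ _).trans (le_max_left _ _)
  have hκC : C₀ ≤ κ := (le_max_right _ _).trans (le_max_left _ _)
  have hκ3 : C₃ + C₄ ≤ (1 - ρ₁) * κ := by
    rw [mul_comm, ← div_le_iff₀ (by linarith)]
    exact le_max_right _ _
  have hκr : κ ^ r = κ * κ ^ (r - 1) := by
    rw [mul_comm, ← Real.rpow_add_one (by positivity)]
    ring_nf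
  have hκr1 : 1 ≤ κ ^ (r - 1) := Real.one_le_rpow hκ1 (by linarith)
  have hclose : ρ₁ * κ ^ r + C₃ * κ ^ (r - 1) + C₄ ≤ κ ^ r := by
    have h1 : (C₃ + C₄) * κ ^ (r - 1) ≤ (1 - ρ₁) * κ * κ ^ (r - 1) := by gcongr
    have h2 : C₄ ≤ C₄ * κ ^ (r - 1) := le_mul_of_one_le_right hC₄0 hκr1
    rw [hκr]
    linarith
  refine ⟨κ ^ r, eventually_atTop.mpr ⟨t₁, ?_⟩⟩
  refine forall_ge_of_forall_mul h.lt_one ht₀pos hqt₀ (fun t h1 h2 => ?_) fun t h1 h2 => ?_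
  · have hone : (1 : ℝ) ≤ (t : ℝ) ^ (r / 2) :=
      Real.one_le_rpow (by exact_mod_cast h1t₁.trans h1) (by linarith)
    calc _ ≤ C₀ := hC₀ t h2
      _ ≤ κ := hκC
      _ ≤ κ ^ r := Real.self_le_rpow_of_one_le hκ1 (by linarith)
      _ ≤ κ ^ r * (t : ℝ) ^ (r / 2) := le_mul_of_one_le_right (by positivity) hone
  · have htt : t₁ ≤ t := by
      refine ((hqt₀ k).trans ?_).trans h1
      exact mul_le_of_le_one_left zero_le (h.lt_one k).le
    have hge : ∀ x, t₁ ≤ q x * t := fun x => (hqt₀ x).trans (by gcongr)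
    refine (h.integral_rpow_step (lt_of_lt_of_le ht₀pos h1) (V := |V|) (C := |C|) (K := κ ^ r)
      (by positivity) hθ hθ1 (fun x => ?_) (abs_nonneg V) ?_ h2).trans ?_
    · refine (ht₁ _ (hge x)).1.1.trans ?_
      gcongr
      exact le_abs_self V
    · refine (ht₁ t htt).1.2.trans ?_
      gcongr
      exact le_abs_self C
    · gcongr
      refine le_trans (le_of_eq ?_) hclose
      rw [← Real.rpow_mul (by positivity), mul_div_cancel₀ _ (by linarith), hρ₁, hC₃, hC₄]
      ring

end RecursiveFamily

/-! ### Estimates for characteristic functions -/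

/-- Interpolates between the cubic Taylor remainder for `|y| ≤ 1` and the trivial quadratic bound
for `|y| > 1`, so moments of order `s` between `2` and `3` suffice. -/
lemma norm_cexp_sub_taylor_le {s : ℝ} (hs : 2 ≤ s) (hs3 : s ≤ 3) (y : ℝ) :
    ‖Complex.exp (y * Complex.I) - (1 + y * Complex.I - y ^ 2 / 2)‖ ≤ 4 * |y| ^ s := by
  have hnorm : ‖(y * Complex.I : ℂ)‖ = |y| := by simp
  rcases le_or_gt |y| 1 with hy | hy
  · have h := Complex.exp_bound (x := y * Complex.I) (by rw [hnorm]; exact hy) (n := 3) (by norm_num)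
    have hsum : ∑ m ∈ Finset.range 3, (y * Complex.I : ℂ) ^ m / m.factorial =
        1 + y * Complex.I - y ^ 2 / 2 := by
      simp [Finset.sum_range_succ, mul_pow, Complex.I_sq]
      ring
    rw [hsum, hnorm] at h
    have h3 : |y| ^ 3 ≤ |y| ^ s := by
      rcases (abs_nonneg y).eq_or_lt with h0 | h0
      · rw [← h0]
        simp [Real.zero_rpow (by linarith : s ≠ 0)]
      · rw [← Real.rpow_natCast]
        exact Real.rpow_le_rpow_of_exponent_ge h0 hy (by exact_mod_cast hs3)
    refine h.trans ?_
    have h0 : 0 ≤ |y| ^ 3 := by positivity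
    norm_num [Nat.factorial]
    linarith
  · have h1 : |y| ≤ |y| ^ s := Real.self_le_rpow_of_one_le hy.le (by linarith)
    have h2 : |y| ^ 2 ≤ |y| ^ s := by
      rw [← Real.rpow_natCast]
      exact Real.rpow_le_rpow_of_exponent_le hy.le (by exact_mod_cast hs)
    have h0 : 1 ≤ |y| ^ s := Real.one_le_rpow hy.le (by linarith)
    have hexp : ‖Complex.exp (y * Complex.I)‖ = 1 := Complex.norm_exp_ofReal_mul_I y
    have hsq : ‖((y : ℂ) ^ 2 / 2)‖ = |y| ^ 2 / 2 := by simp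
    calc _ ≤ ‖Complex.exp (y * Complex.I)‖ + (‖(1 : ℂ)‖ + ‖(y * Complex.I : ℂ)‖ +
          ‖((y : ℂ) ^ 2 / 2)‖) := by
          refine (norm_sub_le _ _).trans (add_le_add le_rfl ((norm_sub_le _ _).trans ?_))
          exact add_le_add (norm_add_le _ _) le_rfl
      _ ≤ 4 * |y| ^ s := by
          rw [hexp, hnorm, hsq, norm_one]
          linarith

lemma abs_exp_neg_sub_le {a s : ℝ} (ha : 0 ≤ a) (hs : 1 ≤ s) (hs2 : s ≤ 2) :
    |Real.exp (-a) - (1 - a)| ≤ a ^ s := by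
  have h1 : 0 ≤ Real.exp (-a) - (1 - a) := by
    have := Real.add_one_le_exp (-a)
    linarith
  rw [abs_of_nonneg h1]
  rcases le_or_gt a 1 with h | h
  · have h2 := Real.abs_exp_sub_one_sub_id_le (x := -a) (by rwa [abs_neg, abs_of_nonneg ha])
    have h3 : a ^ (2 : ℝ) ≤ a ^ s := by
      rcases ha.eq_or_lt with rfl | h0
      · simp [Real.zero_rpow (by linarith : s ≠ 0)]
      · exact Real.rpow_le_rpow_of_exponent_ge h0 h hs2
    rw [Real.rpow_two] at h3
    have := (le_abs_self _).trans h2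
    rw [neg_sq] at this
    linarith
  · have h2 : Real.exp (-a) ≤ 1 := Real.exp_le_one_iff.mpr (by linarith)
    have h3 : a ≤ a ^ s := Real.self_le_rpow_of_one_le h.le hs
    linarith

lemma abs_exp_neg_sub_exp_neg_le {a b : ℝ} (ha : 0 ≤ a) (hb : 0 ≤ b) :
    |Real.exp (-a) - Real.exp (-b)| ≤ |a - b| := by
  wlog hab : a ≤ b generalizing a b
  · rw [abs_sub_comm, abs_sub_comm a]
    exact this hb ha (le_of_not_ge hab)
  rw [abs_of_nonneg (sub_nonneg.mpr (Real.exp_le_exp.mpr (by linarith))), abs_sub_comm,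
    abs_of_nonneg (by linarith)]
  have h1 : Real.exp (-b) = Real.exp (-a) * Real.exp (-(b - a)) := by
    rw [← Real.exp_add]
    ring_nf
  have h2 : Real.exp (-a) ≤ 1 := Real.exp_le_one_iff.mpr (by linarith)
  have h3 := Real.add_one_le_exp (-(b - a))
  have h4 := Real.exp_pos (-a)
  rw [h1]
  nlinarith

/-- Factors are exchanged one at a time; the others have norm at most `1`. -/
lemma norm_prod_sub_prod_le {ι : Type*} (s : Finset ι) {f g : ι → ℂ} (hf : ∀ i, ‖f i‖ ≤ 1)
    (hg : ∀ i, ‖g i‖ ≤ 1) : ‖∏ i ∈ s, f i - ∏ i ∈ s, g i‖ ≤ ∑ i ∈ s, ‖f i - g i‖ := by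
  classical
  induction s using Finset.induction_on with
  | empty => simp
  | insert i s hi ih =>
    rw [Finset.prod_insert hi, Finset.prod_insert hi, Finset.sum_insert hi]
    have hfp : ‖∏ j ∈ s, f j‖ ≤ 1 := by
      rw [norm_prod]
      exact Finset.prod_le_one (fun _ _ => norm_nonneg _) fun j _ => hf j
    calc ‖f i * ∏ j ∈ s, f j - g i * ∏ j ∈ s, g j‖ =
          ‖(f i - g i) * ∏ j ∈ s, f j + g i * (∏ j ∈ s, f j - ∏ j ∈ s, g j)‖ := by ring_nf
      _ ≤ ‖f i - g i‖ * ‖∏ j ∈ s, f j‖ + ‖g i‖ * ‖∏ j ∈ s, f j - ∏ j ∈ s, g j‖ := by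
          rw [← norm_mul, ← norm_mul]
          exact norm_add_le _ _
      _ ≤ ‖f i - g i‖ * 1 + 1 * ∑ j ∈ s, ‖f j - g j‖ := by
          gcongr
          exact hg i
      _ = _ := by ring

/-! ### Characteristic functions against moments -/

section CharFun

variable {Ω : Type*} [MeasurableSpace Ω] {μ : Measure Ω}

lemma charFun_map_real {X : Ω → ℝ} (hX : AEMeasurable X μ) (u : ℝ) :
    charFun (μ.map X) u = ∫ ω, Complex.exp ((u * X ω : ℝ) * Complex.I) ∂μ := by
  rw [charFun_apply_real, integral_map hX (by fun_prop)]
  push_cast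
  rfl

variable [IsProbabilityMeasure μ]

lemma integrable_cexp {X : Ω → ℝ} (hX : AEMeasurable X μ) :
    Integrable (fun ω => Complex.exp (X ω * Complex.I)) μ := by
  refine Integrable.of_bound (C := 1) ?_ (Eventually.of_forall fun ω => ?_)
  · exact (Complex.measurable_exp.comp_aemeasurable
      ((Complex.measurable_ofReal.comp_aemeasurable hX).mul_const _)).aestronglyMeasurable
  · rw [Complex.norm_exp_ofReal_mul_I]

lemma norm_cexp_sub_cexp_le (x y : ℝ) :
    ‖Complex.exp (x * Complex.I) - Complex.exp (y * Complex.I)‖ ≤ |x - y| := by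
  have h1 : Complex.exp (x * Complex.I) - Complex.exp (y * Complex.I) =
      Complex.exp (y * Complex.I) * (Complex.exp (Complex.I * (x - y : ℝ)) - 1) := by
    rw [mul_sub, mul_one, ← Complex.exp_add]
    push_cast
    ring_nf
  rw [h1, norm_mul, Complex.norm_exp_ofReal_mul_I, one_mul]
  exact Real.norm_exp_I_mul_ofReal_sub_one_le

lemma norm_charFun_map_sub_le {X Y : Ω → ℝ} (hX : AEMeasurable X μ) (hY : AEMeasurable Y μ)
    (hXY : Integrable (fun ω => X ω - Y ω) μ) (u : ℝ) :
    ‖charFun (μ.map X) u - charFun (μ.map Y) u‖ ≤ |u| * ∫ ω, |X ω - Y ω| ∂μ := by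
  rw [charFun_map_real hX, charFun_map_real hY, ← integral_sub (integrable_cexp (hX.const_mul u))
    (integrable_cexp (hY.const_mul u)), ← integral_const_mul]
  refine norm_integral_le_of_norm_le (hXY.abs.const_mul _) (Eventually.of_forall fun ω => ?_)
  refine (norm_cexp_sub_cexp_le _ _).trans (le_of_eq ?_)
  rw [← mul_sub, abs_mul]

/-- Both functions are compared with their common second-order expansion `1 - u ^ 2 * m / 2`. The
normal remainder is controlled by `m ^ (s / 2) ≤ E |X| ^ s`. The bound has order greater than `2` at
`u = 0`, which the contraction exploits. -/
lemma norm_charFun_map_sub_gaussian_le {X : Ω → ℝ} {s : ℝ} (hs : 2 < s) (hs3 : s ≤ 3)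
    (hX : MemLp X (ENNReal.ofReal s) μ) (h0 : ∫ ω, X ω ∂μ = 0) (u : ℝ) :
    ‖charFun (μ.map X) u - Real.exp (-(u ^ 2 * (∫ ω, X ω ^ 2 ∂μ) / 2))‖ ≤
      5 * |u| ^ s * ∫ ω, |X ω| ^ s ∂μ := by
  have hXm := hX.aestronglyMeasurable.aemeasurable
  have hint2 : Integrable (fun ω => X ω ^ 2) μ := by
    have := integrable_abs_rpow hX zero_le_two hs.le
    simpa using this
  have hints : Integrable (fun ω => |X ω| ^ s) μ := integrable_abs_rpow hX (by linarith) le_rfl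
  have hint1 : Integrable X μ := hX.integrable (by
    rw [← ENNReal.ofReal_one]
    exact ENNReal.ofReal_le_ofReal (by linarith))
  set m := ∫ ω, X ω ^ 2 ∂μ with hm
  have hm0 : 0 ≤ m := integral_nonneg fun ω => sq_nonneg _
  have htaylor : ‖charFun (μ.map X) u - (1 - u ^ 2 * m / 2 : ℝ)‖ ≤
      4 * |u| ^ s * ∫ ω, |X ω| ^ s ∂μ := by
    have i1 : Integrable (fun ω => ((u * X ω : ℝ) : ℂ) * Complex.I) μ :=
      ((hint1.const_mul u).ofReal).mul_const _
    have hsq : ∀ ω, ((u * X ω : ℝ) : ℂ) ^ 2 / 2 = ((u ^ 2 / 2 * X ω ^ 2 : ℝ) : ℂ) := fun ω => by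
      push_cast
      ring
    have i2 : Integrable (fun ω => ((u * X ω : ℝ) : ℂ) ^ 2 / 2) μ := by
      simp_rw [hsq]
      exact (hint2.const_mul (u ^ 2 / 2)).ofReal
    have e2 : ∫ ω, ((u * X ω : ℝ) : ℂ) ^ 2 / 2 ∂μ = ((u ^ 2 * m / 2 : ℝ) : ℂ) := by
      simp_rw [hsq]
      rw [integral_complex_ofReal, integral_const_mul, ← hm]
      congr 1
      ring
    have i3 : Integrable (fun ω => 1 + ((u * X ω : ℝ) : ℂ) * Complex.I) μ :=
      (integrable_const _).add i1
    have hpoly : ((1 - u ^ 2 * m / 2 : ℝ) : ℂ) = ∫ ω, (1 + ((u * X ω : ℝ) : ℂ) * Complex.I -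
        ((u * X ω : ℝ) : ℂ) ^ 2 / 2) ∂μ := by
      rw [integral_sub i3 i2, integral_add (integrable_const _) i1, integral_mul_const,
        integral_complex_ofReal, integral_const_mul, h0, e2]
      simp
    have i4 : Integrable (fun ω => 1 + ((u * X ω : ℝ) : ℂ) * Complex.I -
        ((u * X ω : ℝ) : ℂ) ^ 2 / 2) μ := i3.sub i2
    rw [charFun_map_real hXm, hpoly, ← integral_sub (integrable_cexp (hXm.const_mul u)) i4,
      ← integral_const_mul]
    refine norm_integral_le_of_norm_le (hints.const_mul _) (Eventually.of_forall fun ω => ?_)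
    refine (norm_cexp_sub_taylor_le hs.le hs3 (u * X ω)).trans (le_of_eq ?_)
    rw [abs_mul, Real.mul_rpow (abs_nonneg _) (abs_nonneg _)]
    ring
  have hexp : ‖((1 - u ^ 2 * m / 2 : ℝ) : ℂ) - Real.exp (-(u ^ 2 * m / 2))‖ ≤
      |u| ^ s * ∫ ω, |X ω| ^ s ∂μ := by
    rw [← Complex.ofReal_sub, Complex.norm_real, Real.norm_eq_abs, abs_sub_comm]
    refine (abs_exp_neg_sub_le (s := s / 2) (by positivity) (by linarith) (by linarith)).trans ?_
    have hms : m ^ (s / 2) ≤ ∫ ω, |X ω| ^ s ∂μ := by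
      have h2 := integral_abs_rpow_le hX two_pos hs.le
      have h3 : ∫ ω, |X ω| ^ (2 : ℝ) ∂μ = m := by simp [hm]
      rw [h3] at h2
      have hI : 0 ≤ ∫ ω, |X ω| ^ s ∂μ := integral_nonneg fun ω => by positivity
      calc m ^ (s / 2) ≤ ((∫ ω, |X ω| ^ s ∂μ) ^ (2 / s)) ^ (s / 2) := by gcongr
        _ = _ := by
          rw [← Real.rpow_mul hI, div_mul_div_cancel₀ (by linarith), div_self two_ne_zero,
            Real.rpow_one]
    calc (u ^ 2 * m / 2) ^ (s / 2) ≤ (u ^ 2 * m) ^ (s / 2) := by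
          gcongr
          exact half_le_self (by positivity)
      _ = |u| ^ s * m ^ (s / 2) := by
          rw [Real.mul_rpow (sq_nonneg u) hm0, ← sq_abs, ← Real.rpow_natCast,
            ← Real.rpow_mul (abs_nonneg u)]
          congr 2
          push_cast
          ring
      _ ≤ _ := by gcongr
  calc _ ≤ _ := norm_sub_le_norm_sub_add_norm_sub _ ((1 - u ^ 2 * m / 2 : ℝ) : ℂ) _
    _ ≤ _ := add_le_add htaylor hexp
    _ = _ := by ring

end CharFun

/-! ### Gaussian approximation for recursive families -/

/-- Cauchy–Schwarz: the variance of `X + c • Y` is a nonnegative quadratic in `c`, so its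
discriminant is not positive. -/
lemma abs_covariance_le {Ω : Type*} [MeasurableSpace Ω] {μ : Measure Ω} [IsProbabilityMeasure μ]
    {X Y : Ω → ℝ} (hX : MemLp X 2 μ) (hY : MemLp Y 2 μ) :
    |cov[X, Y; μ]| ≤ √(Var[X; μ] * Var[Y; μ]) := by
  have h : ∀ c : ℝ, 0 ≤ Var[Y; μ] * (c * c) + 2 * cov[X, Y; μ] * c + Var[X; μ] := fun c => by
    have h1 := variance_nonneg (X + c • Y) μ
    rw [variance_add hX (hY.const_smul c), covariance_smul_right, variance_smul] at h1
    linarith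
  have h2 := discrim_le_zero h
  rw [discrim] at h2
  refine Real.abs_le_sqrt ?_
  linarith

namespace RecursiveFamily

variable [Fintype A] {Ω : Type*} [MeasurableSpace Ω] {q : A → ℝ≥0} {P : ℝ≥0 → Measure Ω}
  {Z Y : Ω → ℝ} {W : A → Ω → ℝ} {r : ℝ}

lemma sum_variance_child (h : RecursiveFamily q P Z Y W r) (t : ℝ≥0) :
    Var[fun ω => ∑ x, W x ω; P t] = ∑ x, Var[Z; P (q x * t)] := by
  have := h.isProbabilityMeasure t
  have h1 := IndepFun.variance_sum (μ := P t) (X := W) (s := Finset.univ)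
    (fun x _ => (h.memLp_child t x).mono_exponent h.ofReal_two_le)
    (fun x _ y _ hxy => (h.indep t).indepFun hxy)
  simp_rw [h.variance_child] at h1
  rw [← h1]
  congr 1
  ext ω
  simp

lemma abs_variance_sub_sum_le (h : RecursiveFamily q P Z Y W r) (t : ℝ≥0) :
    |Var[Z; P t] - ∑ x, Var[Z; P (q x * t)]| ≤
      2 * √((∑ x, Var[Z; P (q x * t)]) * Var[Y; P t]) + Var[Y; P t] := by
  have := h.isProbabilityMeasure t
  have hS : MemLp (fun ω => ∑ x, W x ω) 2 (P t) :=
    memLp_finsetSum _ fun x _ => (h.memLp_child t x).mono_exponent h.ofReal_two_le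
  have hY : MemLp Y 2 (P t) := (h.memLp_toll t).mono_exponent h.ofReal_two_le
  have hZ : Z = fun ω => ∑ x, W x ω + Y ω := by
    funext ω
    rw [h.decomp, add_comm]
  have h1 : Var[Z; P t] = ∑ x, Var[Z; P (q x * t)] + 2 * cov[fun ω => ∑ x, W x ω, Y; P t] +
      Var[Y; P t] := by
    rw [← h.sum_variance_child t]
    nth_rewrite 1 [hZ]
    exact variance_fun_add hS hY
  have h2 := abs_covariance_le hS hY
  rw [h.sum_variance_child] at h2
  have h3 := variance_nonneg Y (P t)
  rw [abs_le] at h2 ⊢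
  constructor <;> linarith

/-- The normalized variances satisfy the recursion asymptotically. -/
lemma tendsto_variance_sub (h : RecursiveFamily q P Z Y W r) :
    Tendsto (fun t : ℝ≥0 => Var[Z; P t] / t - ∑ x, q x * (Var[Z; P (q x * t)] / (q x * t : ℝ≥0)))
      atTop (𝓝 0) := by
  obtain ⟨V, hV⟩ := h.variance_le
  have hchild : ∀ᶠ t : ℝ≥0 in atTop, ∀ x, Var[Z; P (q x * t)] ≤ V * (q x * t : ℝ≥0) :=
    eventually_all.mpr fun x => (h.tendsto_mul_atTop x).eventually hV
  have hlim : Tendsto (fun t : ℝ≥0 => 2 * √(V * (Var[Y; P t] / t)) + Var[Y; P t] / t) atTop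
      (𝓝 0) := by
    have h1 : Tendsto (fun t : ℝ≥0 => √(V * (Var[Y; P t] / t))) atTop (𝓝 (√(V * 0))) :=
      (h.toll_variance.const_mul V).sqrt
    simpa using (h1.const_mul 2).add h.toll_variance
  refine squeeze_zero_norm' ?_ hlim
  filter_upwards [hchild, eventually_gt_atTop 0] with t ht ht0
  have ht0' : (0 : ℝ) < t := ht0
  have hsum : ∑ x, (q x : ℝ) * (Var[Z; P (q x * t)] / (q x * t : ℝ≥0)) =
      (∑ x, Var[Z; P (q x * t)]) / t := by
    rw [Finset.sum_div]
    refine Finset.sum_congr rfl fun x _ => ?_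
    have hx : (0 : ℝ) < q x := h.pos x
    push_cast
    field_simp
  have hle : ∑ x, Var[Z; P (q x * t)] ≤ V * t := by
    calc _ ≤ ∑ x, V * (q x * t : ℝ≥0) := Finset.sum_le_sum fun x _ => ht x
      _ = V * t := by
        have h1 : ∑ x, (q x : ℝ) = 1 := by exact_mod_cast h.sum_eq_one
        push_cast
        rw [← Finset.mul_sum, ← Finset.sum_mul, h1, one_mul]
  have hY := variance_nonneg Y (P t)
  rw [hsum, ← sub_div, Real.norm_eq_abs, abs_div, abs_of_pos ht0', div_le_iff₀ ht0']
  refine (h.abs_variance_sub_sum_le t).trans ?_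
  -- The variance of the children is at most `V * t`, so the covariance term is `o(t)` as soon as
  -- `Var Y` is.
  have h2 : √((∑ x, Var[Z; P (q x * t)]) * Var[Y; P t]) ≤ √(V * (Var[Y; P t] / t)) * t := by
    rw [Real.sqrt_le_left (by positivity), mul_pow, Real.sq_sqrt]
    · calc _ ≤ V * t * Var[Y; P t] := by gcongr
        _ = _ := by field_simp
    · have : 0 ≤ V * t := (Finset.sum_nonneg fun x _ => variance_nonneg _ _).trans hle
      have hV0 : 0 ≤ V := nonneg_of_mul_nonneg_left this ht0'
      positivity
  calc _ ≤ 2 * (√(V * (Var[Y; P t] / t)) * t) + Var[Y; P t] := by gcongr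
    _ = _ := by field_simp

/-- The random variable `Z`, centred by its mean under `P t` and divided by `√t`. -/
def normalized (P : ℝ≥0 → Measure Ω) (Z : Ω → ℝ) (t : ℝ≥0) (ω : Ω) : ℝ :=
  (Z ω - ∫ ω', Z ω' ∂(P t)) / √t

lemma measurable_normalized (h : RecursiveFamily q P Z Y W r) (t : ℝ≥0) :
    Measurable (normalized P Z t) :=
  (h.measurable.sub_const _).div_const _

lemma memLp_normalized (h : RecursiveFamily q P Z Y W r) (t : ℝ≥0) :
    MemLp (normalized P Z t) (ENNReal.ofReal r) (P t) := by
  have := h.isProbabilityMeasure t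
  have h1 := ((h.memLp t).sub (memLp_const (∫ ω', Z ω' ∂(P t)))).const_mul (√t)⁻¹
  refine h1.congr_norm (h.measurable_normalized t).aestronglyMeasurable
    (Eventually.of_forall fun ω => ?_)
  simp [normalized, div_eq_inv_mul]

lemma integral_normalized (h : RecursiveFamily q P Z Y W r) (t : ℝ≥0) :
    ∫ ω, normalized P Z t ω ∂(P t) = 0 := by
  have := h.isProbabilityMeasure t
  simp only [normalized]
  rw [integral_div, integral_sub ((h.memLp t).integrable h.ofReal_one_le) (integrable_const _)]
  simp

lemma integral_normalized_sq (h : RecursiveFamily q P Z Y W r) (t : ℝ≥0) :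
    ∫ ω, normalized P Z t ω ^ 2 ∂(P t) = Var[Z; P t] / t := by
  simp only [normalized, div_pow]
  rw [integral_div, variance_eq_integral h.measurable.aemeasurable, Real.sq_sqrt t.coe_nonneg]

lemma exists_integral_normalized_rpow_le (h : RecursiveFamily q P Z Y W r) :
    ∃ K, 0 ≤ K ∧ ∀ᶠ t : ℝ≥0 in atTop, ∫ ω, |normalized P Z t ω| ^ r ∂(P t) ≤ K := by
  obtain ⟨K, hK⟩ := h.exists_integral_rpow_le
  refine ⟨|K|, abs_nonneg K, ?_⟩
  filter_upwards [hK, eventually_gt_atTop 0] with t ht ht0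
  have ht0' : (0 : ℝ) < t := ht0
  have h1 : ∀ ω, |normalized P Z t ω| ^ r =
      |Z ω - ∫ ω', Z ω' ∂(P t)| ^ r / (t : ℝ) ^ (r / 2) := fun ω => by
    rw [normalized, abs_div, Real.div_rpow (abs_nonneg _) (abs_nonneg _),
      abs_of_nonneg (Real.sqrt_nonneg _), Real.sqrt_eq_rpow, ← Real.rpow_mul ht0'.le]
    congr 2
    ring
  simp_rw [h1]
  rw [integral_div, div_le_iff₀ (by positivity)]
  refine ht.trans ?_
  gcongr
  exact le_abs_self K

/-- A child is normalised by `√t` here, but by `√(q x * t)` in its own model; the ratio `√(q x)`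
moves into the argument. -/
lemma charFun_child (h : RecursiveFamily q P Z Y W r) (t : ℝ≥0) (x : A) (u : ℝ) :
    charFun ((P t).map fun ω => (W x ω - ∫ ω', W x ω' ∂(P t)) / √t) u =
      charFun ((P (q x * t)).map (normalized P Z (q x * t))) (√(q x) * u) := by
  have hm := (((h.measurable_child x).sub_const (∫ ω', W x ω' ∂(P t))).div_const √t)
  rw [charFun_map_real hm.aemeasurable, charFun_map_real (h.measurable_normalized _).aemeasurable,
    h.integral_child_self]
  have h1 := h.integral_child t x (f := fun z => Complex.exp
    ((u * ((z - ∫ ω', Z ω' ∂(P (q x * t))) / √t) : ℝ) * Complex.I))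
    (Measurable.stronglyMeasurable (by fun_prop))
  rw [h1]
  refine integral_congr_ae (Eventually.of_forall fun ω => ?_)
  have hx : √(q x : ℝ) ≠ 0 := (Real.sqrt_pos.mpr (h.pos x)).ne'
  simp only [normalized, NNReal.coe_mul, Real.sqrt_mul (q x).coe_nonneg]
  congr 3
  field_simp

/-- Removing the toll costs its mean absolute deviation divided by `√t`; what remains factorises by
independence. -/
lemma norm_charFun_sub_prod_le (h : RecursiveFamily q P Z Y W r) (t : ℝ≥0) (u : ℝ) :
    ‖charFun ((P t).map (normalized P Z t)) u -
      ∏ x, charFun ((P (q x * t)).map (normalized P Z (q x * t))) (√(q x) * u)‖ ≤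
      |u| * √(Var[Y; P t] / t) := by
  have := h.isProbabilityMeasure t
  have hm : ∀ x, Measurable fun ω => (W x ω - ∫ ω', W x ω' ∂(P t)) / √t := fun x =>
    ((h.measurable_child x).sub_const _).div_const _
  have hind : iIndepFun (fun x ω => (W x ω - ∫ ω', W x ω' ∂(P t)) / √t) (P t) :=
    (h.indep t).comp (fun x z => (z - ∫ ω', W x ω' ∂(P t)) / √t) fun x => by fun_prop
  have hprod := congrFun (hind.charFun_map_fun_sum_eq_prod fun x => (hm x).aemeasurable) u
  rw [Finset.prod_apply] at hprod
  simp_rw [h.charFun_child] at hprod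
  have hdiff : ∀ ω, normalized P Z t ω - ∑ x, (W x ω - ∫ ω', W x ω' ∂(P t)) / √t =
      (Y ω - ∫ ω', Y ω' ∂(P t)) / √t := fun ω => by
    rw [normalized, h.sub_integral_eq, ← Finset.sum_div]
    ring
  have hY : MemLp Y 2 (P t) := (h.memLp_toll t).mono_exponent h.ofReal_two_le
  rw [← hprod]
  refine (norm_charFun_map_sub_le (h.measurable_normalized t).aemeasurable
    (Finset.measurable_fun_sum _ fun x _ => hm x).aemeasurable ?_ u).trans ?_
  · simp_rw [hdiff]
    exact ((hY.integrable one_le_two).sub (integrable_const _)).div_const _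
  · simp_rw [hdiff, abs_div]
    rw [integral_div, abs_of_nonneg (Real.sqrt_nonneg _), Real.sqrt_div (variance_nonneg _ _)]
    gcongr
    exact integral_abs_sub_integral_le hY

lemma exists_norm_charFun_sub_le (h : RecursiveFamily q P Z Y W r) {s : ℝ} (hs : 2 < s)
    (hs3 : s ≤ 3) (hsr : s ≤ r) :
    ∃ C, 0 ≤ C ∧ ∀ᶠ t : ℝ≥0 in atTop, ∀ u : ℝ,
      ‖charFun ((P t).map (normalized P Z t)) u - Real.exp (-(u ^ 2 * (Var[Z; P t] / t) / 2))‖ ≤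
        C * |u| ^ s := by
  obtain ⟨K, hK0, hK⟩ := h.exists_integral_normalized_rpow_le
  refine ⟨5 * K ^ (s / r), by positivity, ?_⟩
  filter_upwards [hK] with t ht u
  have := h.isProbabilityMeasure t
  have h1 := norm_charFun_map_sub_gaussian_le hs hs3
    ((h.memLp_normalized t).mono_exponent (ENNReal.ofReal_le_ofReal hsr)) (h.integral_normalized t) u
  rw [h.integral_normalized_sq] at h1
  have h2 : ∫ ω, |normalized P Z t ω| ^ s ∂(P t) ≤ K ^ (s / r) := by
    refine (integral_abs_rpow_le (h.memLp_normalized t) (by linarith) hsr).trans ?_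
    have : 0 ≤ ∫ ω, |normalized P Z t ω| ^ r ∂(P t) := integral_nonneg fun ω => by positivity
    have hr := h.two_lt
    gcongr
  calc _ ≤ _ := h1
    _ ≤ 5 * |u| ^ s * K ^ (s / r) := by gcongr
    _ = _ := by ring

/-- The three terms are the removal of the toll, the errors inherited from the children, and the
defect in the recursion for the normalised variance. -/
lemma norm_charFun_sub_gaussian_step (h : RecursiveFamily q P Z Y W r) (t : ℝ≥0) (u : ℝ) :
    ‖charFun ((P t).map (normalized P Z t)) u - Real.exp (-(u ^ 2 * (Var[Z; P t] / t) / 2))‖ ≤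
      |u| * √(Var[Y; P t] / t) +
      ∑ x, ‖charFun ((P (q x * t)).map (normalized P Z (q x * t))) (√(q x) * u) -
        Real.exp (-((√(q x) * u) ^ 2 * (Var[Z; P (q x * t)] / (q x * t : ℝ≥0)) / 2))‖ +
      u ^ 2 / 2 * |Var[Z; P t] / t - ∑ x, q x * (Var[Z; P (q x * t)] / (q x * t : ℝ≥0))| := by
  have hprob := h.isProbabilityMeasure
  set g : A → ℝ := fun x => (√(q x) * u) ^ 2 * (Var[Z; P (q x * t)] / (q x * t : ℝ≥0)) / 2 with hg
  have hg0 : ∀ x, 0 ≤ g x := fun x => by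
    have := variance_nonneg Z (P (q x * t))
    positivity
  have hprod : ∏ x, ((Real.exp (-g x) : ℝ) : ℂ) = (Real.exp (-∑ x, g x) : ℝ) := by
    rw [← Complex.ofReal_prod, ← Real.exp_sum, Finset.sum_neg_distrib]
  have hgsum : ∑ x, g x =
      u ^ 2 * (∑ x, q x * (Var[Z; P (q x * t)] / (q x * t : ℝ≥0))) / 2 := by
    rw [Finset.mul_sum, Finset.sum_div]
    refine Finset.sum_congr rfl fun x _ => ?_
    simp only [hg, mul_pow, Real.sq_sqrt (q x).coe_nonneg]
    ring
  have h2 : ‖∏ x, charFun ((P (q x * t)).map (normalized P Z (q x * t))) (√(q x) * u) -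
      ∏ x, ((Real.exp (-g x) : ℝ) : ℂ)‖ ≤ ∑ x, ‖charFun ((P (q x * t)).map
        (normalized P Z (q x * t))) (√(q x) * u) - ((Real.exp (-g x) : ℝ) : ℂ)‖ := by
    refine norm_prod_sub_prod_le _ (fun x => ?_) fun x => ?_
    · have := Measure.isProbabilityMeasure_map (μ := P (q x * t))
        (h.measurable_normalized (q x * t)).aemeasurable
      exact norm_charFun_le_one _
    · rw [Complex.norm_real, Real.norm_eq_abs, Real.abs_exp]
      exact Real.exp_le_one_iff.mpr (neg_nonpos.mpr (hg0 x))
  have h3 : ‖((Real.exp (-∑ x, g x) : ℝ) : ℂ) - Real.exp (-(u ^ 2 * (Var[Z; P t] / t) / 2))‖ ≤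
      u ^ 2 / 2 * |Var[Z; P t] / t - ∑ x, q x * (Var[Z; P (q x * t)] / (q x * t : ℝ≥0))| := by
    rw [← Complex.ofReal_sub, Complex.norm_real, Real.norm_eq_abs]
    have := variance_nonneg Z (P t)
    refine (abs_exp_neg_sub_exp_neg_le (Finset.sum_nonneg fun x _ => hg0 x)
      (by positivity)).trans (le_of_eq ?_)
    rw [hgsum, abs_sub_comm, ← abs_of_nonneg (by positivity : 0 ≤ u ^ 2 / 2), ← abs_mul]
    congr 1
    ring
  rw [hprod] at h2
  calc _ ≤ _ := norm_sub_le_norm_sub_add_norm_sub _ ((Real.exp (-∑ x, g x) : ℝ) : ℂ) _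
    _ ≤ _ := add_le_add ((norm_sub_le_norm_sub_add_norm_sub _ _ _).trans
      (add_le_add (h.norm_charFun_sub_prod_le t u) h2)) h3

/-- The characteristic function of the normalized variable is asymptotically that of a normal
distribution with the same variance. -/
theorem tendsto_charFun_sub (h : RecursiveFamily q P Z Y W r) (u : ℝ) :
    Tendsto (fun t : ℝ≥0 => charFun ((P t).map (normalized P Z t)) u -
      Real.exp (-(u ^ 2 * (Var[Z; P t] / t) / 2))) atTop (𝓝 0) := by
  have hr := h.two_lt
  have hA := h.nonempty
  -- The exponent must exceed `2` for contraction, and be at most `r` and `3` for the Taylor bound.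
  set s := min r 3 with hs
  have hs2 : 2 < s := lt_min hr (by norm_num)
  obtain ⟨C, hC0, hC⟩ := h.exists_norm_charFun_sub_le hs2 (min_le_right _ _) (min_le_left _ _)
  set ρ := ∑ x, (q x : ℝ) ^ (s / 2) with hρ
  have hρ1 : ρ < 1 := h.sum_rpow_lt_one (by linarith)
  have hρ0 : 0 ≤ ρ := Finset.sum_nonneg fun x _ => by positivity
  -- Each level of the recursion gains a factor `ρ`, because `|√(q x) * u| ^ s = q x ^ (s / 2) * |u|
  -- ^ s`. The argument `u` changes between levels, so it is quantified inside the induction, and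
  -- the additive errors are collected in `ε`.
  have key : ∀ n : ℕ, ∀ u : ℝ, ∀ ε > 0, ∀ᶠ t : ℝ≥0 in atTop,
      ‖charFun ((P t).map (normalized P Z t)) u - Real.exp (-(u ^ 2 * (Var[Z; P t] / t) / 2))‖ ≤
        C * ρ ^ n * |u| ^ s + ε := by
    intro n
    induction n with
    | zero =>
      intro u ε hε
      filter_upwards [hC] with t ht
      have := ht u
      rw [pow_zero, mul_one]
      linarith
    | succ n ih =>
      intro u ε hε
      have hc : (0 : ℝ) < Fintype.card A := by exact_mod_cast Fintype.card_pos
      have h1 : ∀ᶠ t : ℝ≥0 in atTop, |u| * √(Var[Y; P t] / t) ≤ ε / 3 := by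
        have : Tendsto (fun t : ℝ≥0 => |u| * √(Var[Y; P t] / t)) atTop (𝓝 (|u| * √0)) :=
          h.toll_variance.sqrt.const_mul _
        rw [Real.sqrt_zero, mul_zero] at this
        exact this.eventually_le_const (by positivity)
      have h2 : ∀ᶠ t : ℝ≥0 in atTop, ∀ x,
          ‖charFun ((P (q x * t)).map (normalized P Z (q x * t))) (√(q x) * u) -
            Real.exp (-((√(q x) * u) ^ 2 * (Var[Z; P (q x * t)] / (q x * t : ℝ≥0)) / 2))‖ ≤
          C * ρ ^ n * |√(q x) * u| ^ s + ε / 3 / Fintype.card A :=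
        eventually_all.mpr fun x => (h.tendsto_mul_atTop x).eventually
          (ih (√(q x) * u) (ε / 3 / Fintype.card A) (by positivity))
      have h3 : ∀ᶠ t : ℝ≥0 in atTop, u ^ 2 / 2 *
          |Var[Z; P t] / t - ∑ x, q x * (Var[Z; P (q x * t)] / (q x * t : ℝ≥0))| ≤ ε / 3 := by
        have := h.tendsto_variance_sub.abs.const_mul (u ^ 2 / 2)
        rw [abs_zero, mul_zero] at this
        exact this.eventually_le_const (by positivity)
      filter_upwards [h1, h2, h3] with t ht1 ht2 ht3
      refine (h.norm_charFun_sub_gaussian_step t u).trans ?_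
      have hsum : ∑ x, (C * ρ ^ n * |√(q x) * u| ^ s + ε / 3 / Fintype.card A) =
          C * ρ ^ (n + 1) * |u| ^ s + ε / 3 := by
        rw [Finset.sum_add_distrib, ← Finset.mul_sum, Finset.sum_const, Finset.card_univ,
          nsmul_eq_mul, mul_div_cancel₀ _ hc.ne']
        have : ∀ x, |√(q x) * u| ^ s = (q x : ℝ) ^ (s / 2) * |u| ^ s := fun x => by
          rw [abs_mul, abs_of_nonneg (Real.sqrt_nonneg _),
            Real.mul_rpow (Real.sqrt_nonneg _) (abs_nonneg _), Real.sqrt_eq_rpow,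
            ← Real.rpow_mul (q x).coe_nonneg]
          congr 2
          ring
        simp_rw [this]
        rw [← Finset.sum_mul, ← hρ]
        ring
      have := Finset.sum_le_sum fun x (_ : x ∈ Finset.univ) => ht2 x
      rw [hsum] at this
      linarith
  rw [Metric.tendsto_nhds]
  intro ε hε
  have hlim : Tendsto (fun n : ℕ => C * ρ ^ n * |u| ^ s) atTop (𝓝 (C * 0 * |u| ^ s)) :=
    ((tendsto_pow_atTop_nhds_zero_of_lt_one hρ0 hρ1).const_mul C).mul_const _
  rw [mul_zero, zero_mul] at hlim
  obtain ⟨n, hn⟩ := (hlim.eventually_lt_const (half_pos hε)).exists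
  filter_upwards [key n u (ε / 2) (half_pos hε)] with t ht
  rw [dist_zero_right]
  linarith

end RecursiveFamily

/-! ### Gaussian approximation from characteristic functions -/

section Approximation

variable {ι Ω Ω' : Type*} [MeasurableSpace Ω] [MeasurableSpace Ω'] {l : Filter ι}
  {P : ι → Measure Ω} {X : ι → Ω → ℝ} {Q : ι → Measure Ω'} {Y : ι → Ω' → ℝ}

lemma charFun_gaussianReal_zero (v : ℝ≥0) (u : ℝ) :
    charFun (gaussianReal 0 v) u = Real.exp (-(u ^ 2 * v / 2)) := by
  rw [charFun_gaussianReal]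
  push_cast
  congr 1
  ring

/-- The variances `w i` need not converge. By compactness of `[0, B]` every sequence has a
subsequence along which they do, and there both laws tend to the same normal law by Lévy's theorem.
-/
lemma approxInDistribution_gaussianReal [l.IsCountablyGenerated]
    [hP : ∀ i, IsProbabilityMeasure (P i)] (hX : ∀ i, Measurable (X i)) {w : ι → ℝ≥0} {B : ℝ≥0}
    (hw : ∀ᶠ i in l, w i ≤ B)
    (hchar : ∀ u : ℝ, Tendsto (fun i => charFun ((P i).map (X i)) u -
      Real.exp (-(u ^ 2 * w i / 2))) l (𝓝 0)) :
    ApproxInDistribution l P X (fun i => gaussianReal 0 (w i)) fun _ y => y := by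
  intro f
  refine tendsto_of_subseq_tendsto fun ns hns => ?_
  have hfreq : ∃ᶠ n in atTop, w (ns n) ∈ Set.Icc 0 B :=
    ((hns.eventually hw).mono fun n hn => ⟨zero_le, hn⟩).frequently
  obtain ⟨w₀, -, ms, hms, hlim⟩ := (isCompact_Icc (a := (0 : ℝ≥0)) (b := B)).tendsto_subseq' hfreq
  refine ⟨ms, ?_⟩
  have hlim' : ∀ u : ℝ, Tendsto (fun n => ((Real.exp (-(u ^ 2 * w (ns (ms n)) / 2)) : ℝ) : ℂ)) atTop
      (𝓝 (charFun (gaussianReal 0 w₀) u)) := fun u => by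
    rw [charFun_gaussianReal_zero]
    have hcont : Continuous fun z : ℝ≥0 => ((Real.exp (-(u ^ 2 * z / 2)) : ℝ) : ℂ) := by fun_prop
    exact (hcont.tendsto w₀).comp hlim
  have hnm : Tendsto (fun n => ns (ms n)) atTop l := hns.comp hms.tendsto_atTop
  have hprob : ∀ i, IsProbabilityMeasure ((P i).map (X i)) := fun i =>
    Measure.isProbabilityMeasure_map (hX i).aemeasurable
  have h1 := ProbabilityMeasure.tendsto_of_tendsto_charFun
    (μ₀ := ⟨gaussianReal 0 w₀, inferInstance⟩)
    (μ := fun n => ⟨(P (ns (ms n))).map (X (ns (ms n))), hprob _⟩) fun u => by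
      have := ((hchar u).comp hnm).add (hlim' u)
      simpa using this
  have h2 := ProbabilityMeasure.tendsto_of_tendsto_charFun
    (μ₀ := ⟨gaussianReal 0 w₀, inferInstance⟩)
    (μ := fun n => ⟨gaussianReal 0 (w (ns (ms n))), inferInstance⟩) fun u => by
      have := hlim' u
      simpa [charFun_gaussianReal_zero] using this
  have h3 := (ProbabilityMeasure.tendsto_iff_forall_integral_tendsto.mp h1 f).sub
    (ProbabilityMeasure.tendsto_iff_forall_integral_tendsto.mp h2 f)
  rw [sub_self] at h3
  refine h3.congr fun n => ?_
  simp only [ProbabilityMeasure.coe_mk]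
  rw [integral_map (hX _).aemeasurable f.continuous.aestronglyMeasurable]

/-- Scaling by `c i` makes the argument `c i * u` vary with `i`, whereas `hchar` concerns a fixed
argument. Along a subsequence with `c i → c₀` the argument is frozen at `c₀ * u`; the bound on `E |X
i|` controls the replacement. -/
lemma tendsto_charFun_affine [l.IsCountablyGenerated] [hP : ∀ i, IsProbabilityMeasure (P i)]
    (hX : ∀ i, Measurable (X i)) (hint : ∀ i, Integrable (X i) (P i)) {B : ℝ}
    (hB : ∀ᶠ i in l, ∫ ω, |X i ω| ∂(P i) ≤ B) {v : ι → ℝ} (hv0 : ∀ i, 0 ≤ v i)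
    (hv : ∀ᶠ i in l, v i ≤ B)
    (hchar : ∀ u : ℝ, Tendsto (fun i => charFun ((P i).map (X i)) u -
      Real.exp (-(u ^ 2 * v i / 2))) l (𝓝 0))
    {c δ : ι → ℝ} (hc0 : ∀ᶠ i in l, 0 ≤ c i) (hc : ∀ᶠ i in l, c i ≤ B) (hδ : Tendsto δ l (𝓝 0))
    {w : ι → ℝ≥0} (hw : Tendsto (fun i => (w i : ℝ) - c i ^ 2 * v i) l (𝓝 0)) (u : ℝ) :
    Tendsto (fun i => charFun ((P i).map fun ω => c i * X i ω + δ i) u -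
      Real.exp (-(u ^ 2 * w i / 2))) l (𝓝 0) := by
  refine tendsto_of_subseq_tendsto fun ns hns => ?_
  have hfreq : ∃ᶠ n in atTop, c (ns n) ∈ Set.Icc 0 B :=
    (hns.eventually (hc0.and hc)).frequently
  obtain ⟨c₀, -, ms, hms, hlim⟩ := isCompact_Icc.tendsto_subseq' hfreq
  refine ⟨ms, ?_⟩
  set ks := fun n => ns (ms n) with hks
  have hnm : Tendsto ks atTop l := hns.comp hms.tendsto_atTop
  have hlim : Tendsto (fun n => c (ks n)) atTop (𝓝 c₀) := hlim
  have hsq : Tendsto (fun n => |c (ks n) - c₀|) atTop (𝓝 0) := by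
    simpa using (hlim.sub_const c₀).abs
  have hsq2 : Tendsto (fun n => |c₀ ^ 2 - c (ks n) ^ 2|) atTop (𝓝 0) := by
    have := ((hlim.pow 2).const_sub (c₀ ^ 2)).abs
    rwa [sub_self, abs_zero] at this
  have h1 : Tendsto (fun n => charFun ((P (ks n)).map fun ω => c (ks n) * X (ks n) ω + δ (ks n)) u -
      charFun ((P (ks n)).map (X (ks n))) (c₀ * u)) atTop (𝓝 0) := by
    have hb : Tendsto (fun n => |u| * (|c (ks n) - c₀| * B + |δ (ks n)|)) atTop (𝓝 0) := by
      simpa using ((hsq.mul_const B).add (hδ.comp hnm).abs).const_mul |u|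
    refine squeeze_zero_norm' ?_ hb
    filter_upwards [hnm.eventually hB] with n hn
    have e1 : charFun ((P (ks n)).map (X (ks n))) (c₀ * u) =
        charFun ((P (ks n)).map fun ω => c₀ * X (ks n) ω) u := by
      rw [← charFun_map_mul, Measure.map_map (by fun_prop) (hX _)]
      rfl
    have e2 : ∀ ω, c (ks n) * X (ks n) ω + δ (ks n) - c₀ * X (ks n) ω =
        (c (ks n) - c₀) * X (ks n) ω + δ (ks n) := fun ω => by ring
    have i1 : Integrable (fun ω => (c (ks n) - c₀) * X (ks n) ω + δ (ks n)) (P (ks n)) :=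
      ((hint _).const_mul _).add (integrable_const _)
    rw [e1]
    refine (norm_charFun_map_sub_le (((hX _).const_mul _).add_const _).aemeasurable
      ((hX _).const_mul _).aemeasurable (by simpa only [e2] using i1) u).trans ?_
    gcongr
    simp only [e2]
    calc ∫ ω, |(c (ks n) - c₀) * X (ks n) ω + δ (ks n)| ∂(P (ks n))
        ≤ ∫ ω, (|c (ks n) - c₀| * |X (ks n) ω| + |δ (ks n)|) ∂(P (ks n)) := by
          refine integral_mono i1.abs (((hint _).abs.const_mul _).add (integrable_const _))
            fun ω => ?_
          simp only
          rw [← abs_mul]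
          exact abs_add_le _ _
      _ = |c (ks n) - c₀| * ∫ ω, |X (ks n) ω| ∂(P (ks n)) + |δ (ks n)| := by
          rw [integral_add ((hint _).abs.const_mul _) (integrable_const _), integral_const_mul]
          simp
      _ ≤ _ := by gcongr
  have h2 := (hchar (c₀ * u)).comp hnm
  -- The same replacement on the normal side, where boundedness of `v` is used.
  have h3 : Tendsto (fun n => ((Real.exp (-((c₀ * u) ^ 2 * v (ks n) / 2)) : ℝ) : ℂ) -
      Real.exp (-(u ^ 2 * w (ks n) / 2))) atTop (𝓝 0) := by
    have hb : Tendsto (fun n => u ^ 2 / 2 * (|c₀ ^ 2 - c (ks n) ^ 2| * B +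
        |(w (ks n) : ℝ) - c (ks n) ^ 2 * v (ks n)|)) atTop (𝓝 0) := by
      simpa using ((hsq2.mul_const B).add (hw.comp hnm).abs).const_mul (u ^ 2 / 2)
    refine squeeze_zero_norm' ?_ hb
    filter_upwards [hnm.eventually hv] with n hn
    have hv' := hv0 (ks n)
    rw [← Complex.ofReal_sub, Complex.norm_real, Real.norm_eq_abs]
    refine (abs_exp_neg_sub_exp_neg_le (by positivity) (by positivity)).trans ?_
    calc _ = u ^ 2 / 2 * |(c₀ ^ 2 - c (ks n) ^ 2) * v (ks n) -
          (w (ks n) - c (ks n) ^ 2 * v (ks n))| := by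
          rw [← abs_of_nonneg (by positivity : 0 ≤ u ^ 2 / 2), ← abs_mul]
          congr 1
          ring
      _ ≤ _ := by
          gcongr
          refine (abs_sub _ _).trans ?_
          rw [abs_mul, abs_of_nonneg hv']
          gcongr
  have h4 := (h1.add h2).add h3
  simp only [add_zero] at h4
  refine h4.congr fun n => ?_
  simp only [Function.comp]
  ring

/-! ### Convergence of moments -/

/-- Clamping changes nothing when `|x| ≤ M`, and beyond that `|x| ^ s ≤ M ^ (s - r) * |x| ^ r`. This
is uniform integrability in quantitative form. -/
lemma abs_sub_clamp_le {g : ℝ → ℝ} {s r M : ℝ} (hs : 0 < s) (hsr : s < r) (hM : 0 < M)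
    (hg : ∀ x, |g x| ≤ |x| ^ s) (x : ℝ) :
    |g x - g (max (-M) (min M x))| ≤ 2 * M ^ (s - r) * |x| ^ r := by
  rcases le_or_gt |x| M with hx | hx
  · rw [abs_le] at hx
    rw [min_eq_right hx.2, max_eq_right hx.1, sub_self, abs_zero]
    positivity
  · have hclamp : |max (-M) (min M x)| ≤ M :=
      abs_le.mpr ⟨le_max_left _ _, max_le (by linarith) (min_le_left _ _)⟩
    have hx0 : 0 < |x| := hM.trans hx
    have h1 : |x| ^ s ≤ M ^ (s - r) * |x| ^ r := by
      calc |x| ^ s = |x| ^ (s - r) * |x| ^ r := by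
            rw [← Real.rpow_add hx0]
            congr 1
            ring
        _ ≤ _ := by
            gcongr ?_ * _
            exact Real.rpow_le_rpow_of_nonpos hM hx.le (by linarith)
    have h2 : |g (max (-M) (min M x))| ≤ |x| ^ s := by
      exact (hg _).trans (Real.rpow_le_rpow (abs_nonneg _) (hclamp.trans hx.le) hs.le)
    calc _ ≤ |g x| + |g (max (-M) (min M x))| := abs_sub _ _
      _ ≤ |x| ^ s + |x| ^ s := add_le_add (hg x) h2
      _ ≤ _ := by linarith

lemma integrable_of_abs_le_rpow {μ : Measure Ω} [IsProbabilityMeasure μ] {Z : Ω → ℝ} {g : ℝ → ℝ}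
    {s r : ℝ} (hs : 0 < s) (hsr : s < r) (hg : Continuous g) (hgs : ∀ x, |g x| ≤ |x| ^ s)
    (hZ : MemLp Z (ENNReal.ofReal r) μ) : Integrable (fun ω => g (Z ω)) μ :=
  (integrable_abs_rpow hZ hs.le hsr.le).mono'
    (hg.comp_aestronglyMeasurable hZ.aestronglyMeasurable) (Eventually.of_forall fun _ => hgs _)

lemma abs_integral_sub_clamp_le {μ : Measure Ω} [IsProbabilityMeasure μ] {Z : Ω → ℝ} {g : ℝ → ℝ}
    {s r M K : ℝ} (hs : 0 < s) (hsr : s < r) (hM : 0 < M) (hg : Continuous g)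
    (hgs : ∀ x, |g x| ≤ |x| ^ s) (hZ : MemLp Z (ENNReal.ofReal r) μ)
    (hK : ∫ ω, |Z ω| ^ r ∂μ ≤ K) :
    |∫ ω, g (Z ω) ∂μ - ∫ ω, g (max (-M) (min M (Z ω))) ∂μ| ≤ 2 * M ^ (s - r) * K := by
  have hr0 : 0 ≤ r := by linarith
  have hi := integrable_of_abs_le_rpow hs hsr hg hgs hZ
  have hclamp : ∀ x, |max (-M) (min M x)| ≤ M := fun x =>
    abs_le.mpr ⟨le_max_left _ _, max_le (by linarith) (min_le_left _ _)⟩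
  have hi' : Integrable (fun ω => g (max (-M) (min M (Z ω)))) μ := by
    refine Integrable.of_bound (C := M ^ s) ?_ (Eventually.of_forall fun ω => ?_)
    · have : Continuous fun x => g (max (-M) (min M x)) := by fun_prop
      exact this.comp_aestronglyMeasurable hZ.aestronglyMeasurable
    · exact (hgs _).trans (Real.rpow_le_rpow (abs_nonneg _) (hclamp _) hs.le)
  rw [← integral_sub hi hi', ← Real.norm_eq_abs]
  calc _ ≤ ∫ ω, 2 * M ^ (s - r) * |Z ω| ^ r ∂μ :=
        norm_integral_le_of_norm_le ((integrable_abs_rpow hZ hr0 le_rfl).const_mul _)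
          (Eventually.of_forall fun ω => abs_sub_clamp_le hs hsr hM hgs _)
    _ ≤ _ := by
        rw [integral_const_mul]
        gcongr

/-- Clamping the argument of `g` yields a bounded continuous test function, and the two tail errors
are small uniformly in the index. A general `g` serves both `|x| ^ s` and `x ^ k`. -/
lemma ApproxInDistribution.tendsto_integral_sub (h : ApproxInDistribution l P X Q Y)
    [hP : ∀ i, IsProbabilityMeasure (P i)] [hQ : ∀ i, IsProbabilityMeasure (Q i)] {r K s : ℝ}
    (hX : ∀ᶠ i in l, MemLp (X i) (ENNReal.ofReal r) (P i) ∧ ∫ ω, |X i ω| ^ r ∂(P i) ≤ K)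
    (hY : ∀ᶠ i in l, MemLp (Y i) (ENNReal.ofReal r) (Q i) ∧ ∫ ω, |Y i ω| ^ r ∂(Q i) ≤ K)
    (hs : 0 < s) (hsr : s < r) {g : ℝ → ℝ} (hg : Continuous g) (hgs : ∀ x, |g x| ≤ |x| ^ s) :
    Tendsto (fun i => ∫ ω, g (X i ω) ∂(P i) - ∫ ω, g (Y i ω) ∂(Q i)) l (𝓝 0) := by
  rw [Metric.tendsto_nhds]
  intro ε hε
  have hM : ∃ M : ℝ, 2 * M ^ (s - r) * K < ε / 3 ∧ 0 < M := by
    have h1 : Tendsto (fun M : ℝ => 2 * M ^ (s - r) * K) atTop (𝓝 (2 * 0 * K)) := by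
      have := tendsto_rpow_neg_atTop (y := r - s) (by linarith)
      rw [neg_sub] at this
      exact (this.const_mul 2).mul_const K
    rw [mul_zero, zero_mul] at h1
    exact ((h1.eventually_lt_const (by linarith)).and (eventually_gt_atTop 0)).exists
  obtain ⟨M, hMε, hM0⟩ := hM
  have hcont : Continuous fun x => g (max (-M) (min M x)) := by fun_prop
  have hbound : ∀ x, ‖g (max (-M) (min M x))‖ ≤ M ^ s := fun x => by
    refine (hgs _).trans (Real.rpow_le_rpow (abs_nonneg _) ?_ hs.le)
    exact abs_le.mpr ⟨le_max_left _ _, max_le (by linarith) (min_le_left _ _)⟩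
  have hf := h (BoundedContinuousFunction.ofNormedAddCommGroup _ hcont _ hbound)
  simp only [BoundedContinuousFunction.coe_ofNormedAddCommGroup] at hf
  filter_upwards [hX, hY, (Metric.tendsto_nhds.mp hf) (ε / 3) (by linarith)] with i hXi hYi hi
  have h1 := abs_integral_sub_clamp_le hs hsr hM0 hg hgs hXi.1 hXi.2
  have h2 := abs_integral_sub_clamp_le hs hsr hM0 hg hgs hYi.1 hYi.2
  rw [Real.dist_eq, sub_zero] at hi ⊢
  rw [abs_le] at h1 h2
  rw [abs_lt] at hi ⊢
  constructor <;> linarith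

/-- Approximation in distribution together with bounded moments of order `r` gives approximation
of all moments of order less than `r`. -/
theorem ApproxInDistribution.approxMomentsBelow (h : ApproxInDistribution l P X Q Y)
    [hP : ∀ i, IsProbabilityMeasure (P i)] [hQ : ∀ i, IsProbabilityMeasure (Q i)] {r K : ℝ}
    (hX : ∀ᶠ i in l, MemLp (X i) (ENNReal.ofReal r) (P i) ∧ ∫ ω, |X i ω| ^ r ∂(P i) ≤ K)
    (hY : ∀ᶠ i in l, MemLp (Y i) (ENNReal.ofReal r) (Q i) ∧ ∫ ω, |Y i ω| ^ r ∂(Q i) ≤ K) :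
    ApproxMomentsBelow l P X Q Y r := by
  have key : ∀ s : ℝ, 0 < s → s < r → ∀ g : ℝ → ℝ, Continuous g → (∀ x, |g x| ≤ |x| ^ s) →
      (∀ᶠ i in l, Integrable (fun ω => g (X i ω)) (P i) ∧ Integrable (fun ω => g (Y i ω)) (Q i)) ∧
      Tendsto (fun i => ∫ ω, g (X i ω) ∂(P i) - ∫ ω, g (Y i ω) ∂(Q i)) l (𝓝 0) := by
    intro s hs hsr g hg hgs
    refine ⟨?_, h.tendsto_integral_sub hX hY hs hsr hg hgs⟩
    filter_upwards [hX, hY] with i hXi hYi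
    exact ⟨integrable_of_abs_le_rpow hs hsr hg hgs hXi.1,
      integrable_of_abs_le_rpow hs hsr hg hgs hYi.1⟩
  refine ⟨fun s hs hsr => key s hs hsr (fun x => |x| ^ s)
    (continuous_abs.rpow_const fun x => Or.inr hs.le) fun x => ?_,
    fun k hk hkr => key k (by exact_mod_cast hk) hkr (fun x => x ^ k) (continuous_pow k)
      fun x => ?_⟩
  · rw [abs_of_nonneg (by positivity)]
  · rw [abs_pow, Real.rpow_natCast]

lemma ApproxInDistribution.congr {X' : ι → Ω → ℝ} (h : ApproxInDistribution l P X Q Y)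
    (hX : ∀ᶠ i in l, X i = X' i) : ApproxInDistribution l P X' Q Y := fun f =>
  (h f).congr' (hX.mono fun i hi => by rw [hi])

lemma ApproxMomentsBelow.congr {X' : ι → Ω → ℝ} {r : ℝ} (h : ApproxMomentsBelow l P X Q Y r)
    (hX : ∀ᶠ i in l, X i = X' i) : ApproxMomentsBelow l P X' Q Y r := by
  refine ⟨fun s hs hsr => ⟨?_, ?_⟩, fun k hk hkr => ⟨?_, ?_⟩⟩
  · filter_upwards [(h.1 s hs hsr).1, hX] with i h1 h2
    rwa [← h2]
  · exact (h.1 s hs hsr).2.congr' (hX.mono fun i hi => by rw [hi])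
  · filter_upwards [(h.2 k hk hkr).1, hX] with i h1 h2
    rwa [← h2]
  · exact (h.2 k hk hkr).2.congr' (hX.mono fun i hi => by rw [hi])

lemma ApproxInDistribution.tendstoInDistribution [hP : ∀ i, IsProbabilityMeasure (P i)]
    {μ : Measure ℝ} [IsProbabilityMeasure μ] (hX : ∀ i, Measurable (X i))
    (h : ApproxInDistribution l P X (fun _ => μ) fun _ y => y) :
    TendstoInDistribution X l (fun y : ℝ => y) P μ where
  forall_aemeasurable i := (hX i).aemeasurable
  aemeasurable_limit := aemeasurable_id
  tendsto := by
    refine ProbabilityMeasure.tendsto_iff_forall_integral_tendsto.mpr fun f => ?_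
    have h1 := (h f).add_const (∫ y, f y ∂μ)
    simp only [sub_add_cancel, zero_add] at h1
    simp only [ProbabilityMeasure.coe_mk]
    rw [integral_map aemeasurable_id' f.continuous.aestronglyMeasurable]
    refine h1.congr fun i => ?_
    rw [integral_map (hX i).aemeasurable f.continuous.aestronglyMeasurable]

lemma integral_abs_rpow_gaussianReal (w : ℝ≥0) (r : ℝ) :
    ∫ y, |y| ^ r ∂(gaussianReal 0 w) = √w ^ r * ∫ y, |y| ^ r ∂(gaussianReal 0 1) := by
  have h1 : (gaussianReal 0 1).map (fun y => √w * y) = gaussianReal 0 w := by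
    rw [gaussianReal_map_const_mul]
    congr 1
    · simp
    · ext
      simp
  rw [← h1, integral_map (by fun_prop) (Measurable.aestronglyMeasurable (by fun_prop)),
    ← integral_const_mul]
  refine integral_congr_ae (Eventually.of_forall fun y => ?_)
  simp only
  rw [abs_mul, abs_of_nonneg (Real.sqrt_nonneg _),
    Real.mul_rpow (Real.sqrt_nonneg _) (abs_nonneg _)]

end Approximation

/-! ### Normal approximation of affine images -/

namespace RecursiveFamily

variable [Fintype A] {Ω : Type*} [MeasurableSpace Ω] {q : A → ℝ≥0} {P : ℝ≥0 → Measure Ω}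
  {Z Y : Ω → ℝ} {W : A → Ω → ℝ} {r : ℝ}

/-- Affine images of the normalized variable are approximately normal, with all moments of order
less than `r`. -/
theorem approx_gaussianReal (h : RecursiveFamily q P Z Y W r) {c δ : ℝ≥0 → ℝ} {w : ℝ≥0 → ℝ≥0}
    {B : ℝ} (hc0 : ∀ᶠ t in atTop, 0 ≤ c t) (hc : ∀ᶠ t in atTop, c t ≤ B)
    (hδ : Tendsto δ atTop (𝓝 0))
    (hw : Tendsto (fun t : ℝ≥0 => (w t : ℝ) - c t ^ 2 * (Var[Z; P t] / t)) atTop (𝓝 0))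
    {X : ℝ≥0 → Ω → ℝ} (hX : ∀ᶠ t in atTop, ∀ ω, X t ω = c t * normalized P Z t ω + δ t) :
    ApproxInDistribution atTop P X (fun t => gaussianReal 0 (w t)) (fun _ y => y) ∧
      ApproxMomentsBelow atTop P X (fun t => gaussianReal 0 (w t)) (fun _ y => y) r := by
  have hprob := h.isProbabilityMeasure
  have hr := h.two_lt
  have hr0 : 0 ≤ r := by linarith
  obtain ⟨V, hV⟩ := h.variance_le
  obtain ⟨K, hK0, hK⟩ := h.exists_integral_normalized_rpow_le
  set D := max (max B V) (max (K ^ (1 / r)) 1) with hD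
  have hBD : B ≤ D := (le_max_left _ _).trans (le_max_left _ _)
  have hVD : V ≤ D := (le_max_right _ _).trans (le_max_left _ _)
  have hKD : K ^ (1 / r) ≤ D := (le_max_left _ _).trans (le_max_right _ _)
  have hD1 : 1 ≤ D := (le_max_right _ _).trans (le_max_right _ _)
  have hcD : ∀ᶠ t in atTop, c t ≤ D := hc.mono fun t ht => ht.trans hBD
  have hv0 : ∀ t : ℝ≥0, 0 ≤ Var[Z; P t] / t := fun t => div_nonneg (variance_nonneg _ _) t.2
  have hv : ∀ᶠ t : ℝ≥0 in atTop, Var[Z; P t] / t ≤ D := by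
    filter_upwards [hV, eventually_gt_atTop 0] with t ht ht0
    rw [div_le_iff₀ (by exact_mod_cast ht0)]
    exact ht.trans (by gcongr)
  have hE : ∀ᶠ t in atTop, ∫ ω, |normalized P Z t ω| ∂(P t) ≤ D := by
    filter_upwards [hK] with t ht
    have h1 := integral_abs_rpow_le (h.memLp_normalized t) one_pos (by linarith)
    simp only [Real.rpow_one] at h1
    have : 0 ≤ ∫ ω, |normalized P Z t ω| ^ r ∂(P t) := integral_nonneg fun ω => by positivity
    exact (h1.trans (Real.rpow_le_rpow this ht (by positivity))).trans hKD
  -- Eventually `w t` is within `1` of the product of `c t ^ 2 ≤ D ^ 2` and a normalised variance of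
  -- at most `D`.
  have hwB : ∀ᶠ t in atTop, w t ≤ (D ^ 3 + 1).toNNReal := by
    filter_upwards [hw.eventually_le_const one_pos, hv, hcD, hc0] with t h1 h2 h3 h4
    rw [← NNReal.coe_le_coe, Real.coe_toNNReal _ (by positivity)]
    have h5 : c t ^ 2 * (Var[Z; P t] / t) ≤ D ^ 2 * D := by
      have := hv0 t
      gcongr
    calc (w t : ℝ) ≤ D ^ 2 * D + 1 := by linarith
      _ = _ := by ring
  have hm : ∀ t, Measurable fun ω => c t * normalized P Z t ω + δ t := fun t =>
    ((h.measurable_normalized t).const_mul _).add_const _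
  have happ : ApproxInDistribution atTop P (fun t ω => c t * normalized P Z t ω + δ t)
      (fun t => gaussianReal 0 (w t)) (fun _ y => y) :=
    approxInDistribution_gaussianReal hm hwB fun u => tendsto_charFun_affine
      h.measurable_normalized (fun t => (h.memLp_normalized t).integrable h.ofReal_one_le) hE hv0 hv
      h.tendsto_charFun_sub hc0 hcD hδ hw u
  have hL : ∀ t, MemLp (fun ω => c t * normalized P Z t ω + δ t) (ENNReal.ofReal r) (P t) :=
    fun t => ((h.memLp_normalized t).const_mul _).add (memLp_const _)
  set G := ∫ y, |y| ^ r ∂(gaussianReal 0 1) with hG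
  set M₁ := (1 - 1 / 2 : ℝ) ^ (1 - r) * (D ^ r * K) + (1 / 2 : ℝ) ^ (1 - r) * 1 with hM₁
  set M₂ := √((D ^ 3 + 1).toNNReal) ^ r * G with hM₂
  have hmomX : ∀ᶠ t in atTop, MemLp (fun ω => c t * normalized P Z t ω + δ t)
      (ENNReal.ofReal r) (P t) ∧
      ∫ ω, |c t * normalized P Z t ω + δ t| ^ r ∂(P t) ≤ max M₁ M₂ := by
    have hδ1 : ∀ᶠ t in atTop, |δ t| ≤ 1 := by
      have := hδ.abs
      rw [abs_zero] at this
      exact this.eventually_le_const one_pos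
    filter_upwards [hK, hc0, hcD, hδ1] with t h1 h2 h3 h4
    refine ⟨hL t, le_trans ?_ (le_max_left _ _)⟩
    have hi := integrable_abs_rpow (h.memLp_normalized t) hr0 le_rfl
    have hδr : |δ t| ^ r ≤ 1 := Real.rpow_le_one (abs_nonneg _) h4 hr0
    have hcr : c t ^ r ≤ D ^ r := Real.rpow_le_rpow h2 h3 hr0
    calc ∫ ω, |c t * normalized P Z t ω + δ t| ^ r ∂(P t)
        ≤ ∫ ω, ((1 - 1 / 2 : ℝ) ^ (1 - r) * (c t ^ r * |normalized P Z t ω| ^ r) +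
            (1 / 2 : ℝ) ^ (1 - r) * |δ t| ^ r) ∂(P t) := by
          refine integral_mono (integrable_abs_rpow (hL t) hr0 le_rfl)
            (((hi.const_mul _).const_mul _).add (integrable_const _)) fun ω => ?_
          refine (abs_add_rpow_le (θ := 1 / 2) (by linarith) (by norm_num) (by norm_num) _ _).trans
            (le_of_eq ?_)
          rw [abs_mul, abs_of_nonneg h2, Real.mul_rpow h2 (abs_nonneg _)]
      _ = (1 - 1 / 2 : ℝ) ^ (1 - r) * (c t ^ r * ∫ ω, |normalized P Z t ω| ^ r ∂(P t)) +
            (1 / 2 : ℝ) ^ (1 - r) * |δ t| ^ r := by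
          rw [integral_add ((hi.const_mul _).const_mul _) (integrable_const _),
            integral_const_mul, integral_const_mul]
          simp
      _ ≤ M₁ := by
          have : 0 ≤ ∫ ω, |normalized P Z t ω| ^ r ∂(P t) := integral_nonneg fun ω => by positivity
          have h12 : (0 : ℝ) ≤ (1 - 1 / 2 : ℝ) ^ (1 - r) := Real.rpow_nonneg (by norm_num) _
          rw [hM₁]
          gcongr
  have hmomY : ∀ᶠ t in atTop, MemLp (fun y : ℝ => y) (ENNReal.ofReal r) (gaussianReal 0 (w t)) ∧
      ∫ y, |y| ^ r ∂(gaussianReal 0 (w t)) ≤ max M₁ M₂ := by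
    filter_upwards [hwB] with t ht
    refine ⟨memLp_id_gaussianReal' _ ENNReal.ofReal_ne_top, le_trans ?_ (le_max_right _ _)⟩
    have hG0 : 0 ≤ G := integral_nonneg fun y => by positivity
    rw [integral_abs_rpow_gaussianReal, hM₂]
    gcongr
  have hcongr : ∀ᶠ t in atTop, (fun ω => c t * normalized P Z t ω + δ t) = X t :=
    hX.mono fun t ht => funext fun ω => (ht ω).symm
  exact ⟨happ.congr hcongr, (happ.approxMomentsBelow hmomX hmomY).congr hcongr⟩

end RecursiveFamily

/-! ### The additive functional of the Poisson trie as a recursive family -/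

/-! ### Moments under bounded perturbations and centring -/

section Perturbation

variable {Ω : Type*} [MeasurableSpace Ω] {μ : Measure Ω} {X Y : Ω → ℝ} {r c : ℝ}

lemma memLp_ofReal_iff (hX : AEStronglyMeasurable X μ) (hr : 0 < r) :
    MemLp X (ENNReal.ofReal r) μ ↔ ∫⁻ ω, ‖X ω‖ₑ ^ r ∂μ < ⊤ := by
  rw [MemLp, and_iff_right hX, eLpNorm_lt_top_iff_lintegral_rpow_enorm_lt_top
    (by simpa using hr) ENNReal.ofReal_ne_top, ENNReal.toReal_ofReal hr.le]

lemma integral_abs_rpow_eq_toReal (hX : AEStronglyMeasurable X μ) (hr : 0 ≤ r) :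
    ∫ ω, |X ω| ^ r ∂μ = (∫⁻ ω, ‖X ω‖ₑ ^ r ∂μ).toReal := by
  rw [integral_eq_lintegral_of_nonneg_ae (Eventually.of_forall fun ω => by positivity)
    ((continuous_abs.rpow_const fun _ => Or.inr hr).comp_aestronglyMeasurable hX)]
  congr 1
  refine lintegral_congr fun ω => ?_
  rw [← ENNReal.ofReal_rpow_of_nonneg (abs_nonneg _) hr, ← Real.norm_eq_abs,
    ofReal_norm]

variable [IsProbabilityMeasure μ]

lemma memLp_of_abs_sub_le {p : ℝ≥0∞} (hX : MemLp X p μ) (hY : AEStronglyMeasurable Y μ)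
    (hc : ∀ ω, |X ω - Y ω| ≤ c) : MemLp Y p μ := by
  have h1 : MemLp (fun ω => X ω - Y ω) p μ :=
    MemLp.of_bound (hX.aestronglyMeasurable.sub hY) c (Eventually.of_forall hc)
  have h2 := hX.sub h1
  refine h2.congr_norm hY (Eventually.of_forall fun ω => ?_)
  simp

/-- Parallelogram identity for the variances of `X + D` and `X - D` with `D = X - Y`, whose variance
is at most `c ^ 2`. -/
lemma variance_le_of_abs_sub_le (hX : MemLp X 2 μ) (hY : AEStronglyMeasurable Y μ)
    (hc : ∀ ω, |X ω - Y ω| ≤ c) : Var[Y; μ] ≤ 2 * Var[X; μ] + 2 * c ^ 2 := by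
  have hD : MemLp (fun ω => X ω - Y ω) 2 μ :=
    MemLp.of_bound (hX.aestronglyMeasurable.sub hY) c (Eventually.of_forall hc)
  have h1 := variance_sub hX hD
  have h2 := variance_add hX hD
  have h3 := variance_nonneg (X + fun ω => X ω - Y ω) μ
  have h4 : Var[fun ω => X ω - Y ω; μ] ≤ c ^ 2 := by
    refine (variance_le_expectation_sq hD.aestronglyMeasurable).trans ?_
    calc ∫ ω, ((fun ω => X ω - Y ω) ^ 2) ω ∂μ ≤ ∫ _, c ^ 2 ∂μ := by
          refine integral_mono hD.integrable_sq (integrable_const _) fun ω => ?_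
          exact sq_le_sq' (abs_le.mp (hc ω)).1 (abs_le.mp (hc ω)).2
      _ = c ^ 2 := by simp
  have h5 : X - (fun ω => X ω - Y ω) = Y := by
    funext ω
    simp
  rw [h5] at h1
  linarith

/-- After centring, the two variables differ by at most `2 * c`; convexity with equal weights does
the rest. -/
lemma integral_abs_sub_rpow_le_of_abs_sub_le (hr : 1 ≤ r) (hX : MemLp X (ENNReal.ofReal r) μ)
    (hY : AEStronglyMeasurable Y μ) (hc : ∀ ω, |X ω - Y ω| ≤ c) :
    ∫ ω, |Y ω - ∫ ω', Y ω' ∂μ| ^ r ∂μ ≤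
      2 ^ (r - 1) * (∫ ω, |X ω - ∫ ω', X ω' ∂μ| ^ r ∂μ + (2 * c) ^ r) := by
  have hYm := memLp_of_abs_sub_le hX hY hc
  have hr1 : 1 ≤ ENNReal.ofReal r := by
    rw [← ENNReal.ofReal_one]
    exact ENNReal.ofReal_le_ofReal hr
  have hr0 : 0 ≤ r := by linarith
  have hXc : MemLp (fun ω => X ω - ∫ ω', X ω' ∂μ) (ENNReal.ofReal r) μ := hX.sub (memLp_const _)
  have hYc : MemLp (fun ω => Y ω - ∫ ω', Y ω' ∂μ) (ENNReal.ofReal r) μ := hYm.sub (memLp_const _)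
  have hmean : |∫ ω, X ω ∂μ - ∫ ω, Y ω ∂μ| ≤ c := by
    rw [← integral_sub (hX.integrable hr1) (hYm.integrable hr1), ← Real.norm_eq_abs]
    have h1 : ‖∫ ω, (X ω - Y ω) ∂μ‖ ≤ ∫ _, c ∂μ :=
      norm_integral_le_of_norm_le (integrable_const _) (Eventually.of_forall hc)
    simpa using h1
  have hpt : ∀ ω, |Y ω - ∫ ω', Y ω' ∂μ| ^ r ≤
      2 ^ (r - 1) * |X ω - ∫ ω', X ω' ∂μ| ^ r + 2 ^ (r - 1) * (2 * c) ^ r := fun ω => by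
    have h1 := abs_add_rpow_le (θ := 1 / 2) hr (by norm_num) (by norm_num)
      (X ω - ∫ ω', X ω' ∂μ) ((∫ ω', X ω' ∂μ - ∫ ω', Y ω' ∂μ) - (X ω - Y ω))
    have h2 : (1 / 2 : ℝ) ^ (1 - r) = 2 ^ (r - 1) := by
      rw [one_div, Real.inv_rpow (by norm_num), ← Real.rpow_neg (by norm_num)]
      congr 1
      ring
    have h3 : (1 - 1 / 2 : ℝ) = 1 / 2 := by norm_num
    rw [h3, h2] at h1
    have h4 : |(∫ ω', X ω' ∂μ - ∫ ω', Y ω' ∂μ) - (X ω - Y ω)| ≤ 2 * c :=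
      (abs_sub _ _).trans (by linarith [hc ω])
    have h5 : X ω - ∫ ω', X ω' ∂μ + ((∫ ω', X ω' ∂μ - ∫ ω', Y ω' ∂μ) - (X ω - Y ω)) =
        Y ω - ∫ ω', Y ω' ∂μ := by ring
    rw [h5] at h1
    refine h1.trans ?_
    gcongr
  calc _ ≤ ∫ ω, (2 ^ (r - 1) * |X ω - ∫ ω', X ω' ∂μ| ^ r + 2 ^ (r - 1) * (2 * c) ^ r) ∂μ :=
        integral_mono (integrable_abs_rpow hYc hr0 le_rfl)
          (((integrable_abs_rpow hXc hr0 le_rfl).const_mul _).add (integrable_const _)) hpt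
    _ = _ := by
        rw [integral_add ((integrable_abs_rpow hXc hr0 le_rfl).const_mul _) (integrable_const _),
          integral_const_mul]
        simp
        ring

lemma integral_abs_sub_rpow_le (hr : 1 ≤ r) (hX : MemLp X (ENNReal.ofReal r) μ) :
    ∫ ω, |X ω - ∫ ω', X ω' ∂μ| ^ r ∂μ ≤ 2 ^ r * ∫ ω, |X ω| ^ r ∂μ := by
  have hr0 : 0 ≤ r := by linarith
  have hXc : MemLp (fun ω => X ω - ∫ ω', X ω' ∂μ) (ENNReal.ofReal r) μ := hX.sub (memLp_const _)
  have hi := integrable_abs_rpow hX hr0 le_rfl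
  have hmean : |∫ ω, X ω ∂μ| ^ r ≤ ∫ ω, |X ω| ^ r ∂μ := by
    have h1 := integral_abs_rpow_le hX one_pos hr
    simp only [Real.rpow_one] at h1
    have h0 : 0 ≤ ∫ ω, |X ω| ^ r ∂μ := integral_nonneg fun ω => by positivity
    calc |∫ ω, X ω ∂μ| ^ r ≤ ((∫ ω, |X ω| ^ r ∂μ) ^ (1 / r)) ^ r := by
          gcongr
          exact abs_integral_le_integral_abs.trans h1
      _ = _ := by
          rw [← Real.rpow_mul h0, one_div, inv_mul_cancel₀ (by linarith), Real.rpow_one]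
  have h2 : (1 / 2 : ℝ) ^ (1 - r) = 2 ^ (r - 1) := by
    rw [one_div, Real.inv_rpow (by norm_num), ← Real.rpow_neg (by norm_num)]
    congr 1
    ring
  calc _ ≤ ∫ ω, (2 ^ (r - 1) * |X ω| ^ r + 2 ^ (r - 1) * |∫ ω', X ω' ∂μ| ^ r) ∂μ := by
        refine integral_mono (integrable_abs_rpow hXc hr0 le_rfl)
          ((hi.const_mul _).add (integrable_const _)) fun ω => ?_
        have h1 := abs_add_rpow_le (θ := 1 / 2) hr (by norm_num) (by norm_num) (X ω)
          (-∫ ω', X ω' ∂μ)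
        have h3 : (1 - 1 / 2 : ℝ) = 1 / 2 := by norm_num
        rwa [h3, h2, abs_neg, ← sub_eq_add_neg] at h1
    _ = 2 ^ (r - 1) * (∫ ω, |X ω| ^ r ∂μ + |∫ ω', X ω' ∂μ| ^ r) := by
        rw [integral_add (hi.const_mul _) (integrable_const _), integral_const_mul]
        simp
        ring
    _ ≤ 2 ^ (r - 1) * (2 * ∫ ω, |X ω| ^ r ∂μ) := by
        gcongr
        linarith
    _ = _ := by
        rw [← mul_assoc, ← Real.rpow_add_one (by norm_num)]
        ring_nf

end Perturbation

/-! ### Verification of the hypotheses for Poisson tries -/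

section PoissonTrie

variable [Fintype A] [MeasurableSpace A] [DiscreteMeasurableSpace A]
  {p : PMF A} {φ : Trie A → ℝ} {r : ℝ}

lemma measurable_apply_poissonTrie (ψ : Trie A → ℝ) : Measurable fun ω => ψ (poissonTrie ω) :=
  Measurable.of_discrete.comp measurable_poissonTrie

/-- The model with a larger mean dominates the one with a smaller mean up to a constant, so
finiteness for large `t` descends to every `t`. -/
lemma memLp_poissonTrie_of_eventually (hr : 0 < r) {m : ℝ≥0 → ℝ}
    (h : ∀ᶠ t : ℝ≥0 in atTop,
      Integrable (fun ω => |φ (poissonTrie ω) - m t| ^ r) (poissonModel p t)) (t : ℝ≥0) :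
    MemLp (fun ω => φ (poissonTrie ω)) (ENNReal.ofReal r) (poissonModel p t) := by
  obtain ⟨t', ht', htt'⟩ := (h.and (eventually_ge_atTop t)).exists
  have hmeas := measurable_apply_poissonTrie φ
  have h1 : MemLp (fun ω => φ (poissonTrie ω) - m t') (ENNReal.ofReal r) (poissonModel p t') := by
    rw [← integrable_norm_rpow_iff (hmeas.sub_const _).aestronglyMeasurable
      (by simpa using hr) ENNReal.ofReal_ne_top, ENNReal.toReal_ofReal hr.le]
    exact ht'
  have h2 : MemLp (fun ω => φ (poissonTrie ω)) (ENNReal.ofReal r) (poissonModel p t') := by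
    refine (h1.add (memLp_const (m t'))).congr_norm hmeas.aestronglyMeasurable
      (Eventually.of_forall fun ω => ?_)
    simp
  rw [memLp_ofReal_iff hmeas.aestronglyMeasurable hr] at h2 ⊢
  refine (lintegral_poissonModel_mono p htt' (hmeas.enorm.pow_const r)).trans_lt ?_
  exact ENNReal.mul_lt_top ENNReal.ofReal_lt_top h2

lemma memLp_additiveFunctional [Nontrivial A] (hp : ∀ x, 0 < p x) (hφ : φ (emptyTrie A) = 0) (hr : 1 < r)
    (h : ∀ t, MemLp (fun ω => φ (poissonTrie ω)) (ENNReal.ofReal r) (poissonModel p t)) (t : ℝ≥0) :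
    MemLp (fun ω => additiveFunctional φ (poissonTrie ω)) (ENNReal.ofReal r)
      (poissonModel p t) := by
  have hr0 : 0 < r := by linarith
  rw [memLp_ofReal_iff (measurable_apply_poissonTrie _).aestronglyMeasurable hr0]
  exact lintegral_additiveFunctional_rpow_lt_top hp hφ hr (fun t =>
    (memLp_ofReal_iff (measurable_apply_poissonTrie _).aestronglyMeasurable hr0).mp (h t)) t

lemma exists_integral_abs_sub_rpow_le {ψ : Trie A → ℝ} (hr : 1 ≤ r)
    (h : ∀ t, MemLp (fun ω => ψ (poissonTrie ω)) (ENNReal.ofReal r) (poissonModel p t))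
    (t₀ : ℝ≥0) : ∃ C, ∀ t ≤ t₀, ∫ ω, |ψ (poissonTrie ω) -
      ∫ ω', ψ (poissonTrie ω') ∂(poissonModel p t)| ^ r ∂(poissonModel p t) ≤ C := by
  have hr0 : 0 < r := by linarith
  have hmeas := measurable_apply_poissonTrie ψ
  refine ⟨2 ^ r * (ENNReal.ofReal (Real.exp t₀) *
    ∫⁻ ω, ‖ψ (poissonTrie ω)‖ₑ ^ r ∂(poissonModel p t₀)).toReal, fun t ht => ?_⟩
  refine (integral_abs_sub_rpow_le hr (h t)).trans ?_
  rw [integral_abs_rpow_eq_toReal hmeas.aestronglyMeasurable hr0.le]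
  gcongr
  · exact ENNReal.mul_ne_top ENNReal.ofReal_ne_top
      ((memLp_ofReal_iff hmeas.aestronglyMeasurable hr0).mp (h t₀)).ne
  · exact lintegral_poissonModel_mono p ht (hmeas.enorm.pow_const r)

lemma iIndepFun_poissonSubtrie (p : PMF A) (t : ℝ≥0) :
    iIndepFun (fun x : A => poissonSubtrie x) (poissonModel p t) := by
  rw [iIndepFun_iff_map_fun_eq_pi_map fun x => (measurable_poissonSubtrie x).aemeasurable,
    map_poissonSubtrie]
  simp_rw [map_poissonSubtrie_apply]

theorem recursiveFamily_additiveFunctional [Nontrivial A] (hp : ∀ x, 0 < p x)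
    (hφ : φ (emptyTrie A) = 0) (hr : 2 < r)
    (hvarO : (fun t : ℝ≥0 => poissonVar p (additiveFunctional φ) t) =O[atTop]
      fun t : ℝ≥0 => (t : ℝ))
    (htoll : (fun t : ℝ≥0 => poissonVar p φ t) =o[atTop] fun t : ℝ≥0 => (t : ℝ))
    (hmomfin : ∀ᶠ t : ℝ≥0 in atTop,
      Integrable (fun ω => |φ (poissonTrie ω) - poissonMean p φ t| ^ r) (poissonModel p t))
    (hmom : (fun t : ℝ≥0 =>
        ∫ ω, |φ (poissonTrie ω) - poissonMean p φ t| ^ r ∂(poissonModel p t))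
      =O[atTop] fun t : ℝ≥0 => (t : ℝ) ^ (r / 2)) :
    RecursiveFamily (letterProb p) (poissonModel p)
      (fun ω => additiveFunctional φ (poissonTrie ω)) (fun ω => innerToll φ (poissonTrie ω))
      (fun x ω => additiveFunctional φ (poissonSubtrie x ω)) r := by
  have hφL := memLp_poissonTrie_of_eventually (p := p) (by linarith) hmomfin
  have hΦL := memLp_additiveFunctional hp hφ (by linarith) hφL
  have hbd : ∀ ω : ℕ × (ℕ → ℕ → A),
      |φ (poissonTrie ω) - innerToll φ (poissonTrie ω)| ≤ |leafToll φ| :=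
    fun ω => abs_sub_innerToll_le φ _
  have htop : Tendsto (fun t : ℝ≥0 => (t : ℝ)) atTop atTop := NNReal.tendsto_coe_atTop.mpr tendsto_id
  exact
  { two_lt := hr
    sum_eq_one := sum_letterProb p
    pos := letterProb_pos hp
    lt_one := letterProb_lt_one hp
    isProbabilityMeasure := fun t => inferInstance
    measurable := measurable_apply_poissonTrie _
    measurable_child := fun x =>
      (Measurable.of_discrete (f := additiveFunctional φ)).comp (measurable_poissonSubtrie x)
    decomp := fun ω => additiveFunctional_trieOf hφ (poissonStrings ω)
    indep := fun t => (iIndepFun_poissonSubtrie p t).comp (fun _ => additiveFunctional φ)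
      fun _ => Measurable.of_discrete
    map_child := fun t x => by
      have h1 := congrArg (fun μ => μ.map (additiveFunctional φ)) (map_poissonSubtrie_apply p t x)
      rwa [Measure.map_map Measurable.of_discrete (measurable_poissonSubtrie x),
        Measure.map_map Measurable.of_discrete measurable_poissonTrie] at h1
    memLp := hΦL
    bounded := exists_integral_abs_sub_rpow_le (by linarith) hΦL
    variance_le := by
      obtain ⟨V, hV⟩ := hvarO.bound
      refine ⟨V, hV.mono fun t ht => ?_⟩
      rw [Real.norm_of_nonneg t.coe_nonneg] at ht
      exact (le_abs_self _).trans ht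
    toll_variance := by
      have h1 := htoll.tendsto_div_nhds_zero
      have h2 : Tendsto (fun t : ℝ≥0 => 2 * |leafToll φ| ^ 2 / (t : ℝ)) atTop (𝓝 0) :=
        htop.const_div_atTop _
      have h3 := (h1.const_mul 2).add h2
      rw [mul_zero, add_zero] at h3
      refine squeeze_zero (fun t => div_nonneg (variance_nonneg _ _) t.coe_nonneg) (fun t => ?_) h3
      rw [← mul_div_assoc, ← add_div]
      gcongr
      refine variance_le_of_abs_sub_le ((hφL t).mono_exponent ?_)
        (measurable_apply_poissonTrie _).aestronglyMeasurable hbd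
      rw [← ENNReal.ofReal_ofNat]
      exact ENNReal.ofReal_le_ofReal hr.le
    toll_moment := by
      obtain ⟨C, hC⟩ := hmom.bound
      -- The second summand comes from replacing `φ` by `innerToll φ`; it is absorbed because `t ^
      -- (r / 2) ≥ 1` for `t ≥ 1`.
      refine ⟨2 ^ (r - 1) * (C + (2 * |leafToll φ|) ^ r), ?_⟩
      filter_upwards [hC, eventually_ge_atTop 1] with t ht ht1
      have h1 := integral_abs_sub_rpow_le_of_abs_sub_le (by linarith) (hφL t)
        (measurable_apply_poissonTrie (innerToll φ)).aestronglyMeasurable hbd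
      have h2 : (1 : ℝ) ≤ (t : ℝ) ^ (r / 2) :=
        Real.one_le_rpow (by exact_mod_cast ht1) (by linarith)
      rw [Real.norm_of_nonneg (integral_nonneg fun ω => by positivity),
        Real.norm_of_nonneg (by positivity)] at ht
      refine h1.trans ?_
      rw [mul_assoc, add_mul]
      gcongr
      · exact ht
      · exact le_mul_of_one_le_right (by positivity) h2 }

end PoissonTrie

/-! ### The two normalisations -/

namespace RecursiveFamily

variable [Fintype A] {Ω : Type*} [MeasurableSpace Ω] {q : A → ℝ≥0} {P : ℝ≥0 → Measure Ω}
  {Z Y : Ω → ℝ} {W : A → Ω → ℝ} {r : ℝ}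

/-- Normal approximation after division by `√t`. -/
theorem approx_div_sqrt (h : RecursiveFamily q P Z Y W r) {a b : ℝ≥0 → ℝ}
    (ha : Tendsto (fun t : ℝ≥0 => (∫ ω, Z ω ∂(P t) - a t) / √t) atTop (𝓝 0))
    (hb : Tendsto (fun t : ℝ≥0 => (Var[Z; P t] - b t) / t) atTop (𝓝 0)) :
    ApproxInDistribution atTop P (fun t ω => (Z ω - a t) / √t)
        (fun t => gaussianReal 0 (b t / t).toNNReal) (fun _ y => y) ∧
      ApproxMomentsBelow atTop P (fun t ω => (Z ω - a t) / √t)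
        (fun t => gaussianReal 0 (b t / t).toNNReal) (fun _ y => y) r := by
  refine h.approx_gaussianReal (c := fun _ => 1) (B := 1)
    (Eventually.of_forall fun _ => zero_le_one) (Eventually.of_forall fun _ => le_rfl) ha ?_
    (Eventually.of_forall fun t ω => ?_)
  -- Truncating `b t / t` at `0` is harmless: the positive part is 1-Lipschitz and fixes the
  -- nonnegative `Var Z / t`.
  · refine squeeze_zero_norm (fun t => ?_) (by simpa using hb.abs)
    have hv : 0 ≤ Var[Z; P t] / t := div_nonneg (variance_nonneg _ _) t.coe_nonneg
    rw [one_pow, one_mul, Real.norm_eq_abs, Real.coe_toNNReal', sub_div, abs_sub_comm _ (b t / t)]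
    calc |max (b t / t) 0 - Var[Z; P t] / t| = |max (b t / t) 0 - max (Var[Z; P t] / t) 0| := by
          rw [max_eq_left hv]
      _ ≤ _ := abs_max_sub_max_le_abs _ _ _
  · rw [normalized, one_mul, ← add_div]
    ring

/-- Normal approximation after division by the approximate standard deviation. -/
theorem approx_div_sqrt_variance (h : RecursiveFamily q P Z Y W r) {a b : ℝ≥0 → ℝ}
    (ha : Tendsto (fun t : ℝ≥0 => (∫ ω, Z ω ∂(P t) - a t) / √t) atTop (𝓝 0))
    (hb : Tendsto (fun t : ℝ≥0 => (Var[Z; P t] - b t) / t) atTop (𝓝 0)) {c : ℝ} (hc : 0 < c)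
    (hcb : ∀ᶠ t : ℝ≥0 in atTop, c * t ≤ b t) :
    ApproxInDistribution atTop P (fun t ω => (Z ω - a t) / √(b t))
        (fun _ => gaussianReal 0 1) (fun _ y => y) ∧
      ApproxMomentsBelow atTop P (fun t ω => (Z ω - a t) / √(b t))
        (fun _ => gaussianReal 0 1) (fun _ y => y) r := by
  have hpos : ∀ᶠ t : ℝ≥0 in atTop, (0 : ℝ) < t ∧ 0 < b t ∧ t / b t ≤ c⁻¹ := by
    filter_upwards [hcb, eventually_gt_atTop 0] with t ht ht0
    have ht0' : (0 : ℝ) < t := ht0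
    have hb0 : 0 < b t := lt_of_lt_of_le (by positivity) ht
    refine ⟨ht0', hb0, ?_⟩
    rw [div_le_iff₀ hb0, inv_mul_eq_div, le_div_iff₀ hc]
    linarith
  -- Passing from `√t` to `√(b t)` multiplies by `√(t / b t)`, which the linear lower bound on `b`
  -- keeps bounded.
  refine h.approx_gaussianReal (c := fun t => √(t / b t)) (B := √c⁻¹) (w := fun _ => 1)
    (δ := fun t => √(t / b t) * ((∫ ω, Z ω ∂(P t) - a t) / √t))
    (Eventually.of_forall fun _ => Real.sqrt_nonneg _)
    (hpos.mono fun t ht => Real.sqrt_le_sqrt ht.2.2) ?_ ?_ (hpos.mono fun t ht ω => ?_)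
  · refine squeeze_zero_norm' ?_ (by simpa only [abs_zero, mul_zero] using ha.abs.const_mul √c⁻¹)
    filter_upwards [hpos] with t ht
    rw [norm_mul, Real.norm_eq_abs, Real.norm_eq_abs, abs_of_nonneg (Real.sqrt_nonneg _)]
    gcongr
    exact ht.2.2
  · refine squeeze_zero_norm' ?_ (by simpa only [abs_zero, mul_zero] using hb.abs.const_mul c⁻¹)
    filter_upwards [hpos] with t ht
    obtain ⟨ht0, hb0, hle⟩ := ht
    have h1 : ((1 : ℝ≥0) : ℝ) - √(t / b t) ^ 2 * (Var[Z; P t] / t) =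
        -(t / b t * ((Var[Z; P t] - b t) / t)) := by
      rw [Real.sq_sqrt (by positivity)]
      push_cast
      field_simp
      ring
    rw [h1, norm_neg, norm_mul, Real.norm_eq_abs, Real.norm_eq_abs,
      abs_of_nonneg (div_nonneg ht0.le hb0.le)]
    gcongr
  · obtain ⟨ht0, hb0, -⟩ := ht
    have h1 := (Real.sqrt_pos.mpr ht0).ne'
    have h2 := (Real.sqrt_pos.mpr hb0).ne'
    rw [normalized, Real.sqrt_div ht0.le]
    field_simp
    ring

end RecursiveFamily

end Tries

end

/-! ### The limit theorem for Poisson tries -/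

theorem theoremT1 {A : Type*} [Fintype A] [Nontrivial A] [MeasurableSpace A]
    [DiscreteMeasurableSpace A]
    (p : PMF A) (hp : ∀ x, 0 < p x)
    (φ Φ : Tries.Trie A → ℝ) (hφ : φ (Tries.emptyTrie A) = 0)
    (hΦ : Φ = Tries.additiveFunctional φ)
    (a b : ℝ≥0 → ℝ) (r : ℝ) (hr : 2 < r)
    (hmean : (fun t : ℝ≥0 => Tries.poissonMean p Φ t - a t) =o[atTop] fun t : ℝ≥0 => √(t : ℝ))
    (hvar : (fun t : ℝ≥0 => Tries.poissonVar p Φ t - b t) =o[atTop] fun t : ℝ≥0 => (t : ℝ))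
    (hvarO : (fun t : ℝ≥0 => Tries.poissonVar p Φ t) =O[atTop] fun t : ℝ≥0 => (t : ℝ))
    (htoll : (fun t : ℝ≥0 => Tries.poissonVar p φ t) =o[atTop] fun t : ℝ≥0 => (t : ℝ))
    (hmomfin : ∀ᶠ t : ℝ≥0 in atTop,
      Integrable (fun ω => |φ (Tries.poissonTrie ω) - Tries.poissonMean p φ t| ^ r)
        (Tries.poissonModel p t))
    (hmom : (fun t : ℝ≥0 =>
        ∫ ω, |φ (Tries.poissonTrie ω) - Tries.poissonMean p φ t| ^ r ∂(Tries.poissonModel p t))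
      =O[atTop] fun t : ℝ≥0 => (t : ℝ) ^ (r / 2)) :
    -- part (i), normalized by `a` and `b`
    (Tries.ApproxInDistribution atTop
        (Tries.poissonModel p) (fun t ω => (Φ (Tries.poissonTrie ω) - a t) / √(t : ℝ))
        (fun t => gaussianReal 0 (b t / t).toNNReal) (fun _ y => y) ∧
      Tries.ApproxMomentsBelow atTop
        (Tries.poissonModel p) (fun t ω => (Φ (Tries.poissonTrie ω) - a t) / √(t : ℝ))
        (fun t => gaussianReal 0 (b t / t).toNNReal) (fun _ y => y) r) ∧
    -- part (i), normalized by the exact mean and variance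
    (Tries.ApproxInDistribution atTop
        (Tries.poissonModel p)
        (fun t ω => (Φ (Tries.poissonTrie ω) - Tries.poissonMean p Φ t) / √(t : ℝ))
        (fun t => gaussianReal 0 (Tries.poissonVar p Φ t / t).toNNReal) (fun _ y => y) ∧
      Tries.ApproxMomentsBelow atTop
        (Tries.poissonModel p)
        (fun t ω => (Φ (Tries.poissonTrie ω) - Tries.poissonMean p Φ t) / √(t : ℝ))
        (fun t => gaussianReal 0 (Tries.poissonVar p Φ t / t).toNNReal) (fun _ y => y) r) ∧
    -- part (ii)
    ((∃ c : ℝ, 0 < c ∧ ∀ᶠ t : ℝ≥0 in atTop, c * t ≤ b t) →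
      (TendstoInDistribution (fun t ω => (Φ (Tries.poissonTrie ω) - a t) / √(b t)) atTop
          (fun y : ℝ => y) (fun t => Tries.poissonModel p t) (gaussianReal 0 1) ∧
        Tries.ApproxMomentsBelow atTop
          (Tries.poissonModel p) (fun t ω => (Φ (Tries.poissonTrie ω) - a t) / √(b t))
          (fun _ => gaussianReal 0 1) (fun _ y => y) r) ∧
      (TendstoInDistribution
          (fun t ω => (Φ (Tries.poissonTrie ω) - Tries.poissonMean p Φ t) /
            √(Tries.poissonVar p Φ t)) atTop
          (fun y : ℝ => y) (fun t => Tries.poissonModel p t) (gaussianReal 0 1) ∧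
        Tries.ApproxMomentsBelow atTop
          (Tries.poissonModel p)
          (fun t ω => (Φ (Tries.poissonTrie ω) - Tries.poissonMean p Φ t) /
            √(Tries.poissonVar p Φ t))
          (fun _ => gaussianReal 0 1) (fun _ y => y) r)) := by
  subst hΦ
  have h := Tries.recursiveFamily_additiveFunctional hp hφ hr hvarO htoll hmomfin hmom
  have hmeas := Tries.measurable_apply_poissonTrie (Tries.additiveFunctional φ)
  have ha := hmean.tendsto_div_nhds_zero
  have hb := hvar.tendsto_div_nhds_zero
  -- The exact normalisations are the special case where `a` is the mean and `b` the variance.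
  have ha' : Tendsto (fun t : ℝ≥0 => (Tries.poissonMean p (Tries.additiveFunctional φ) t -
      Tries.poissonMean p (Tries.additiveFunctional φ) t) / √(t : ℝ)) atTop (𝓝 0) := by
    simp
  have hb' : Tendsto (fun t : ℝ≥0 => (Tries.poissonVar p (Tries.additiveFunctional φ) t -
      Tries.poissonVar p (Tries.additiveFunctional φ) t) / (t : ℝ)) atTop (𝓝 0) := by
    simp
  refine ⟨h.approx_div_sqrt ha hb, h.approx_div_sqrt ha' hb', fun ⟨c, hc, hcb⟩ => ?_⟩
  -- The variance inherits linear growth from `b`; half of `c` covers the `o(t)` error.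
  have hcv : ∀ᶠ t : ℝ≥0 in atTop,
      c / 2 * t ≤ Tries.poissonVar p (Tries.additiveFunctional φ) t := by
    filter_upwards [hcb, hb.eventually_const_le (neg_lt_zero.mpr (half_pos hc)),
      eventually_gt_atTop 0] with t h1 h2 h3
    rw [le_div_iff₀ (by exact_mod_cast h3)] at h2
    linarith
  have h1 := h.approx_div_sqrt_variance ha hb hc hcb
  have h2 := h.approx_div_sqrt_variance ha' hb' (half_pos hc) hcv
  exact ⟨⟨h1.1.tendstoInDistribution fun t => (hmeas.sub_const _).div_const _, h1.2⟩,
    ⟨h2.1.tendstoInDistribution fun t => (hmeas.sub_const _).div_const _, h2.2⟩⟩
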